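/- Let $d,n\ge 1$ be integers and let $0<s<1$, $1\le p<\infty$, $0<q\le\infty$ and $-n<\alpha<sp-n$. Then $\big(B^{s-(\alpha+n)/p}_{p,p}(\mathbb R^d),\,F^s_{p,q}(\mathbb R^{d+n},\mu_\alpha)\big)$ is a Whitney trace-extension pair. The notions are as follows; functions are complex-valued. **Measure.** Identify $\mathbb R^d$ with $\mathbb R^d\times\{0\}^n\subset\mathbb R^{d+n}$. The measure $\mu_\alpha$ on $\mathbb R^{d+n}$ has density $\min(1,\operatorname{dist}(x,\mathbb R^d))^\alpha$ with respect to Lebesgue measure. **Spaces.** $\mathcal Q_{N,k}$ ($k\in\mathbb Z$) is the set of dyadic cubes $2^{-k}((0,1]^N+m)$, $m\in\mathbb Z^N$, in $\mathbb R^N$, with edge length $\ell(Q)=2^{-k}$. $Q^x_k$ is the cube in $\mathcal Q_{N,k}$ containing $x$. Write $Q\sim Q'$ if $\frac12\le \ell(Q)/\ell(Q')\le 2$ and $\overline Q\cap\overline{Q'}\ne\emptyset$. For a measure $\mu$, $f_{Q,\mu}$ is the $\mu$-mean of $f$ over $Q$. For $0<\sigma<1$, $$\|f\|_{B^\sigma_{p,q}(\mathbb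 R^N,\mu)}=\|f\|_{L^p(\mu)}+\Big(\sum_{k\ge0}2^{k\sigma q}\Big(\sum_{Q\in\mathcal Q_{N,k}}\mu(Q)\sum_{Q'\sim Q}|f_{Q,\mu}-f_{Q',\mu}|^p\Big)^{q/p}\Big)^{1/q},$$ $$\|f\|_{F^\sigma_{p,q}(\mathbb R^N,\mu)}=\|f\|_{L^p(\mu)}+\Big(\int_{\mathbb R^N}\Big(\sum_{k\ge0}2^{k\sigma q}\sum_{Q'\sim Q^x_k}|f_{Q^x_k,\mu}-f_{Q',\mu}|^q\Big)^{p/q}d\mu(x)\Big)^{1/p}$$ (suprema in place of the $\ell^q$-sums if $q=\infty$); the spaces consist of the locally integrable $f$ for which the quasinorm is finite, and $\mu$ is Lebesgue measure if it is not mentioned. **Whitney extension.** For $Q\in\mathcal Q_{d,k}$ let $\mathcal A_Q$ be the set of $P\in\mathcal Q_{d+n,k}$ with $P\subset (Q\times[-2^{1-k},2^{1-k}]^n)\setminus(Q\times(-2^{-k},2^{-k})^n)$. Let $\psi_P$, for $P\in\mathcal A_Q$ with $\ell(Q)\le1$, be any family of smooth functions $\mathbb R^{d+n}\to[0,1]$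 such that, with constants $C,c>0$ independent of $P$, $\psi_P$ is $C/\ell(P)$-Lipschitz, $\psi_P\ge c$ on $P$, the support of $\psi_P$ lies in the $\ell(P)/4$-neighbourhood of $P$, and $\sum_{\ell(Q)\le 1}\sum_{P\in\mathcal A_Q}\psi_P= 1$ on the union of these cubes $P$. Put $$\mathcal Ef(x)=\sum_{\ell(Q)\le1}\ \sum_{P\in\mathcal A_Q}\Big(\frac1{|Q|}\int_Q f\Big)\psi_P(x).$$ **Whitney trace-extension pair.** For such a family $(\psi_P)$, the statement that $(X,Y)$ is a Whitney trace-extension pair (with $Y$ a space of functions on $(\mathbb R^{d+n},\mu)$) means: the linear operator $\mathcal E$ maps $X$ boundedly into $Y$; for every $f\in Y$ the limit $$\mathcal Rf(x)=\lim_{r\to0}\frac1{\mu(B((x,0),r))}\int_{B((x,0),r)}f\,d\mu$$ exists for almost every $x\in\mathbb R^d$, and $\mathcal Rf$ is locally integrable; the linear operator $\mathcal R$ maps $Y$ boundedly into $X$; and $\mathcal R(\mathcal Ef)=f$ almost everywhere for every $f\in X$. The theorem holds for every such family $(\psi_P)$. -/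

import Mathlib

open scoped ENNReal NNReal Topology

namespace WhitneyTrace

noncomputable section

/-- A dyadic cube `2 ^ (-k) ((0,1]^ι + m)` in `ℝ^ι`, given by its generation `k` and the
integer vector `m`. -/
structure DyadicCube (ι : Type) where
  level : ℤ
  corner : ι → ℤ

namespace DyadicCube

variable {ι : Type}

/-- The edge length `ℓ(Q) = 2 ^ (-k)`. -/
def edge (Q : DyadicCube ι) : ℝ := (2 : ℝ) ^ (-Q.level)

/-- The semi-open cube `2 ^ (-k) ((0,1]^ι + m)` as a set of points. -/
def toSet (Q : DyadicCube ι) : Set (EuclideanSpace ℝ ι) :=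
  {x | ∀ i, Q.edge * (Q.corner i : ℝ) < x i ∧ x i ≤ Q.edge * ((Q.corner i : ℝ) + 1)}

/-- The cube `Q_k^x`: the unique dyadic cube of generation `k` that contains `x`. -/
def at_ (k : ℤ) (x : EuclideanSpace ℝ ι) : DyadicCube ι where
  level := k
  corner := fun i => ⌈(2 : ℝ) ^ k * x i⌉ - 1

/-- The neighbour relation `Q ∼ Q'`. -/
def Neighbor (Q Q' : DyadicCube ι) : Prop :=
  1 / 2 ≤ Q.edge / Q'.edge ∧ Q.edge / Q'.edge ≤ 2 ∧
    (closure Q.toSet ∩ closure Q'.toSet).Nonempty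

end DyadicCube

/-- The `ℓ^q` quasinorm of a family in `[0,∞]`, `0 < q ≤ ∞`; a supremum if `q = ∞`. -/
def lqNorm {κ : Type} (q : ℝ≥0∞) (a : κ → ℝ≥0∞) : ℝ≥0∞ :=
  if q = ∞ then ⨆ j, a j else (∑' j, a j ^ q.toReal) ^ (1 / q.toReal)

section Spaces

variable {ι : Type} [Fintype ι]

/-- `|f_{Q,μ} - f_{Q',μ}|` -/
def avgDiff (μ : MeasureTheory.Measure (EuclideanSpace ℝ ι)) (f : EuclideanSpace ℝ ι → ℂ)
    (Q Q' : DyadicCube ι) : ℝ≥0∞ :=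
  ‖(⨍ y in Q.toSet, f y ∂μ) - (⨍ y in Q'.toSet, f y ∂μ)‖ₑ

/-- The energy part of the Besov norm,
`(∑_{k ≥ 0} 2^{ksq} (∑_{Q of level k} μ(Q) ∑_{Q' ∼ Q} |f_Q - f_Q'|^p)^{q/p})^{1/q}`. -/
def besovEnergy (s p : ℝ) (q : ℝ≥0∞) (μ : MeasureTheory.Measure (EuclideanSpace ℝ ι))
    (f : EuclideanSpace ℝ ι → ℂ) : ℝ≥0∞ :=
  lqNorm q fun k : ℕ => (2 : ℝ≥0∞) ^ ((k : ℝ) * s) *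
    (∑' Q : {Q : DyadicCube ι // Q.level = k}, μ Q.1.toSet *
      ∑' Q' : {Q' : DyadicCube ι // Q.1.Neighbor Q'}, avgDiff μ f Q.1 Q'.1 ^ p) ^ (1 / p)

/-- The Besov quasinorm `‖f‖_{B^s_{p,q}(μ)}`, `1 ≤ p < ∞`. -/
def besovNorm (s p : ℝ) (q : ℝ≥0∞) (μ : MeasureTheory.Measure (EuclideanSpace ℝ ι))
    (f : EuclideanSpace ℝ ι → ℂ) : ℝ≥0∞ :=
  MeasureTheory.eLpNorm f (ENNReal.ofReal p) μ + besovEnergy s p q μ f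

/-- The Besov space `B^s_{p,q}(μ)`, `1 ≤ p < ∞`. -/
def besovSpace (s p : ℝ) (q : ℝ≥0∞) (μ : MeasureTheory.Measure (EuclideanSpace ℝ ι)) :
    Set (EuclideanSpace ℝ ι → ℂ) :=
  {f | MeasureTheory.LocallyIntegrable f MeasureTheory.volume ∧
    MeasureTheory.AEStronglyMeasurable f μ ∧ besovNorm s p q μ f < ∞}

/-- The energy part of the Triebel--Lizorkin norm,
`(∫ (∑_{k ≥ 0} 2^{ksq} ∑_{Q' ∼ Q_k^x} |f_{Q_k^x} - f_Q'|^q)^{p/q} dμ(x))^{1/p}`. -/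
def triebelEnergy (s p : ℝ) (q : ℝ≥0∞) (μ : MeasureTheory.Measure (EuclideanSpace ℝ ι))
    (f : EuclideanSpace ℝ ι → ℂ) : ℝ≥0∞ :=
  (∫⁻ x, (lqNorm q fun k : ℕ => (2 : ℝ≥0∞) ^ ((k : ℝ) * s) *
    lqNorm q fun Q' : {Q' : DyadicCube ι // (DyadicCube.at_ k x).Neighbor Q'} =>
      avgDiff μ f (DyadicCube.at_ k x) Q'.1) ^ p ∂μ) ^ (1 / p)

/-- The Triebel--Lizorkin quasinorm `‖f‖_{F^s_{p,q}(μ)}`, `1 ≤ p < ∞`. -/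
def triebelNorm (s p : ℝ) (q : ℝ≥0∞) (μ : MeasureTheory.Measure (EuclideanSpace ℝ ι))
    (f : EuclideanSpace ℝ ι → ℂ) : ℝ≥0∞ :=
  MeasureTheory.eLpNorm f (ENNReal.ofReal p) μ + triebelEnergy s p q μ f

/-- The Triebel--Lizorkin space `F^s_{p,q}(μ)`, `1 ≤ p < ∞`. -/
def triebelSpace (s p : ℝ) (q : ℝ≥0∞) (μ : MeasureTheory.Measure (EuclideanSpace ℝ ι)) :
    Set (EuclideanSpace ℝ ι → ℂ) :=
  {f | MeasureTheory.LocallyIntegrable f MeasureTheory.volume ∧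
    MeasureTheory.AEStronglyMeasurable f μ ∧ triebelNorm s p q μ f < ∞}

end Spaces

section Codimension

variable {d n : ℕ}

/-- The subspace `ℝ^d × {0}^n` of `ℝ^{d+n}`. The coordinates of `ℝ^{d+n}` are indexed by
`Fin d ⊕ Fin n`, the first `d` by `Sum.inl`, the last `n` by `Sum.inr`. -/
def plane (d n : ℕ) : Set (EuclideanSpace ℝ (Fin d ⊕ Fin n)) :=
  {x | ∀ j, x (Sum.inr j) = 0}

/-- The point `(x, 0)` of `ℝ^{d+n}`. -/
def embed (n : ℕ) (x : EuclideanSpace ℝ (Fin d)) : EuclideanSpace ℝ (Fin d ⊕ Fin n) :=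
  WithLp.toLp 2 (Sum.elim (fun i => x i) fun _ => 0)

/-- The measure `μ_α` with density `min(1, dist(x, ℝ^d))^α` with respect to Lebesgue measure. -/
def weightMeasure (d n : ℕ) (α : ℝ) : MeasureTheory.Measure (EuclideanSpace ℝ (Fin d ⊕ Fin n)) :=
  MeasureTheory.volume.withDensity fun x =>
    ENNReal.ofReal (min 1 (Metric.infDist x (plane d n)) ^ α)

/-- The product `Q × S^n` in `ℝ^{d+n}`, for `S ⊆ ℝ`. -/
def cylinder (n : ℕ) (Q : DyadicCube (Fin d)) (S : Set ℝ) :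
    Set (EuclideanSpace ℝ (Fin d ⊕ Fin n)) :=
  {x | WithLp.toLp 2 (fun i => x (Sum.inl i)) ∈ Q.toSet ∧ ∀ j, x (Sum.inr j) ∈ S}

/-- The family `A_Q` of Whitney cubes over `Q`. -/
def whitneyCubes (n : ℕ) (Q : DyadicCube (Fin d)) : Set (DyadicCube (Fin d ⊕ Fin n)) :=
  {P | P.level = Q.level ∧
    P.toSet ⊆ cylinder n Q (Set.Icc (-(2 * Q.edge)) (2 * Q.edge)) \
      cylinder n Q (Set.Ioo (-Q.edge) Q.edge)}

/-- `ψ` is a smooth partition of unity subordinate to the Whitney cubes of edge length at most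
`1`: only the functions `ψ P` with `P ∈ A_Q`, `ℓ(Q) ≤ 1`, are restricted and used. -/
structure IsWhitneyBumpFamily
    (ψ : DyadicCube (Fin d ⊕ Fin n) → EuclideanSpace ℝ (Fin d ⊕ Fin n) → ℝ) : Prop where
  smooth : ∀ Q : DyadicCube (Fin d), 0 ≤ Q.level → ∀ P ∈ whitneyCubes n Q,
    ContDiff ℝ ((⊤ : ℕ∞) : WithTop ℕ∞) (ψ P)
  range : ∀ Q : DyadicCube (Fin d), 0 ≤ Q.level → ∀ P ∈ whitneyCubes n Q,
    ∀ x, ψ P x ∈ Set.Icc (0 : ℝ) 1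
  lipschitz : ∃ C : ℝ, ∀ Q : DyadicCube (Fin d), 0 ≤ Q.level → ∀ P ∈ whitneyCubes n Q,
    ∀ x y, |ψ P x - ψ P y| ≤ C / P.edge * dist x y
  lower_bound : ∃ c : ℝ, 0 < c ∧ ∀ Q : DyadicCube (Fin d), 0 ≤ Q.level →
    ∀ P ∈ whitneyCubes n Q, ∀ x ∈ P.toSet, c ≤ ψ P x
  support : ∀ Q : DyadicCube (Fin d), 0 ≤ Q.level → ∀ P ∈ whitneyCubes n Q,
    tsupport (ψ P) ⊆ Metric.thickening (P.edge / 4) P.toSet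
  sum_eq_one : ∀ Q₀ : DyadicCube (Fin d), 0 ≤ Q₀.level → ∀ P₀ ∈ whitneyCubes n Q₀,
    ∀ x ∈ P₀.toSet,
      ∑' Q : {Q : DyadicCube (Fin d) // 0 ≤ Q.level}, ∑' P : whitneyCubes n Q.1, ψ P.1 x = 1

/-- The Whitney extension of `f`; at every point only finitely many terms are nonzero. -/
def whitneyExt (ψ : DyadicCube (Fin d ⊕ Fin n) → EuclideanSpace ℝ (Fin d ⊕ Fin n) → ℝ)
    (f : EuclideanSpace ℝ (Fin d) → ℂ) (x : EuclideanSpace ℝ (Fin d ⊕ Fin n)) : ℂ :=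
  ∑' Q : {Q : DyadicCube (Fin d) // 0 ≤ Q.level}, ∑' P : whitneyCubes n Q.1,
    (⨍ y in Q.1.toSet, f y ∂MeasureTheory.volume) * (ψ P.1 x : ℂ)

/-- The mean value of `f` with respect to `μ` over the ball `B((x,0), r)`. -/
def ballMean (μ : MeasureTheory.Measure (EuclideanSpace ℝ (Fin d ⊕ Fin n)))
    (f : EuclideanSpace ℝ (Fin d ⊕ Fin n) → ℂ) (x : EuclideanSpace ℝ (Fin d)) (r : ℝ) : ℂ :=
  ⨍ y in Metric.ball (embed n x) r, f y ∂μ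

/-- The trace `(R f)(x) = lim_{r → 0} ⨍_{B((x,0), r)} f dμ`, meaningful where the limit exists. -/
def trace (μ : MeasureTheory.Measure (EuclideanSpace ℝ (Fin d ⊕ Fin n)))
    (f : EuclideanSpace ℝ (Fin d ⊕ Fin n) → ℂ) (x : EuclideanSpace ℝ (Fin d)) : ℂ :=
  Filter.limUnder (𝓝[>] (0 : ℝ)) (ballMean μ f x)

/-- `(X, Y)` is a Whitney trace-extension pair, for the extension operator built from `ψ`. Here
`X` is a space of functions on `ℝ^d` with quasinorm `NX` and `Y` is a space of functions on
`ℝ^{d+n}` with measure `μ` and quasinorm `NY`. Continuity of the (linear) extension and trace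
operators is expressed as boundedness. -/
structure IsWhitneyTraceExtensionPair
    (ψ : DyadicCube (Fin d ⊕ Fin n) → EuclideanSpace ℝ (Fin d ⊕ Fin n) → ℝ)
    (μ : MeasureTheory.Measure (EuclideanSpace ℝ (Fin d ⊕ Fin n)))
    (X : Set (EuclideanSpace ℝ (Fin d) → ℂ)) (NX : (EuclideanSpace ℝ (Fin d) → ℂ) → ℝ≥0∞)
    (Y : Set (EuclideanSpace ℝ (Fin d ⊕ Fin n) → ℂ))
    (NY : (EuclideanSpace ℝ (Fin d ⊕ Fin n) → ℂ) → ℝ≥0∞) : Prop where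
  ext_mem : ∀ f ∈ X, whitneyExt ψ f ∈ Y
  ext_bounded : ∃ C : ℝ≥0, ∀ f ∈ X, NY (whitneyExt ψ f) ≤ C * NX f
  trace_exists : ∀ f ∈ Y, ∀ᵐ x : EuclideanSpace ℝ (Fin d),
    Filter.Tendsto (ballMean μ f x) (𝓝[>] 0) (𝓝 (trace μ f x))
  trace_locallyIntegrable : ∀ f ∈ Y,
    MeasureTheory.LocallyIntegrable (trace μ f) MeasureTheory.volume
  trace_mem : ∀ f ∈ Y, trace μ f ∈ X
  trace_bounded : ∃ C : ℝ≥0, ∀ f ∈ Y, NX (trace μ f) ≤ C * NY f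
  trace_ext : ∀ f ∈ X, ∀ᵐ x : EuclideanSpace ℝ (Fin d), trace μ (whitneyExt ψ f) x = f x

end Codimension

end

end WhitneyTrace

/-!
Points of `ℝ^{d+n}` are written as pairs `(x, v)`, and `σ = s - (α + n) / p`; the hypotheses on `α`
say that `n + α > 0` and `σ > 0`. Both directions pass through a scale-by-scale description of
functions on `ℝ^d`. Let values `a(Q)` be attached to the dyadic cubes, with a limit `g(x)` along the
cubes containing `x`, and let the jump of `a` at `Q` be the largest `|a(Q) - a(Q')|`, `Q' ∼ Q`. If
the jumps at scale `2^{-k}`, multiplied by `2^{kσ}`, are `p`-summable over `k` and `x`, and `g` is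
in `L^p`, then so are the mean oscillations of `g` (`exists_isOscBound`, a discrete Hardy
inequality), and these control the Besov energy of `g` (`exists_besovEnergy_le`). With `a(Q)` the
mean of `g` over `Q`, conversely, the Besov norm controls the oscillations
(`exists_isOscBound_of_besov`).

*Extension.* Near a point at distance about `2^{-j} ≤ 1` from the subspace, the extension is a
convex combination of means of `f` over boundedly many cubes of edge about `2^{-j}`, with coefficients
that are Lipschitz at that scale (`exists_whitneyExt_local_le`). Hence the differences of its means at
scale `2^{-k}` are bounded by the oscillation of `f` at scale `2^{-k}` if `k ≤ j`, and by
`2^{-(k-j)}` times the oscillation at scale `2^{-j}` if `k > j` (`exists_avgDiff_whitneyExt_le`). As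
`s < 1`, the scales `k > j` sum up geometrically. Giving up a part of the decay `2^{-i(n+α)}` of the
integral of the weight over `|v| < 2^{-i}`, the scales `i ≤ j` can be summed for every `q` as
well, and integration over the fibres turns the weight `2^{is}` into `2^{iσ}`
(`exists_triebelEnergy_whitneyExt_le`). At a Lebesgue point of `f` the means of the extension over
small balls converge to `f` (`ae_tendsto_ballMean_whitneyExt`).

*Trace.* For `f` on `ℝ^{d+n}` let `a(Q)` be the `μ_α`-mean of `f` over the cube `Q × (-ℓ(Q), 0]^n`.
The jumps of `a` at scale `2^{-k}` are jumps of the means of `f`, seen at every point over `Q` whose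
normal coordinates lie between `-2^{-k}` and `-2^{-k-1}`. These layers are disjoint, so only the
supremum over the scales enters at each point, and every Triebel-Lizorkin energy dominates it
(`exists_tsum_maxJump_lift_le`). Thus `a` has a limit almost everywhere. Since `n + α < s p`, the
mean oscillation of `f` around `a(Q)` over the balls of radius `2^{-k}` centred on the subspace
tends to zero almost everywhere (`ae_tendsto_setLIntegral_sub_average_lift`), so this limit is the
trace, and the description above gives the Besov bound (`exists_besovNorm_trace_le`).

All estimates are carried out in `[0, ∞]`, so that no integrability or summability has to be known
in advance. Sums over cubes of a generation are integrals of functions of `DyadicCube.at_ k x`.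
-/

namespace WhitneyTrace

open MeasureTheory Set Filter

/-! ### Powers of two and geometric sums in `[0, ∞]` -/

theorem two_rpow_add (a b : ℝ) : (2 : ℝ≥0∞) ^ (a + b) = 2 ^ a * 2 ^ b :=
  ENNReal.rpow_add a b (by norm_num) (by norm_num)

theorem two_rpow_ne_top (a : ℝ) : (2 : ℝ≥0∞) ^ a ≠ ∞ := by
  simp [ENNReal.rpow_eq_top_iff]

theorem two_rpow_ne_zero (a : ℝ) : (2 : ℝ≥0∞) ^ a ≠ 0 := by
  simp [ENNReal.rpow_eq_zero_iff]

theorem two_rpow_mono {a b : ℝ} (h : a ≤ b) : (2 : ℝ≥0∞) ^ a ≤ 2 ^ b :=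
  ENNReal.rpow_le_rpow_of_exponent_le (by norm_num) h

theorem two_rpow_neg_mul (a : ℝ) : (2 : ℝ≥0∞) ^ (-a) * 2 ^ a = 1 := by
  rw [← two_rpow_add]; simp

theorem ofReal_two_rpow (a : ℝ) : ENNReal.ofReal ((2 : ℝ) ^ a) = (2 : ℝ≥0∞) ^ a := by
  rw [← ENNReal.ofReal_rpow_of_pos (by norm_num)]; simp

theorem ofReal_two_zpow (k : ℤ) : ENNReal.ofReal ((2 : ℝ) ^ k) = (2 : ℝ≥0∞) ^ (k : ℝ) := by
  rw [← ofReal_two_rpow, Real.rpow_intCast]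

theorem two_rpow_rpow (a b : ℝ) : ((2 : ℝ≥0∞) ^ a) ^ b = 2 ^ (a * b) :=
  (ENNReal.rpow_mul _ _ _).symm

theorem tsum_two_rpow_lt_top {a : ℝ} (ha : 0 < a) : ∑' k : ℕ, (2 : ℝ≥0∞) ^ (-(a * k)) < ∞ := by
  have h : ∀ k : ℕ, (2 : ℝ≥0∞) ^ (-(a * k)) = ((2 : ℝ≥0∞) ^ (-a)) ^ k := fun k => by
    rw [← ENNReal.rpow_natCast, two_rpow_rpow]; ring_nf
  simp_rw [h, ENNReal.tsum_geometric]
  rw [ENNReal.inv_lt_top, tsub_pos_iff_lt, ← ofReal_two_rpow, ENNReal.ofReal_lt_one]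
  exact Real.rpow_lt_one_of_one_lt_of_neg (by norm_num) (by linarith)

theorem tsum_two_rpow_abs_le {a : ℝ} (j : ℕ) :
    ∑' k : ℕ, (2 : ℝ≥0∞) ^ (-(a * |(k : ℝ) - j|)) ≤ 2 * ∑' k : ℕ, (2 : ℝ≥0∞) ^ (-(a * k)) := by
  rw [← ENNReal.summable.sum_add_tsum_nat_add' (k := j), two_mul]
  refine add_le_add ?_ (le_of_eq (tsum_congr fun k => by simp))
  · rw [← Finset.sum_range_reflect]
    calc _ ≤ ∑ k ∈ Finset.range j, (2 : ℝ≥0∞) ^ (-(a * ((k + 1 : ℕ) : ℝ))) := by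
          refine Finset.sum_le_sum fun k hk => ?_
          have hk' := Finset.mem_range.1 hk
          rw [Nat.sub_sub, Nat.cast_sub (by omega), abs_sub_comm, sub_sub_cancel, add_comm,
            Nat.abs_cast]
      _ ≤ _ := by
          refine (ENNReal.sum_le_tsum _).trans ?_
          exact ENNReal.tsum_comp_le_tsum_of_injective (f := fun k : ℕ => k + 1)
            (add_left_injective 1) (fun k : ℕ => (2 : ℝ≥0∞) ^ (-(a * (k : ℝ))))

/-- One term of a sequence against a weighted `ℓ^p` sum, with a geometric gain away from the index
`j`. Summed in any `ℓ^q` quasinorm the gain costs a constant, so that `q` becomes irrelevant. -/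
theorem sum_le_of_weight_le {a p : ℝ} (hp : 0 < p) (b : ℕ → ℝ≥0∞) (j i : ℕ) :
    b i ≤ 2 ^ (-(a * |(i : ℝ) - j|)) *
      (∑' i : ℕ, (2 ^ (a * |(i : ℝ) - j|) * b i) ^ p) ^ (1 / p) := by
  have h : (2 : ℝ≥0∞) ^ (a * |(i : ℝ) - j|) * b i ≤
      (∑' i : ℕ, (2 ^ (a * |(i : ℝ) - j|) * b i) ^ p) ^ (1 / p) := by
    rw [one_div, ENNReal.le_rpow_inv_iff hp]
    exact ENNReal.le_tsum (f := fun i : ℕ => ((2 : ℝ≥0∞) ^ (a * |(i : ℝ) - j|) * b i) ^ p) i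
  calc b i = 2 ^ (-(a * |(i : ℝ) - j|)) * (2 ^ (a * |(i : ℝ) - j|) * b i) := by
        rw [← mul_assoc, two_rpow_neg_mul, one_mul]
    _ ≤ _ := by gcongr

/-- A weighted form of Hölder's inequality for sums that works for every `p > 0`. -/
theorem tsum_rpow_le {a p : ℝ} (hp : 0 < p) (b : ℕ → ℝ≥0∞) :
    (∑' k, b k) ^ p ≤
      (∑' k : ℕ, (2 : ℝ≥0∞) ^ (-(a * k))) ^ p * ∑' k : ℕ, (2 ^ (a * k) * b k) ^ p := by
  have h := fun i => sum_le_of_weight_le (a := a) hp b 0 i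
  simp only [Nat.cast_zero, sub_zero, Nat.abs_cast] at h
  calc (∑' k, b k) ^ p ≤ (∑' i : ℕ, 2 ^ (-(a * i)) *
        (∑' i : ℕ, (2 ^ (a * i) * b i) ^ p) ^ (1 / p)) ^ p := by
        gcongr with i; exact h i
    _ = _ := by
        rw [ENNReal.tsum_mul_right, ENNReal.mul_rpow_of_nonneg _ _ hp.le, ← ENNReal.rpow_mul,
          one_div_mul_cancel hp.ne', ENNReal.rpow_one]

theorem add_rpow_le {p : ℝ} (hp : 0 < p) (a b : ℝ≥0∞) :
    (a + b) ^ p ≤ 2 ^ p * (a ^ p + b ^ p) := by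
  calc (a + b) ^ p ≤ (2 * max a b) ^ p := by
        gcongr; rw [two_mul]; exact add_le_add (le_max_left _ _) (le_max_right _ _)
    _ = 2 ^ p * (max a b) ^ p := ENNReal.mul_rpow_of_nonneg _ _ hp.le
    _ ≤ _ := by
        gcongr
        rcases le_total a b with h | h
        · rw [max_eq_right h]; exact le_add_self
        · rw [max_eq_left h]; exact le_self_add

theorem rpow_lintegral_le {X : Type*} [MeasurableSpace X] {μ : Measure X} {p : ℝ} (hp : 1 ≤ p)
    {g : X → ℝ≥0∞} (hg : AEMeasurable g μ) :
    (∫⁻ x, g x ∂μ) ^ p ≤ μ univ ^ (p - 1) * ∫⁻ x, g x ^ p ∂μ := by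
  have hp0 : 0 < p := by linarith
  have h := eLpNorm'_le_eLpNorm'_mul_rpow_measure_univ (μ := μ) (f := g) one_pos hp
    hg.aestronglyMeasurable
  simp only [eLpNorm', enorm_eq_self, ENNReal.rpow_one, div_one] at h
  calc _ ≤ ((∫⁻ x, g x ^ p ∂μ) ^ (1 / p) * μ univ ^ (1 - 1 / p)) ^ p := by gcongr
    _ = _ := by
      rw [ENNReal.mul_rpow_of_nonneg _ _ hp0.le, ← ENNReal.rpow_mul, ← ENNReal.rpow_mul,
        one_div_mul_cancel hp0.ne', ENNReal.rpow_one, mul_comm]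
      congr 2; field_simp

/-! ### The `ℓ^q` quasinorm -/

theorem le_lqNorm {κ : Type} {q : ℝ≥0∞} (hq : 0 < q) (a : κ → ℝ≥0∞) (j : κ) : a j ≤ lqNorm q a := by
  unfold lqNorm
  split_ifs with h
  · exact le_iSup a j
  · have : 0 < q.toReal := ENNReal.toReal_pos hq.ne' h
    rw [one_div, ENNReal.le_rpow_inv_iff this]
    exact ENNReal.le_tsum (f := fun j => a j ^ q.toReal) j

theorem lqNorm_mono {κ : Type} {q : ℝ≥0∞} {a b : κ → ℝ≥0∞} (h : ∀ j, a j ≤ b j) :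
    lqNorm q a ≤ lqNorm q b := by
  unfold lqNorm
  split_ifs
  · exact iSup_mono h
  · gcongr with j; exact h j

theorem lqNorm_mul_right {κ : Type} {q : ℝ≥0∞} (hq : 0 < q) (a : κ → ℝ≥0∞) (S : ℝ≥0∞) :
    lqNorm q (fun j => a j * S) = lqNorm q a * S := by
  unfold lqNorm
  split_ifs with h
  · rw [ENNReal.iSup_mul]
  · have : 0 < q.toReal := ENNReal.toReal_pos hq.ne' h
    simp_rw [ENNReal.mul_rpow_of_nonneg _ _ this.le]
    rw [ENNReal.tsum_mul_right, ENNReal.mul_rpow_of_nonneg _ _ (by positivity), ← ENNReal.rpow_mul,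
      mul_one_div_cancel this.ne', ENNReal.rpow_one]

theorem lqNorm_const_le {κ : Type} {q : ℝ≥0∞} (hq : 0 < q) {N : ℕ}
    (h : ENat.card κ ≤ N) (A : ℝ≥0∞) :
    lqNorm q (fun _ : κ => A) ≤ (N : ℝ≥0∞) ^ (1 / q.toReal) * A := by
  unfold lqNorm
  split_ifs with hq'
  · simp [hq']
  · have hq0 : 0 < q.toReal := ENNReal.toReal_pos hq.ne' hq'
    rw [ENNReal.tsum_const]
    calc _ ≤ ((N : ℝ≥0∞) * A ^ q.toReal) ^ (1 / q.toReal) := by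
          gcongr; exact_mod_cast h
      _ = _ := by
        rw [ENNReal.mul_rpow_of_nonneg _ _ (by positivity), ← ENNReal.rpow_mul,
          mul_one_div_cancel hq0.ne', ENNReal.rpow_one]

/-- A sequence in `ℓ^q` that decays geometrically away from some index has its quasinorm bounded
independently of that index. -/
theorem exists_lqNorm_two_rpow_le {q : ℝ≥0∞} (hq : 0 < q) {a : ℝ} (ha : 0 < a) :
    ∃ C : ℝ≥0, ∀ j : ℕ, lqNorm q (fun k : ℕ => (2 : ℝ≥0∞) ^ (-(a * |(k : ℝ) - j|))) ≤ C := by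
  by_cases h : q = ∞
  · refine ⟨1, fun j => ?_⟩
    simp only [lqNorm, h, if_true]
    refine iSup_le fun k => ?_
    calc (2 : ℝ≥0∞) ^ (-(a * |(k : ℝ) - j|)) ≤ 2 ^ (0 : ℝ) :=
          two_rpow_mono (by have := abs_nonneg ((k : ℝ) - j); nlinarith)
      _ = _ := by simp
  · have hq0 : 0 < q.toReal := ENNReal.toReal_pos hq.ne' h
    have hfin := tsum_two_rpow_lt_top (mul_pos ha hq0)
    have hfin2 : (2 * ∑' k : ℕ, (2 : ℝ≥0∞) ^ (-(a * q.toReal * k))) ^ (1 / q.toReal) ≠ ∞ :=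
      ENNReal.rpow_ne_top_of_nonneg (by positivity) (ENNReal.mul_ne_top (by simp) hfin.ne)
    refine ⟨ENNReal.toNNReal _, fun j => (le_of_le_of_eq ?_ (ENNReal.coe_toNNReal hfin2).symm)⟩
    simp only [lqNorm, h, if_false, two_rpow_rpow]
    gcongr
    refine le_trans (le_of_eq ?_) (tsum_two_rpow_abs_le j)
    congr 1; ext k; congr 1; ring

/-! ### Dyadic cubes -/

namespace DyadicCube

variable {ι : Type}

theorem edge_pos (Q : DyadicCube ι) : 0 < Q.edge := zpow_pos (by norm_num) _

theorem edge_at (k : ℤ) (x : EuclideanSpace ℝ ι) : (at_ k x).edge = (2 : ℝ) ^ (-k) := rfl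

theorem mem_at (k : ℤ) (x : EuclideanSpace ℝ ι) : x ∈ (at_ k x).toSet := by
  intro i
  have h2 : (0 : ℝ) < 2 ^ k := zpow_pos (by norm_num) _
  have h1 := Int.le_ceil ((2 : ℝ) ^ k * x i)
  have h3 := Int.ceil_lt_add_one ((2 : ℝ) ^ k * x i)
  have he : (at_ k x).edge = ((2 : ℝ) ^ k)⁻¹ := by rw [edge_at, zpow_neg]
  rw [he]
  simp only [at_]
  push_cast
  rw [inv_mul_lt_iff₀ h2, le_inv_mul_iff₀ h2]
  constructor <;> linarith

theorem eq_at_of_mem {Q : DyadicCube ι} {x : EuclideanSpace ℝ ι} (h : x ∈ Q.toSet) :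
    at_ Q.level x = Q := by
  have h2 : (0 : ℝ) < 2 ^ Q.level := zpow_pos (by norm_num) _
  cases Q with
  | mk k m =>
    simp only [at_, mk.injEq, true_and]
    ext i
    have := h i
    simp only [edge, zpow_neg] at this h2
    rw [inv_mul_lt_iff₀ h2, le_inv_mul_iff₀ h2] at this
    have : ⌈(2 : ℝ) ^ k * x i⌉ = m i + 1 := by
      rw [Int.ceil_eq_iff]; push_cast; constructor <;> linarith
    omega

theorem toSet_nonempty (Q : DyadicCube ι) : Q.toSet.Nonempty := by
  refine ⟨WithLp.toLp 2 fun i => Q.edge * ((Q.corner i : ℝ) + 1), fun i => ⟨?_, le_rfl⟩⟩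
  have := Q.edge_pos
  simp only; nlinarith

section

theorem toSet_eq_preimage (Q : DyadicCube ι) : Q.toSet = WithLp.ofLp ⁻¹' (Set.pi univ fun i =>
    Ioc (Q.edge * (Q.corner i : ℝ)) (Q.edge * ((Q.corner i : ℝ) + 1))) := by
  ext x; simp [toSet, Set.mem_pi]

theorem mem_closure_toSet {Q : DyadicCube ι} {x : EuclideanSpace ℝ ι} :
    x ∈ closure Q.toSet ↔
      ∀ i, x i ∈ Icc (Q.edge * (Q.corner i : ℝ)) (Q.edge * ((Q.corner i : ℝ) + 1)) := by
  have h : (WithLp.ofLp : EuclideanSpace ℝ ι → ι → ℝ) =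
    ⇑(PiLp.homeomorph 2 (fun _ : ι => ℝ)) := rfl
  rw [toSet_eq_preimage, h, ← Homeomorph.preimage_closure, closure_pi_set]
  have h2 : ∀ i, closure (Ioc (Q.edge * (Q.corner i : ℝ)) (Q.edge * ((Q.corner i : ℝ) + 1))) =
      Icc (Q.edge * (Q.corner i : ℝ)) (Q.edge * ((Q.corner i : ℝ) + 1)) := fun i =>
    closure_Ioc (by have := Q.edge_pos; nlinarith)
  simp only [h2, mem_preimage, Set.mem_pi, mem_univ, true_imp_iff]

theorem neighbor_iff {Q Q' : DyadicCube ι} : Q.Neighbor Q' ↔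
    |Q'.level - Q.level| ≤ 1 ∧ (closure Q.toSet ∩ closure Q'.toSet).Nonempty := by
  have h : Q.edge / Q'.edge = (2 : ℝ) ^ (Q'.level - Q.level) := by
    rw [edge, edge, ← zpow_sub₀ (by norm_num)]; congr 1; ring
  have h1 : (1 / 2 : ℝ) = 2 ^ (-1 : ℤ) := by norm_num
  have h2 : (2 : ℝ) = 2 ^ (1 : ℤ) := by norm_num
  rw [Neighbor, h, h1]
  nth_rw 4 [h2]
  rw [zpow_le_zpow_iff_right₀ (by norm_num), zpow_le_zpow_iff_right₀ (by norm_num), abs_le,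
    and_assoc]

theorem neighbor_of_mem {Q Q' : DyadicCube ι} (h : |Q'.level - Q.level| ≤ 1)
    {x : EuclideanSpace ℝ ι} (hx : x ∈ Q.toSet) (hx' : x ∈ Q'.toSet) : Q.Neighbor Q' :=
  neighbor_iff.2 ⟨h, x, subset_closure hx, subset_closure hx'⟩

theorem neighbor_at_succ (k : ℤ) (x : EuclideanSpace ℝ ι) : (at_ k x).Neighbor (at_ (k + 1) x) :=
  neighbor_of_mem (by simp [at_]) (mem_at _ _) (mem_at _ _)

/-- The cubes of generation `k` around two points whose coordinates differ by at most the edge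
length are neighbours. -/
theorem neighbor_at_of_abs_le {k : ℤ} {x z : EuclideanSpace ℝ ι}
    (h : ∀ i, |x i - z i| ≤ (2 : ℝ) ^ (-k)) : (at_ k x).Neighbor (at_ k z) := by
  have h2 : (0 : ℝ) < 2 ^ k := zpow_pos (by norm_num) _
  -- corresponding corners differ by at most `1`, so the larger ones give a common boundary point
  refine neighbor_iff.2 ⟨by simp [at_], WithLp.toLp 2 fun i =>
    (2 : ℝ) ^ (-k) * max ((at_ k x).corner i : ℝ) ((at_ k z).corner i), ?_, ?_⟩ <;>
  · rw [mem_closure_toSet]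
    intro i
    have hi := h i
    have hc : |(2 : ℝ) ^ k * x i - 2 ^ k * z i| ≤ 1 := by
      rw [← mul_sub, abs_mul, abs_of_pos h2]
      calc _ ≤ (2 : ℝ) ^ k * 2 ^ (-k) := by gcongr
        _ = 1 := by rw [← zpow_add₀ (by norm_num)]; simp
    rw [abs_le] at hc
    have c1 : ⌈(2 : ℝ) ^ k * x i⌉ ≤ ⌈(2 : ℝ) ^ k * z i⌉ + 1 := by
      rw [← Int.ceil_add_one]; exact Int.ceil_mono (by linarith)
    have c2 : ⌈(2 : ℝ) ^ k * z i⌉ ≤ ⌈(2 : ℝ) ^ k * x i⌉ + 1 := by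
      rw [← Int.ceil_add_one]; exact Int.ceil_mono (by linarith)
    have c1' : ((⌈(2 : ℝ) ^ k * x i⌉ : ℤ) : ℝ) ≤ ⌈(2 : ℝ) ^ k * z i⌉ + 1 := by exact_mod_cast c1
    have c2' : ((⌈(2 : ℝ) ^ k * z i⌉ : ℤ) : ℝ) ≤ ⌈(2 : ℝ) ^ k * x i⌉ + 1 := by exact_mod_cast c2
    have he : (0 : ℝ) ≤ 2 ^ (-k) := zpow_nonneg (by norm_num) _
    simp only [mem_Icc, edge_at]
    refine ⟨mul_le_mul_of_nonneg_left ?_ he, mul_le_mul_of_nonneg_left ?_ he⟩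
    · simp
    · simp only [at_]
      push_cast
      exact max_le (by linarith) (by linarith)

theorem Neighbor.edge_le {Q Q' : DyadicCube ι} (h : Q.Neighbor Q') : Q'.edge ≤ 2 * Q.edge := by
  have := h.1
  rw [le_div_iff₀ Q'.edge_pos] at this
  linarith

variable [Fintype ι]

theorem dist_le_of_abs_le {x y : EuclideanSpace ℝ ι} {a : ℝ} (ha : 0 ≤ a)
    (h : ∀ i, |x i - y i| ≤ a) : dist x y ≤ Fintype.card ι * a := by
  rw [EuclideanSpace.dist_eq]
  refine Real.sqrt_le_iff.2 ⟨by positivity, ?_⟩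
  calc ∑ i, dist (x i) (y i) ^ 2 ≤ ∑ _i : ι, a ^ 2 := by
        gcongr with i; exact h i
    _ = Fintype.card ι * a ^ 2 := by simp
    _ ≤ _ := by
      rw [mul_pow]
      gcongr
      rcases Nat.eq_zero_or_pos (Fintype.card ι) with h | h
      · simp [h]
      · have : (1 : ℝ) ≤ Fintype.card ι := by exact_mod_cast h
        nlinarith

theorem abs_coord_sub_le (x y : EuclideanSpace ℝ ι) (i : ι) : |x i - y i| ≤ dist x y := by
  rw [dist_eq_norm, ← Real.norm_eq_abs]
  exact PiLp.norm_apply_le (x - y) i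

theorem dist_le_of_mem {Q : DyadicCube ι} {x y : EuclideanSpace ℝ ι} (hx : x ∈ closure Q.toSet)
    (hy : y ∈ closure Q.toSet) : dist x y ≤ Fintype.card ι * Q.edge := by
  rw [mem_closure_toSet] at hx hy
  refine dist_le_of_abs_le Q.edge_pos.le fun i => ?_
  have h1 := hx i
  have h2 := hy i
  rw [abs_le]
  constructor <;> linarith [h1.1, h1.2, h2.1, h2.2]

theorem Neighbor.subset_closedBall {Q Q' : DyadicCube ι} (h : Q.Neighbor Q')
    {x : EuclideanSpace ℝ ι} (hx : x ∈ Q.toSet) :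
    Q'.toSet ⊆ Metric.closedBall x (3 * Fintype.card ι * Q.edge) := by
  intro z hz
  obtain ⟨w, hw, hw'⟩ := h.2.2
  have h1 := dist_le_of_mem (subset_closure hz) hw'
  have h2 := dist_le_of_mem hw (subset_closure hx)
  have h3 := h.edge_le
  have : (0 : ℝ) ≤ Fintype.card ι := by positivity
  rw [Metric.mem_closedBall]
  calc dist z x ≤ dist z w + dist w x := dist_triangle _ _ _
    _ ≤ Fintype.card ι * (2 * Q.edge) + Fintype.card ι * Q.edge := by
      refine add_le_add (h1.trans ?_) h2; gcongr
    _ = _ := by ring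

/-- Boundedly many dyadic cubes of size comparable to `2 ^ (-k)` fit into a ball of comparable
radius. -/
theorem exists_encard_le (κ : ℕ) (A : ℕ) : ∃ N : ℕ, ∀ (k : ℤ) (y : EuclideanSpace ℝ ι),
    {P : DyadicCube ι | |P.level - k| ≤ κ ∧
      P.toSet ⊆ Metric.closedBall y (A * 2 ^ (-k))}.encard ≤ N := by
  classical
  set B : ℕ := A * 2 ^ κ
  refine ⟨(2 * κ + 1) * (2 * B + 1) ^ Fintype.card ι, fun k y => ?_⟩
  -- a cube of generation `l` in the ball has its corner within `B` of the corner of `at_ l y`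
  set F : Finset (DyadicCube ι) := (Finset.Icc (k - κ) (k + κ)).biUnion fun l =>
    (Fintype.piFinset fun i => Finset.Icc (⌈(2 : ℝ) ^ l * y i⌉ - 1 - B)
      (⌈(2 : ℝ) ^ l * y i⌉ - 1 + B)).image fun c => ⟨l, c⟩
  have hF : {P : DyadicCube ι | |P.level - k| ≤ κ ∧
      P.toSet ⊆ Metric.closedBall y (A * 2 ^ (-k))} ⊆ (F : Set (DyadicCube ι)) := by
    rintro ⟨l, c⟩ ⟨h1, h2⟩
    simp only [F, Finset.coe_biUnion, mem_iUnion, Finset.coe_image, mem_image, Finset.mem_coe,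
      Finset.mem_Icc, Fintype.mem_piFinset, mk.injEq]
    simp only [abs_le] at h1
    refine ⟨l, ⟨by omega, by omega⟩, c, fun i => ?_, rfl, rfl⟩
    obtain ⟨z, hz⟩ := toSet_nonempty ⟨l, c⟩
    have hz' := eq_at_of_mem hz
    have hc : ⌈(2 : ℝ) ^ l * z i⌉ - 1 = c i := by
      have := congrArg (fun P => P.corner i) hz'; exact this
    have hzy := (abs_coord_sub_le z y i).trans (Metric.mem_closedBall.1 (h2 hz))
    have hl : (0 : ℝ) < 2 ^ l := zpow_pos (by norm_num) _
    have : |(2 : ℝ) ^ l * z i - 2 ^ l * y i| ≤ B := by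
      rw [← mul_sub, abs_mul, abs_of_pos hl]
      calc _ ≤ (2 : ℝ) ^ l * (A * 2 ^ (-k)) := by gcongr
        _ = A * 2 ^ (l - k) := by rw [sub_eq_add_neg, zpow_add₀ (by norm_num)]; ring
        _ ≤ A * 2 ^ (κ : ℤ) := by gcongr; · norm_num
                                  · omega
        _ = _ := by simp [B]
    rw [abs_le] at this
    have c1 : ⌈(2 : ℝ) ^ l * z i⌉ ≤ ⌈(2 : ℝ) ^ l * y i⌉ + B := by
      rw [← Int.ceil_add_natCast]; exact Int.ceil_mono (by linarith)
    have c2 : ⌈(2 : ℝ) ^ l * y i⌉ ≤ ⌈(2 : ℝ) ^ l * z i⌉ + B := by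
      rw [← Int.ceil_add_natCast]; exact Int.ceil_mono (by linarith)
    omega
  calc _ ≤ (F : Set (DyadicCube ι)).encard := encard_le_encard hF
    _ = F.card := encard_coe_eq_coe_finsetCard F
    _ ≤ _ := by
      norm_cast
      refine Finset.card_biUnion_le.trans ?_
      calc _ ≤ ∑ _l ∈ Finset.Icc (k - κ) (k + κ), (2 * B + 1) ^ Fintype.card ι := by
            refine Finset.sum_le_sum fun l _ => Finset.card_image_le.trans ?_
            rw [Fintype.card_piFinset]
            refine (Finset.prod_le_pow_card _ _ (2 * B + 1) fun i _ => ?_).trans_eq (by simp)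
            rw [Int.card_Icc]; omega
        _ = _ := by
            rw [Finset.sum_const, Int.card_Icc, smul_eq_mul]
            congr 1; omega

theorem exists_card_neighbor_le (ι : Type) [Fintype ι] : ∃ N : ℕ, ∀ Q : DyadicCube ι,
    {Q' : DyadicCube ι | Q.Neighbor Q'}.encard ≤ N := by
  obtain ⟨N, hN⟩ := exists_encard_le (ι := ι) 1 (3 * Fintype.card ι)
  refine ⟨N, fun Q => ?_⟩
  obtain ⟨x, hx⟩ := Q.toSet_nonempty
  refine (encard_le_encard ?_).trans (hN Q.level x)
  intro Q' h
  exact ⟨by exact_mod_cast (neighbor_iff.1 h).1, by exact_mod_cast h.subset_closedBall hx⟩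

/-! ### Dyadic cubes and measures -/

instance : Countable (DyadicCube ι) :=
  Function.Injective.countable (f := fun Q : DyadicCube ι => (Q.level, Q.corner))
    fun Q Q' h => by cases Q; cases Q'; simpa using h

theorem measurableSet_toSet (Q : DyadicCube ι) : MeasurableSet Q.toSet := by
  rw [toSet_eq_preimage]
  exact (WithLp.measurable_ofLp 2 _) (MeasurableSet.univ_pi fun i => measurableSet_Ioc)

/-- A function of the cube of generation `k` around a point is measurable. -/
theorem measurable_comp_at {β : Type*} [MeasurableSpace β] (k : ℤ) (F : DyadicCube ι → β) :
    Measurable fun x => F (at_ k x) := by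
  intro s _
  have : (fun x => F (at_ k x)) ⁻¹' s =
      ⋃ Q ∈ {Q : DyadicCube ι | F Q ∈ s ∧ Q.level = k}, Q.toSet := by
    ext x
    simp only [mem_preimage, mem_ofPred_eq, mem_iUnion, exists_prop]
    constructor
    · exact fun h => ⟨at_ k x, ⟨h, rfl⟩, mem_at k x⟩
    · rintro ⟨Q, ⟨h, rfl⟩, hx⟩
      rwa [eq_at_of_mem hx]
  rw [this]
  exact MeasurableSet.biUnion (to_countable _) fun Q _ => Q.measurableSet_toSet

theorem tsum_measure_mul_eq (μ : Measure (EuclideanSpace ℝ ι)) (k : ℤ) (F : DyadicCube ι → ℝ≥0∞) :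
    ∑' Q : {Q : DyadicCube ι // Q.level = k}, μ Q.1.toSet * F Q.1 = ∫⁻ x, F (at_ k x) ∂μ := by
  have hU : (⋃ Q : {Q : DyadicCube ι // Q.level = k}, Q.1.toSet) = univ :=
    eq_univ_of_forall fun x => mem_iUnion.2 ⟨⟨at_ k x, rfl⟩, mem_at k x⟩
  have hD : Pairwise (Function.onFun Disjoint
      fun Q : {Q : DyadicCube ι // Q.level = k} => Q.1.toSet) := by
    intro Q Q' h
    refine Set.disjoint_left.2 fun x hx hx' => h ?_
    ext1
    rw [← eq_at_of_mem hx, ← eq_at_of_mem hx', Q.2, Q'.2]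
  rw [← setLIntegral_univ, ← hU, lintegral_iUnion (fun Q => Q.1.measurableSet_toSet) hD]
  refine tsum_congr fun Q => ?_
  rw [setLIntegral_congr_fun (g := fun _ => F Q.1) Q.1.measurableSet_toSet, setLIntegral_const,
    mul_comm]
  intro x hx
  have h := eq_at_of_mem hx
  rw [Q.2] at h
  exact congrArg F h

theorem volume_toSet (Q : DyadicCube ι) :
    volume Q.toSet = (2 : ℝ≥0∞) ^ (-((Q.level : ℝ) * Fintype.card ι)) := by
  rw [toSet_eq_preimage, (PiLp.volume_preserving_ofLp ι).measure_preimage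
    (MeasurableSet.univ_pi fun i => measurableSet_Ioc).nullMeasurableSet, volume_pi_pi]
  simp only [Real.volume_Ioc, mul_add, mul_one, add_sub_cancel_left, Finset.prod_const,
    Finset.card_univ]
  rw [edge, ofReal_two_zpow, ← ENNReal.rpow_natCast, two_rpow_rpow]
  push_cast; ring_nf

end

end DyadicCube

/-! ### Averages and Lebesgue differentiation -/

theorem enorm_setAverage_sub_le {X : Type*} [MeasurableSpace X] {μ : Measure X} {A : Set X}
    (h0 : μ A ≠ 0) (ht : μ A ≠ ∞) {f : X → ℂ} (hf : IntegrableOn f A μ) (c : ℂ) :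
    ‖(⨍ y in A, f y ∂μ) - c‖ₑ ≤ (μ A)⁻¹ * ∫⁻ y in A, ‖f y - c‖ₑ ∂μ := by
  have hr : μ.real A ≠ 0 := (ENNReal.toReal_ne_zero.2 ⟨h0, ht⟩)
  have h : (⨍ y in A, f y ∂μ) - c = (μ.real A)⁻¹ • ∫ y in A, (f y - c) ∂μ := by
    rw [setAverage_eq, integral_sub hf (integrableOn_const ht), setIntegral_const, smul_sub,
      smul_smul, inv_mul_cancel₀ hr, one_smul]
  rw [h, enorm_smul]
  gcongr
  · rw [Real.enorm_eq_ofReal (by positivity), ENNReal.ofReal_inv_of_pos (by positivity),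
      Measure.real, ENNReal.ofReal_toReal ht]
  · exact enorm_integral_le_lintegral_enorm _

theorem enorm_setAverage_le {X : Type*} [MeasurableSpace X] {μ : Measure X} {A : Set X}
    (h0 : μ A ≠ 0) (ht : μ A ≠ ∞) {f : X → ℂ} (hf : IntegrableOn f A μ) :
    ‖⨍ y in A, f y ∂μ‖ₑ ≤ (μ A)⁻¹ * ∫⁻ y in A, ‖f y‖ₑ ∂μ := by
  simpa using enorm_setAverage_sub_le h0 ht hf 0

section

variable {ι : Type} [Fintype ι]

theorem volume_closedBall_eq (x : EuclideanSpace ℝ ι) {r : ℝ} (hr : 0 ≤ r) :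
    volume (Metric.closedBall x r) =
      ENNReal.ofReal (r ^ Fintype.card ι) * volume (Metric.ball (0 : EuclideanSpace ℝ ι) 1) := by
  rw [Measure.addHaar_closedBall _ _ hr, finrank_euclideanSpace]

theorem volume_ball_eq (x : EuclideanSpace ℝ ι) {r : ℝ} (hr : 0 < r) :
    volume (Metric.ball x r) =
      ENNReal.ofReal (r ^ Fintype.card ι) * volume (Metric.ball (0 : EuclideanSpace ℝ ι) 1) := by
  rw [Measure.addHaar_ball_of_pos _ _ hr, finrank_euclideanSpace]

theorem volume_ball_two_zpow (x : EuclideanSpace ℝ ι) {R : ℝ} (hR : 0 < R) (k : ℤ) :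
    volume (Metric.ball x (R * 2 ^ (-k))) =
      volume (Metric.ball (0 : EuclideanSpace ℝ ι) R) *
        (2 : ℝ≥0∞) ^ (-((k : ℝ) * Fintype.card ι)) := by
  rw [volume_ball_eq _ (by positivity), volume_ball_eq _ hR, mul_pow,
    ENNReal.ofReal_mul (by positivity), ENNReal.ofReal_pow (p := (2 : ℝ) ^ (-k)) (by positivity),
    ofReal_two_zpow, ← ENNReal.rpow_natCast, two_rpow_rpow]
  push_cast
  rw [neg_mul]; ring

theorem ae_tendsto_closedBall {f : EuclideanSpace ℝ ι → ℂ} (hf : LocallyIntegrable f) :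
    ∀ᵐ x, Tendsto (fun r => (∫⁻ y in Metric.closedBall x r, ‖f y - f x‖ₑ) /
      volume (Metric.closedBall x r)) (𝓝[>] 0) (𝓝 0) := by
  filter_upwards [(IsUnifLocDoublingMeasure.vitaliFamily
    (volume : Measure (EuclideanSpace ℝ ι)) 1).ae_tendsto_lintegral_enorm_sub_div hf] with x hx
  refine hx.comp (IsUnifLocDoublingMeasure.tendsto_closedBall_filterAt _ (fun _ => x)
    (fun r => r) tendsto_id ?_)
  filter_upwards [self_mem_nhdsWithin] with r hr
  exact Metric.mem_closedBall_self (by simpa using (le_of_lt hr))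

theorem tendsto_two_zpow_neg {R : ℝ} (hR : 0 < R) :
    Tendsto (fun k : ℕ => R * (2 : ℝ) ^ (-(k : ℤ))) atTop (𝓝[>] 0) := by
  refine tendsto_nhdsWithin_iff.2 ⟨?_, .of_forall fun k => mem_Ioi.2 (by positivity)⟩
  have h := (tendsto_pow_atTop_nhds_zero_of_lt_one (r := (2 : ℝ)⁻¹) (by norm_num)
    (by norm_num)).const_mul R
  simpa [zpow_neg, zpow_natCast, inv_pow] using h

/-- The Lebesgue differentiation theorem along dyadic cubes. -/
theorem ae_tendsto_average_at {f : EuclideanSpace ℝ ι → ℂ} (hf : LocallyIntegrable f) :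
    ∀ᵐ x, Tendsto (fun k : ℕ => ⨍ y in (DyadicCube.at_ k x).toSet, f y) atTop (𝓝 (f x)) := by
  filter_upwards [ae_tendsto_closedBall hf] with x hx
  set D : ℝ := Fintype.card ι + 1
  have hD : 0 < D := by positivity
  set V : ℝ≥0∞ := ENNReal.ofReal (D ^ Fintype.card ι) *
    volume (Metric.ball (0 : EuclideanSpace ℝ ι) 1) with hV
  have hVt : V ≠ ∞ := ENNReal.mul_ne_top (by simp) measure_ball_lt_top.ne
  have hV0 : V ≠ 0 := mul_ne_zero (by simpa using by positivity)
    (Metric.measure_ball_pos _ _ one_pos).ne'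
  have h1 := ENNReal.Tendsto.const_mul (hx.comp (tendsto_two_zpow_neg hD))
    (Or.inr hVt)
  rw [mul_zero] at h1
  rw [tendsto_iff_edist_tendsto_0]
  refine tendsto_of_tendsto_of_tendsto_of_le_of_le tendsto_const_nhds h1 (fun _ => zero_le)
    fun k => ?_
  have hvol := DyadicCube.volume_toSet (DyadicCube.at_ k x)
  have hlev : (DyadicCube.at_ (k : ℤ) x).level = k := rfl
  have hsub : (DyadicCube.at_ k x).toSet ⊆ Metric.closedBall x (D * 2 ^ (-(k : ℤ))) := by
    intro z hz
    have h := DyadicCube.dist_le_of_mem (subset_closure hz)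
      (subset_closure (DyadicCube.mem_at k x))
    rw [DyadicCube.edge_at] at h
    refine Metric.mem_closedBall.2 (h.trans ?_)
    gcongr; simp [D]
  have hball : volume (Metric.closedBall x (D * 2 ^ (-(k : ℤ)))) =
      V * volume (DyadicCube.at_ k x).toSet := by
    rw [volume_closedBall_eq _ (by positivity), mul_pow, ENNReal.ofReal_mul (by positivity), hvol,
      hV, ENNReal.ofReal_pow (p := (2 : ℝ) ^ (-(k : ℤ))) (by positivity), ofReal_two_zpow,
      ← ENNReal.rpow_natCast, two_rpow_rpow, hlev]
    push_cast
    rw [neg_mul]; ring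
  have hv0 : volume (DyadicCube.at_ k x).toSet ≠ 0 := hvol ▸ two_rpow_ne_zero _
  have hvt : volume (DyadicCube.at_ k x).toSet ≠ ∞ := hvol ▸ two_rpow_ne_top _
  have hint : IntegrableOn f (DyadicCube.at_ k x).toSet :=
    (hf.integrableOn_isCompact (isCompact_closedBall x (D * 2 ^ (-(k : ℤ))))).mono_set hsub
  rw [edist_eq_enorm_sub]
  refine (enorm_setAverage_sub_le hv0 hvt hint _).trans ?_
  simp only [Function.comp]
  rw [hball, ENNReal.div_eq_inv_mul, ENNReal.mul_inv (Or.inl hV0) (Or.inl hVt), ← mul_assoc,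
    ← mul_assoc, ENNReal.mul_inv_cancel hV0 hVt, one_mul]
  gcongr

/-- Dyadic Lebesgue differentiation for a measure with a locally integrable density that is positive
almost everywhere. -/
theorem ae_tendsto_average_at_withDensity {w : EuclideanSpace ℝ ι → ℝ} (hw : LocallyIntegrable w)
    (hwm : Measurable w) (hw0 : ∀ᵐ x, 0 < w x)
    {f : EuclideanSpace ℝ ι → ℂ} {μ : Measure (EuclideanSpace ℝ ι)}
    (hμ : μ = volume.withDensity fun x => ENNReal.ofReal (w x)) (hf : LocallyIntegrable f μ) :
    ∀ᵐ x ∂μ, Tendsto (fun k : ℕ => ⨍ y in (DyadicCube.at_ k x).toSet, f y ∂μ) atTop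
      (𝓝 (f x)) := by
  have hwpos : ∀ᵐ x, (ENNReal.ofReal (w x)).toReal = w x := by
    filter_upwards [hw0] with x hx
    exact ENNReal.toReal_ofReal hx.le
  have hwf : LocallyIntegrable fun x => (w x : ℂ) * f x := by
    rw [locallyIntegrable_iff] at hf ⊢
    intro K hK
    have := hf K hK
    rw [hμ, IntegrableOn, restrict_withDensity hK.measurableSet,
      integrable_withDensity_iff_integrable_smul' hwm.ennreal_ofReal (by simp)] at this
    refine this.congr ?_
    filter_upwards [ae_restrict_of_ae hwpos] with x hx
    rw [hx, Complex.real_smul]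
  have hwc : LocallyIntegrable fun x => (w x : ℂ) := by
    rw [locallyIntegrable_iff] at hw ⊢
    intro K hK
    exact (hw K hK).ofReal
  -- the mean with respect to `μ` is the quotient of the Lebesgue means of `w f` and of `w`
  rw [hμ]
  refine (withDensity_absolutelyContinuous _ _).ae_le ?_
  filter_upwards [ae_tendsto_average_at hwf, ae_tendsto_average_at hwc, hw0] with x h1 h2 h3
  have h3' : (w x : ℂ) ≠ 0 := by exact_mod_cast h3.ne'
  have h := h1.div h2 h3'
  rw [mul_div_cancel_left₀ _ h3'] at h
  refine h.congr fun k => ?_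
  set A := (DyadicCube.at_ k x).toSet
  have hA : MeasurableSet A := DyadicCube.measurableSet_toSet _
  have hv : volume A = _ := DyadicCube.volume_toSet (DyadicCube.at_ k x)
  have hr : (volume.real A) ≠ 0 := by
    rw [Measure.real, hv]
    exact ENNReal.toReal_ne_zero.2 ⟨two_rpow_ne_zero _, two_rpow_ne_top _⟩
  have e1 : ∫ y in A, f y ∂(volume.withDensity fun x => ENNReal.ofReal (w x)) =
      ∫ y in A, (w y : ℂ) * f y := by
    rw [restrict_withDensity hA, integral_withDensity_eq_integral_toReal_smul hwm.ennreal_ofReal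
      (by simp)]
    refine integral_congr_ae ?_
    filter_upwards [ae_restrict_of_ae hwpos] with x hx
    rw [hx, Complex.real_smul]
  have e2 : (((volume.withDensity fun x => ENNReal.ofReal (w x)).real A : ℝ) : ℂ) =
      ∫ y in A, (w y : ℂ) := by
    rw [show ∫ y in A, (w y : ℂ) = ((∫ y in A, w y : ℝ) : ℂ) from integral_ofReal,
      integral_eq_lintegral_of_nonneg_ae
      (ae_restrict_of_ae (hw0.mono fun x hx => hx.le)) hwm.aestronglyMeasurable, Measure.real,
      withDensity_apply _ hA]
  simp only [setAverage_eq, Pi.div_apply]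
  rw [e1, Complex.real_smul, Complex.real_smul, Complex.real_smul, Complex.ofReal_inv,
    Complex.ofReal_inv, e2]
  have hr' : (volume.real A : ℂ)⁻¹ ≠ 0 := inv_ne_zero (by exact_mod_cast hr)
  rw [mul_div_mul_left _ _ hr', div_eq_inv_mul]

/-! ### Integrals over moving balls -/

theorem measurable_setLIntegral_ball {X Y : Type*} [MeasurableSpace X] [PseudoMetricSpace Y]
    [SecondCountableTopology Y] [MeasurableSpace Y] [OpensMeasurableSpace Y]
    {μ : Measure Y} [SFinite μ] {c : X → Y} (hc : Measurable c) (r : ℝ) {g : Y → ℝ≥0∞}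
    (hg : Measurable g) :
    Measurable fun x => ∫⁻ z in Metric.ball (c x) r, g z ∂μ := by
  have h : ∀ x, ∫⁻ z in Metric.ball (c x) r, g z ∂μ =
      ∫⁻ z, {p : X × Y | dist p.2 (c p.1) < r}.indicator (fun p => g p.2) (x, z) ∂μ := by
    intro x
    rw [← lintegral_indicator Metric.isOpen_ball.measurableSet]
    rfl
  simp_rw [h]
  refine Measurable.lintegral_prod_right' ?_
  refine (hg.comp measurable_snd).indicator ?_
  exact measurableSet_lt (measurable_snd.dist (hc.comp measurable_fst)) measurable_const

/-- Fubini's theorem for averages over moving balls. -/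
theorem lintegral_setLIntegral_ball_le {X Y : Type*} [MeasurableSpace X] [PseudoMetricSpace Y]
    [SecondCountableTopology Y] [MeasurableSpace Y] [OpensMeasurableSpace Y]
    {ν : Measure X} [SFinite ν] {μ : Measure Y} [SFinite μ] {c : X → Y} (hc : Measurable c) {r : ℝ}
    {g : Y → ℝ≥0∞} (hg : Measurable g) {B : Set Y} {V : ℝ≥0∞}
    (hB : ∀ x, Metric.ball (c x) r ⊆ B)
    (hV : ∀ z ∈ B, ν {x | dist z (c x) < r} ≤ V) (hBm : MeasurableSet B) :
    ∫⁻ x, ∫⁻ z in Metric.ball (c x) r, g z ∂μ ∂ν ≤ V * ∫⁻ z in B, g z ∂μ := by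
  have h : ∀ x, ∫⁻ z in Metric.ball (c x) r, g z ∂μ =
      ∫⁻ z in B, {p : X × Y | dist p.2 (c p.1) < r}.indicator (fun p => g p.2) (x, z) ∂μ := by
    intro x
    rw [← lintegral_indicator Metric.isOpen_ball.measurableSet, ← lintegral_indicator hBm]
    refine lintegral_congr fun z => ?_
    by_cases hz : dist z (c x) < r
    · have : z ∈ B := hB x hz
      simp [indicator, hz, this]
    · simp [indicator, hz]
  have hm : MeasurableSet {p : X × Y | dist p.2 (c p.1) < r} :=
    measurableSet_lt (measurable_snd.dist (hc.comp measurable_fst)) measurable_const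
  simp_rw [h]
  rw [lintegral_lintegral_swap (f := fun x z =>
      {p : X × Y | dist p.2 (c p.1) < r}.indicator (fun p => g p.2) (x, z))
    ((hg.comp measurable_snd).indicator hm).aemeasurable,
    ← lintegral_const_mul _ hg]
  refine setLIntegral_mono' hBm fun z hz => ?_
  have : ∀ x, {p : X × Y | dist p.2 (c p.1) < r}.indicator (fun p => g p.2) (x, z) =
      {x | dist z (c x) < r}.indicator (fun _ => g z) x := fun x => rfl
  simp_rw [this]
  rw [lintegral_indicator (measurableSet_lt (measurable_const.dist hc) measurable_const),
    setLIntegral_const, mul_comm]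
  gcongr
  exact hV z hz

/-- The case of balls in Euclidean space, with centres in a ball. -/
theorem setLIntegral_setLIntegral_ball_le (x : EuclideanSpace ℝ ι) {r ρ : ℝ}
    {g : EuclideanSpace ℝ ι → ℝ≥0∞} (hg : Measurable g) :
    ∫⁻ y in Metric.ball x r, ∫⁻ z in Metric.ball y ρ, g z ≤
      volume (Metric.ball (0 : EuclideanSpace ℝ ι) ρ) * ∫⁻ z in Metric.ball x (r + ρ), g z := by
  have h1 : ∫⁻ y in Metric.ball x r, ∫⁻ z in Metric.ball y ρ, g z =
      ∫⁻ y in Metric.ball x r, ∫⁻ z in Metric.ball y ρ, (Metric.ball x (r + ρ)).indicator g z := by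
    refine setLIntegral_congr_fun Metric.isOpen_ball.measurableSet fun y hy => ?_
    refine setLIntegral_congr_fun Metric.isOpen_ball.measurableSet fun z hz => ?_
    rw [Metric.mem_ball] at hy hz
    have : z ∈ Metric.ball x (r + ρ) := by
      rw [Metric.mem_ball]; linarith [dist_triangle z y x]
    simp [indicator_of_mem this]
  rw [h1]
  refine (lintegral_setLIntegral_ball_le (B := univ) measurable_id
    (hg.indicator Metric.isOpen_ball.measurableSet) (fun _ => subset_univ _) (V :=
    volume (Metric.ball (0 : EuclideanSpace ℝ ι) ρ)) ?_ MeasurableSet.univ).trans ?_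
  · intro z _
    refine (Measure.restrict_apply_le _ _).trans (le_of_eq ?_)
    rw [← Measure.addHaar_ball_center volume z ρ]
    congr 1
    ext y; simp [dist_comm]
  · rw [setLIntegral_univ, lintegral_indicator Metric.isOpen_ball.measurableSet]

/-- The `p`-th power of local averages is controlled by the integral of the `p`-th power. -/
theorem lintegral_rpow_setLIntegral_ball_le {p ρ : ℝ} (hp : 1 ≤ p) {g : EuclideanSpace ℝ ι → ℝ≥0∞}
    (hg : Measurable g) :
    ∫⁻ y, (∫⁻ z in Metric.ball y ρ, g z) ^ p ≤
      volume (Metric.ball (0 : EuclideanSpace ℝ ι) ρ) ^ p * ∫⁻ z, g z ^ p := by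
  set V := volume (Metric.ball (0 : EuclideanSpace ℝ ι) ρ) with hV
  have hVt : V ≠ ∞ := measure_ball_lt_top.ne
  calc ∫⁻ y, (∫⁻ z in Metric.ball y ρ, g z) ^ p
      ≤ ∫⁻ y, V ^ (p - 1) * ∫⁻ z in Metric.ball y ρ, g z ^ p := by
        refine lintegral_mono fun y => (rpow_lintegral_le hp hg.aemeasurable.restrict).trans ?_
        rw [Measure.restrict_apply_univ, Measure.addHaar_ball_center volume y ρ]
    _ = V ^ (p - 1) * ∫⁻ y, ∫⁻ z in Metric.ball y ρ, g z ^ p :=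
        lintegral_const_mul' _ _ (ENNReal.rpow_ne_top_of_nonneg (by linarith) hVt)
    _ ≤ V ^ (p - 1) * (V * ∫⁻ z in univ, g z ^ p) := by
        gcongr
        refine lintegral_setLIntegral_ball_le measurable_id (hg.pow_const p)
          (fun _ => subset_univ _) (fun z _ => ?_) MeasurableSet.univ
        rw [hV, ← Measure.addHaar_ball_center volume z ρ]
        refine measure_mono fun y hy => ?_
        simpa [dist_comm] using hy
    _ = _ := by
        rw [setLIntegral_univ, ← mul_assoc]
        congr 1
        have : V ^ p = V ^ ((p - 1) + 1) := by ring_nf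
        rw [this, ENNReal.rpow_add_of_nonneg _ _ (by linarith) zero_le_one, ENNReal.rpow_one]

end

/-! ### The splitting `ℝ^{d+n} = ℝ^d × ℝ^n` and the weight -/

section

variable {d n : ℕ}

/-- The component in `ℝ^d` of a point of `ℝ^{d+n}`. -/
def basePart (y : EuclideanSpace ℝ (Fin d ⊕ Fin n)) : EuclideanSpace ℝ (Fin d) :=
  WithLp.toLp 2 fun i => y (Sum.inl i)

/-- The component in `ℝ^n` of a point of `ℝ^{d+n}`. -/
def fiberPart (y : EuclideanSpace ℝ (Fin d ⊕ Fin n)) : EuclideanSpace ℝ (Fin n) :=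
  WithLp.toLp 2 fun j => y (Sum.inr j)

/-- The point of `ℝ^{d+n}` with the given components. -/
def join (x : EuclideanSpace ℝ (Fin d)) (v : EuclideanSpace ℝ (Fin n)) :
    EuclideanSpace ℝ (Fin d ⊕ Fin n) :=
  WithLp.toLp 2 (Sum.elim (fun i => x i) fun j => v j)

@[simp] theorem basePart_join (x : EuclideanSpace ℝ (Fin d)) (v : EuclideanSpace ℝ (Fin n)) :
    basePart (join x v) = x := rfl

@[simp] theorem fiberPart_join (x : EuclideanSpace ℝ (Fin d)) (v : EuclideanSpace ℝ (Fin n)) :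
    fiberPart (join x v) = v := rfl

@[simp] theorem basePart_embed (x : EuclideanSpace ℝ (Fin d)) : basePart (embed n x) = x := rfl

@[simp] theorem fiberPart_embed (x : EuclideanSpace ℝ (Fin d)) : fiberPart (embed n x) = 0 := rfl

theorem fiberPart_sub (y z : EuclideanSpace ℝ (Fin d ⊕ Fin n)) :
    fiberPart (y - z) = fiberPart y - fiberPart z := rfl

theorem basePart_sub (y z : EuclideanSpace ℝ (Fin d ⊕ Fin n)) :
    basePart (y - z) = basePart y - basePart z := rfl

theorem norm_sq_eq_parts (y : EuclideanSpace ℝ (Fin d ⊕ Fin n)) :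
    ‖y‖ ^ 2 = ‖basePart y‖ ^ 2 + ‖fiberPart y‖ ^ 2 := by
  simp [EuclideanSpace.norm_sq_eq, basePart, fiberPart]

theorem norm_basePart_le (y : EuclideanSpace ℝ (Fin d ⊕ Fin n)) : ‖basePart y‖ ≤ ‖y‖ := by
  have := norm_sq_eq_parts y
  exact (abs_le_of_sq_le_sq' (by nlinarith [sq_nonneg ‖fiberPart y‖]) (norm_nonneg _)).2

theorem norm_fiberPart_le (y : EuclideanSpace ℝ (Fin d ⊕ Fin n)) : ‖fiberPart y‖ ≤ ‖y‖ := by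
  have := norm_sq_eq_parts y
  exact (abs_le_of_sq_le_sq' (by nlinarith [sq_nonneg ‖basePart y‖]) (norm_nonneg _)).2

theorem norm_le_parts (y : EuclideanSpace ℝ (Fin d ⊕ Fin n)) :
    ‖y‖ ≤ ‖basePart y‖ + ‖fiberPart y‖ := by
  have := norm_sq_eq_parts y
  have h := mul_nonneg (norm_nonneg (basePart y)) (norm_nonneg (fiberPart y))
  exact abs_le_of_sq_le_sq' (by nlinarith) (by positivity) |>.2

theorem dist_basePart_le (y z : EuclideanSpace ℝ (Fin d ⊕ Fin n)) :
    dist (basePart y) (basePart z) ≤ dist y z := by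
  rw [dist_eq_norm, dist_eq_norm, ← basePart_sub]; exact norm_basePart_le _

theorem dist_fiberPart_le (y z : EuclideanSpace ℝ (Fin d ⊕ Fin n)) :
    dist (fiberPart y) (fiberPart z) ≤ dist y z := by
  rw [dist_eq_norm, dist_eq_norm, ← fiberPart_sub]; exact norm_fiberPart_le _

theorem dist_embed_le (y : EuclideanSpace ℝ (Fin d ⊕ Fin n)) (x : EuclideanSpace ℝ (Fin d)) :
    dist y (embed n x) ≤ dist (basePart y) x + ‖fiberPart y‖ := by
  have := norm_le_parts (y - embed n x)
  rw [basePart_sub, fiberPart_sub, basePart_embed, fiberPart_embed, sub_zero] at this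
  rwa [dist_eq_norm, dist_eq_norm]

theorem measurable_basePart :
    Measurable (basePart : EuclideanSpace ℝ (Fin d ⊕ Fin n) → EuclideanSpace ℝ (Fin d)) := by
  refine LipschitzWith.continuous (K := 1) (LipschitzWith.of_dist_le_mul fun y z => ?_)
    |>.measurable
  simpa using dist_basePart_le y z

theorem measurable_fiberPart :
    Measurable (fiberPart : EuclideanSpace ℝ (Fin d ⊕ Fin n) → EuclideanSpace ℝ (Fin n)) := by
  refine LipschitzWith.continuous (K := 1) (LipschitzWith.of_dist_le_mul fun y z => ?_)
    |>.measurable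
  simpa using dist_fiberPart_le y z

theorem infDist_plane (y : EuclideanSpace ℝ (Fin d ⊕ Fin n)) :
    Metric.infDist y (plane d n) = ‖fiberPart y‖ := by
  have hmem : embed n (basePart y) ∈ plane d n := fun j => rfl
  refine le_antisymm ?_ ?_
  · refine (Metric.infDist_le_dist_of_mem hmem).trans ?_
    simpa using dist_embed_le y (basePart y)
  · refine (Metric.le_infDist ⟨_, hmem⟩).2 fun z hz => ?_
    have hz0 : fiberPart z = 0 := by ext j; exact hz j
    simpa [hz0] using dist_fiberPart_le y z

theorem measurePreserving_join : MeasurePreserving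
    (fun q : EuclideanSpace ℝ (Fin d) × EuclideanSpace ℝ (Fin n) => join q.1 q.2)
    (volume.prod volume) volume :=
  (PiLp.volume_preserving_toLp (Fin d ⊕ Fin n)).comp
    ((volume_measurePreserving_sumPiEquivProdPi_symm fun _ : Fin d ⊕ Fin n => ℝ).comp
      ((PiLp.volume_preserving_ofLp (Fin d)).prod (PiLp.volume_preserving_ofLp (Fin n))))

theorem lintegral_join {F : EuclideanSpace ℝ (Fin d ⊕ Fin n) → ℝ≥0∞} (hF : Measurable F) :
    ∫⁻ y, F y = ∫⁻ v, ∫⁻ x, F (join x v) := by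
  rw [← measurePreserving_join.lintegral_comp hF, lintegral_prod_symm]
  exact (hF.comp measurePreserving_join.measurable).aemeasurable

/-- The weight `min(1, |v|)^α` as a function of the component in `ℝ^n`. -/
noncomputable def weight (n : ℕ) (α : ℝ) (v : EuclideanSpace ℝ (Fin n)) : ℝ := min 1 ‖v‖ ^ α

theorem measurable_weight (α : ℝ) : Measurable (weight n α) :=
  (measurable_const.min measurable_norm).pow_const α

theorem weightMeasure_eq (α : ℝ) : weightMeasure d n α =
    volume.withDensity fun y => ENNReal.ofReal (weight n α (fiberPart y)) := by
  unfold weightMeasure weight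
  simp_rw [infDist_plane]

instance (α : ℝ) : SFinite (weightMeasure d n α) := by
  unfold weightMeasure; infer_instance

theorem weightMeasure_zero : weightMeasure d n 0 = volume := by
  simp [weightMeasure_eq, weight]

theorem lintegral_weightMeasure (α : ℝ) {F : EuclideanSpace ℝ (Fin d ⊕ Fin n) → ℝ≥0∞}
    (hF : Measurable F) : ∫⁻ y, F y ∂weightMeasure d n α =
      ∫⁻ v, ENNReal.ofReal (weight n α v) * ∫⁻ x, F (join x v) := by
  have hm : Measurable fun y : EuclideanSpace ℝ (Fin d ⊕ Fin n) =>
      ENNReal.ofReal (weight n α (fiberPart y)) :=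
    ((measurable_weight α).comp measurable_fiberPart).ennreal_ofReal
  rw [weightMeasure_eq, lintegral_withDensity_eq_lintegral_mul _ hm hF,
    lintegral_join (hm.mul hF)]
  refine lintegral_congr fun v => ?_
  simp only [Pi.mul_apply, fiberPart_join]
  exact lintegral_const_mul' _ _ (by simp)

theorem weight_pos {α : ℝ} {v : EuclideanSpace ℝ (Fin n)} (hv : v ≠ 0) : 0 < weight n α v :=
  Real.rpow_pos_of_pos (lt_min one_pos (norm_pos_iff.2 hv)) _

/-- On a bounded set the weight is comparable to `|v| ^ α`. -/
theorem weight_le {α R : ℝ} (hR : 1 ≤ R) {v : EuclideanSpace ℝ (Fin n)} (hv : v ≠ 0)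
    (h : ‖v‖ ≤ R) : weight n α v ≤ R ^ |α| * ‖v‖ ^ α := by
  have hv0 := norm_pos_iff.2 hv
  have hRα : 1 ≤ R ^ |α| := Real.one_le_rpow hR (abs_nonneg _)
  unfold weight
  rcases le_total ‖v‖ 1 with h1 | h1
  · rw [min_eq_right h1]
    exact le_mul_of_one_le_left (by positivity) hRα
  · rw [min_eq_left h1, Real.one_rpow]
    rcases le_total 0 α with h2 | h2
    · calc (1 : ℝ) ≤ ‖v‖ ^ α := Real.one_le_rpow h1 h2
        _ ≤ _ := le_mul_of_one_le_left (by positivity) hRα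
    · rw [abs_of_nonpos h2, Real.rpow_neg (by positivity), inv_mul_eq_div,
        one_le_div (by positivity)]
      exact Real.rpow_le_rpow_of_nonpos hv0 h h2

theorem le_weight {α R : ℝ} (hR : 1 ≤ R) {v : EuclideanSpace ℝ (Fin n)} (hv : v ≠ 0)
    (h : ‖v‖ ≤ R) : ‖v‖ ^ α ≤ R ^ |α| * weight n α v := by
  have hv0 := norm_pos_iff.2 hv
  have hRα : 1 ≤ R ^ |α| := Real.one_le_rpow hR (abs_nonneg _)
  unfold weight
  rcases le_total ‖v‖ 1 with h1 | h1
  · rw [min_eq_right h1]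
    exact le_mul_of_one_le_left (by positivity) hRα
  · rw [min_eq_left h1, Real.one_rpow, mul_one]
    rcases le_total 0 α with h2 | h2
    · rw [abs_of_nonneg h2]; exact Real.rpow_le_rpow hv0.le h h2
    · exact (Real.rpow_le_one_of_one_le_of_nonpos h1 h2).trans hRα

theorem ae_ne_zero (hn : 1 ≤ n) : ∀ᵐ v : EuclideanSpace ℝ (Fin n), v ≠ 0 := by
  have : Nonempty (Fin n) := ⟨⟨0, hn⟩⟩
  exact compl_mem_ae_iff.2 (measure_singleton _)

theorem ae_fiberPart_ne_zero (hn : 1 ≤ n) :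
    ∀ᵐ y : EuclideanSpace ℝ (Fin d ⊕ Fin n), fiberPart y ≠ 0 := by
  have hm : MeasurableSet {y : EuclideanSpace ℝ (Fin d ⊕ Fin n) | fiberPart y = 0} :=
    measurable_fiberPart (measurableSet_singleton 0)
  have h : volume {y : EuclideanSpace ℝ (Fin d ⊕ Fin n) | fiberPart y = 0} = 0 := by
    rw [← lintegral_indicator_one hm, lintegral_join (measurable_one.indicator hm),
      lintegral_eq_zero_of_ae_eq_zero]
    filter_upwards [ae_ne_zero hn] with v hv
    simp [indicator, hv]
  exact compl_mem_ae_iff.2 h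

theorem weightMeasure_absolutelyContinuous (α : ℝ) : weightMeasure d n α ≪ volume :=
  withDensity_absolutelyContinuous _ _

/-- Integrals of powers of the norm over balls, by scaling. -/
theorem exists_setLIntegral_norm_rpow_le (hn : 1 ≤ n) {β : ℝ} (hβ : -(n : ℝ) < β) :
    ∃ C : ℝ≥0, ∀ r : ℝ, 0 < r →
      ∫⁻ v in Metric.ball (0 : EuclideanSpace ℝ (Fin n)) r, ENNReal.ofReal (‖v‖ ^ β) ≤
        C * ENNReal.ofReal (r ^ (n + β)) := by
  have hfin : IntegrableOn (fun v : EuclideanSpace ℝ (Fin n) => ‖v‖ ^ β) (Metric.ball 0 1) := by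
    refine integrableOn_ball_of_norm_le_rpow (C := 1) (α := -β) (by simpa using hn)
      (by simp; linarith) (.of_forall fun v => ?_)
      (measurable_norm.pow_const β).aestronglyMeasurable
    rw [neg_neg, one_mul, Real.norm_of_nonneg (by positivity)]
  have hI : ∫⁻ v in Metric.ball (0 : EuclideanSpace ℝ (Fin n)) 1, ENNReal.ofReal (‖v‖ ^ β) ≠ ∞ := by
    have := hfin.2
    rw [hasFiniteIntegral_iff_ofReal (.of_forall fun v => by positivity)] at this
    exact this.ne
  refine ⟨(∫⁻ v in Metric.ball (0 : EuclideanSpace ℝ (Fin n)) 1,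
    ENNReal.ofReal (‖v‖ ^ β)).toNNReal, fun r hr => ?_⟩
  rw [ENNReal.coe_toNNReal hI]
  have hmeas : Measurable fun v : EuclideanSpace ℝ (Fin n) => ENNReal.ofReal (‖v‖ ^ β) :=
    (measurable_norm.pow_const β).ennreal_ofReal
  have hmap := Measure.map_addHaar_smul (volume : Measure (EuclideanSpace ℝ (Fin n)))
    (r := r) hr.ne'
  rw [finrank_euclideanSpace, Fintype.card_fin, abs_inv, abs_of_pos (pow_pos hr n)] at hmap
  have h1 : ∫⁻ v, (Metric.ball (0 : EuclideanSpace ℝ (Fin n)) r).indicator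
      (fun v => ENNReal.ofReal (‖v‖ ^ β)) v ∂(Measure.map (r • ·) volume) =
      ENNReal.ofReal (r ^ β) * ∫⁻ v in Metric.ball (0 : EuclideanSpace ℝ (Fin n)) 1,
        ENNReal.ofReal (‖v‖ ^ β) := by
    rw [lintegral_map (hmeas.indicator Metric.isOpen_ball.measurableSet)
      (measurable_const_smul r), ← lintegral_const_mul' _ _ (by simp),
      ← lintegral_indicator Metric.isOpen_ball.measurableSet]
    refine lintegral_congr fun v => ?_
    have : ‖r • v‖ = r * ‖v‖ := by rw [norm_smul, Real.norm_of_nonneg hr.le]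
    by_cases hv : ‖v‖ < 1
    · have h2 : r * ‖v‖ < r := by nlinarith
      simp [indicator, this, hv, h2, Real.mul_rpow hr.le,
        ENNReal.ofReal_mul (Real.rpow_nonneg hr.le β)]
    · have h2 : ¬ r * ‖v‖ < r := by nlinarith
      simp [indicator, this, hv, h2]
  rw [hmap, lintegral_smul_measure, lintegral_indicator Metric.isOpen_ball.measurableSet,
    smul_eq_mul] at h1
  have h3 : ENNReal.ofReal (r ^ n) * ENNReal.ofReal ((r ^ n)⁻¹) = 1 := by
    rw [← ENNReal.ofReal_mul (by positivity), mul_inv_cancel₀ (by positivity), ENNReal.ofReal_one]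
  calc _ = ENNReal.ofReal (r ^ n) * (ENNReal.ofReal ((r ^ n)⁻¹) *
        ∫⁻ v in Metric.ball (0 : EuclideanSpace ℝ (Fin n)) r, ENNReal.ofReal (‖v‖ ^ β)) := by
        rw [← mul_assoc, h3, one_mul]
    _ ≤ _ := by
        rw [h1, ← mul_assoc, ← ENNReal.ofReal_mul (by positivity), Real.rpow_add hr,
          Real.rpow_natCast, mul_comm]

theorem exists_setLIntegral_weight_rpow_le (hn : 1 ≤ n) {α η R : ℝ} (hR : 1 ≤ R)
    (h : -(n : ℝ) < α - η) : ∃ C : ℝ≥0, ∀ r : ℝ, 0 < r → r ≤ R →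
      ∫⁻ v in Metric.ball (0 : EuclideanSpace ℝ (Fin n)) r,
        ENNReal.ofReal (weight n α v) * ENNReal.ofReal (‖v‖ ^ (-η)) ≤
        C * ENNReal.ofReal (r ^ (n + (α - η))) := by
  obtain ⟨C, hC⟩ := exists_setLIntegral_norm_rpow_le hn h
  refine ⟨Real.toNNReal (R ^ |α|) * C, fun r hr hrR => ?_⟩
  calc _ ≤ ∫⁻ v in Metric.ball (0 : EuclideanSpace ℝ (Fin n)) r,
        ENNReal.ofReal (R ^ |α|) * ENNReal.ofReal (‖v‖ ^ (α - η)) := by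
        refine lintegral_mono_ae ?_
        filter_upwards [ae_restrict_mem Metric.isOpen_ball.measurableSet,
          ae_restrict_of_ae (ae_ne_zero hn)] with v hv hv0
        rw [← ENNReal.ofReal_mul (weight_pos hv0).le, ← ENNReal.ofReal_mul (by positivity)]
        refine ENNReal.ofReal_le_ofReal ?_
        have hv0' := norm_pos_iff.2 hv0
        rw [sub_eq_add_neg, Real.rpow_add hv0', ← mul_assoc]
        gcongr
        exact weight_le hR hv0 ((mem_ball_zero_iff.1 hv).le.trans hrR)
    _ ≤ _ := by
        rw [lintegral_const_mul' _ _ (by simp), ENNReal.coe_mul, mul_assoc]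
        gcongr
        · rfl
        · exact hC r hr

theorem exists_setLIntegral_weight_le (hn : 1 ≤ n) {α R : ℝ} (hR : 1 ≤ R)
    (h : -(n : ℝ) < α) : ∃ C : ℝ≥0, ∀ r : ℝ, 0 < r → r ≤ R →
      ∫⁻ v in Metric.ball (0 : EuclideanSpace ℝ (Fin n)) r, ENNReal.ofReal (weight n α v) ≤
        C * ENNReal.ofReal (r ^ (n + α)) := by
  simpa using exists_setLIntegral_weight_rpow_le hn hR (α := α) (η := 0) (by simpa using h)

end

section

variable {d n : ℕ}

theorem exists_weightMeasure_ball_le (hn : 1 ≤ n) {α R : ℝ} (hR : 1 ≤ R) (h : -(n : ℝ) < α) :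
    ∃ C : ℝ≥0, ∀ (x : EuclideanSpace ℝ (Fin d)) (r : ℝ), 0 < r → r ≤ R →
      weightMeasure d n α (Metric.ball (embed n x) r) ≤ C * ENNReal.ofReal (r ^ (d + n + α)) := by
  obtain ⟨C, hC⟩ := exists_setLIntegral_weight_le hn hR h
  have hVt : volume (Metric.ball (0 : EuclideanSpace ℝ (Fin d)) 1) ≠ ∞ := measure_ball_lt_top.ne
  refine ⟨C * (volume (Metric.ball (0 : EuclideanSpace ℝ (Fin d)) 1)).toNNReal,
    fun x r hr hrR => ?_⟩
  have hm : MeasurableSet (Metric.ball (embed n x) r) := Metric.isOpen_ball.measurableSet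
  rw [← lintegral_indicator_one hm, lintegral_weightMeasure _ (measurable_one.indicator hm)]
  calc _ ≤ ∫⁻ v, (Metric.ball (0 : EuclideanSpace ℝ (Fin n)) r).indicator
        (fun v => ENNReal.ofReal (weight n α v)) v * volume (Metric.ball x r) := by
        refine lintegral_mono fun v => ?_
        by_cases hv : v ∈ Metric.ball (0 : EuclideanSpace ℝ (Fin n)) r
        · simp only [indicator_of_mem hv]
          gcongr
          rw [← lintegral_indicator_one Metric.isOpen_ball.measurableSet]
          refine lintegral_mono fun z => ?_
          by_cases hz : join z v ∈ Metric.ball (embed n x) r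
          · have : z ∈ Metric.ball x r := by
              have := dist_basePart_le (join z v) (embed n x)
              exact lt_of_le_of_lt this hz
            simp [indicator, hz, this]
          · simp [indicator, hz]
        · have : ∀ z, join z v ∉ Metric.ball (embed n x) r := fun z hz => hv (by
            have := dist_fiberPart_le (join z v) (embed n x)
            exact lt_of_le_of_lt this hz)
          simp [indicator, this]
    _ = (∫⁻ v in Metric.ball (0 : EuclideanSpace ℝ (Fin n)) r, ENNReal.ofReal (weight n α v)) *
        volume (Metric.ball x r) := by
        rw [lintegral_mul_const' _ _ measure_ball_lt_top.ne,
          lintegral_indicator Metric.isOpen_ball.measurableSet]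
    _ ≤ C * ENNReal.ofReal (r ^ (n + α)) * (ENNReal.ofReal (r ^ d) *
        volume (Metric.ball (0 : EuclideanSpace ℝ (Fin d)) 1)) := by
        gcongr
        · exact hC r hr hrR
        · rw [volume_ball_eq _ hr, Fintype.card_fin]
    _ = _ := by
        rw [ENNReal.coe_mul, ENNReal.coe_toNNReal hVt, add_assoc, Real.rpow_add hr (d : ℝ),
          Real.rpow_natCast, ENNReal.ofReal_mul (by positivity)]
        ring

theorem isLocallyFiniteMeasure_weightMeasure (hn : 1 ≤ n) {α : ℝ} (h : -(n : ℝ) < α) :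
    IsLocallyFiniteMeasure (weightMeasure d n α) := by
  refine ⟨fun y => ?_⟩
  have hR : (1 : ℝ) ≤ ‖fiberPart y‖ + 1 := by linarith [norm_nonneg (fiberPart y)]
  obtain ⟨C, hC⟩ := exists_weightMeasure_ball_le (d := d) hn hR h
  refine ⟨Metric.ball (embed n (basePart y)) (‖fiberPart y‖ + 1),
    Metric.isOpen_ball.mem_nhds ?_, ?_⟩
  · have := dist_embed_le y (basePart y)
    rw [dist_self] at this
    rw [Metric.mem_ball]; linarith
  · refine (hC (basePart y) _ (by linarith) le_rfl).trans_lt ?_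
    exact ENNReal.mul_lt_top (by simp) (by simp)

theorem locallyIntegrable_weight (hn : 1 ≤ n) {α : ℝ} (h : -(n : ℝ) < α) :
    LocallyIntegrable fun y : EuclideanSpace ℝ (Fin d ⊕ Fin n) => weight n α (fiberPart y) := by
  have := isLocallyFiniteMeasure_weightMeasure (d := d) hn h
  rw [locallyIntegrable_iff]
  intro K hK
  refine ⟨((measurable_weight α).comp measurable_fiberPart).aestronglyMeasurable, ?_⟩
  have h0 : ∀ y : EuclideanSpace ℝ (Fin d ⊕ Fin n), 0 ≤ weight n α (fiberPart y) := fun y =>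
    Real.rpow_nonneg (le_min zero_le_one (norm_nonneg _)) _
  rw [hasFiniteIntegral_iff_ofReal (.of_forall h0), ← withDensity_apply _ hK.measurableSet,
    ← weightMeasure_eq]
  exact hK.measure_lt_top

/-- Lebesgue differentiation along dyadic cubes for the weighted measure. -/
theorem ae_tendsto_average_at_weightMeasure (hn : 1 ≤ n) {α : ℝ} (h : -(n : ℝ) < α)
    {f : EuclideanSpace ℝ (Fin d ⊕ Fin n) → ℂ} (hf : LocallyIntegrable f (weightMeasure d n α)) :
    ∀ᵐ y ∂weightMeasure d n α, Tendsto (fun k : ℕ =>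
      ⨍ z in (DyadicCube.at_ k y).toSet, f z ∂weightMeasure d n α) atTop (𝓝 (f y)) :=
  ae_tendsto_average_at_withDensity (locallyIntegrable_weight hn h)
    ((measurable_weight α).comp measurable_fiberPart)
    ((ae_fiberPart_ne_zero hn).mono fun _ hy => weight_pos hy) (weightMeasure_eq α) hf

namespace DyadicCube

/-- The dyadic child of a cube that stays away from all coordinate hyperplanes. -/
def farChild {ι : Type} (P : DyadicCube ι) : DyadicCube ι where
  level := P.level + 1
  corner := fun i => if 0 ≤ P.corner i then 2 * P.corner i + 1 else 2 * P.corner i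

theorem edge_farChild {ι : Type} (P : DyadicCube ι) : P.farChild.edge = P.edge / 2 := by
  simp only [edge, farChild, neg_add, zpow_add₀ (two_ne_zero' ℝ)]
  norm_num; ring

theorem farChild_subset {ι : Type} (P : DyadicCube ι) : P.farChild.toSet ⊆ P.toSet := by
  intro x hx i
  have h := hx i
  have he := P.edge_pos
  rw [edge_farChild] at h
  simp only [farChild] at h
  split_ifs at h <;> push_cast at h <;> constructor <;> nlinarith [h.1, h.2]

theorem le_abs_of_mem_farChild {ι : Type} {P : DyadicCube ι} {x : EuclideanSpace ℝ ι}
    (hx : x ∈ P.farChild.toSet) (i : ι) : P.edge / 2 ≤ |x i| := by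
  have h := hx i
  have he := P.edge_pos
  rw [edge_farChild] at h
  simp only [farChild] at h
  split_ifs at h with h0
  · push_cast at h
    have h0' : (0 : ℝ) ≤ P.corner i := by exact_mod_cast h0
    exact le_trans (by nlinarith [h.1]) (le_abs_self _)
  · push_cast at h
    have h0' : (P.corner i : ℝ) ≤ -1 := by exact_mod_cast (by omega : P.corner i ≤ -1)
    exact le_trans (by nlinarith [h.2]) (neg_le_abs _)

end DyadicCube

/-- Lower bound for the weight at distance comparable to `2 ^ (-k)` from the subspace. -/
theorem exists_le_weight (n : ℕ) (α : ℝ) {R : ℝ} (hR : 1 ≤ R) :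
    ∃ c : ℝ, 0 < c ∧ ∀ (v : EuclideanSpace ℝ (Fin n)) (k : ℕ), 2 ^ (-(k : ℝ)) / 4 ≤ ‖v‖ →
      ‖v‖ ≤ R * 2 ^ (-(k : ℝ)) → c * 2 ^ (-(k * α)) ≤ weight n α v := by
  -- the sign of `α` decides which end of the range of `‖v‖` is the worst one
  refine ⟨(R ^ |α|)⁻¹ * min (R ^ α) (4⁻¹ ^ α), by positivity, fun v k h1 h2 => ?_⟩
  have hk : (0 : ℝ) < 2 ^ (-(k : ℝ)) := by positivity
  have hk1 : (2 : ℝ) ^ (-(k : ℝ)) ≤ 1 := Real.rpow_le_one_of_one_le_of_nonpos (by norm_num)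
    (by simp)
  have hv0 : 0 < ‖v‖ := lt_of_lt_of_le (by positivity) h1
  have hv : v ≠ 0 := norm_pos_iff.1 hv0
  have h3 := le_weight (α := α) hR hv (h2.trans (mul_le_of_le_one_right (by linarith) hk1))
  have hRp : 0 < R ^ |α| := by positivity
  rw [mul_assoc, inv_mul_le_iff₀ hRp]
  refine le_trans ?_ h3
  have e : (2 : ℝ) ^ (-(k * α)) = (2 ^ (-(k : ℝ))) ^ α := by
    rw [← Real.rpow_mul (by norm_num)]; ring_nf
  rw [e]
  rcases le_total 0 α with h0 | h0
  · calc _ ≤ 4⁻¹ ^ α * ((2 : ℝ) ^ (-(k : ℝ))) ^ α := by gcongr; exact min_le_right _ _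
      _ = (2 ^ (-(k : ℝ)) / 4) ^ α := by
        rw [← Real.mul_rpow (by positivity) (by positivity)]; congr 1; ring
      _ ≤ _ := Real.rpow_le_rpow (by positivity) h1 h0
  · calc _ ≤ R ^ α * ((2 : ℝ) ^ (-(k : ℝ))) ^ α := by gcongr; exact min_le_left _ _
      _ = (R * 2 ^ (-(k : ℝ))) ^ α := by
        rw [← Real.mul_rpow (by positivity) (by positivity)]
      _ ≤ _ := Real.rpow_le_rpow_of_nonpos hv0 h2 h0

/-- Lower bound for the measure of dyadic cubes close to the subspace. For `α > 0` the weight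
degenerates at the subspace, but on one dyadic child it is comparable to `2 ^ (-k α)`. -/
theorem exists_inv_weightMeasure_toSet_le (hn : 1 ≤ n) (α : ℝ) {R : ℝ} (hR : 1 ≤ R) :
    ∃ C : ℝ≥0, ∀ (P : DyadicCube (Fin d ⊕ Fin n)) (k : ℕ) (x : EuclideanSpace ℝ (Fin d)),
      P.level ≤ k + 1 → P.toSet ⊆ Metric.closedBall (embed n x) (R * 2 ^ (-(k : ℝ))) →
      (weightMeasure d n α P.toSet)⁻¹ ≤ C * 2 ^ ((k : ℝ) * (d + n + α)) := by
  obtain ⟨c, hc, hw⟩ := exists_le_weight n α hR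
  refine ⟨Real.toNNReal (c⁻¹ * 2 ^ (2 * ((d : ℝ) + n))), fun P k x hl hP => ?_⟩
  have hedge : (2 : ℝ) ^ (-(k : ℝ)) / 2 ≤ P.edge := by
    have : (2 : ℝ) ^ (-(k : ℝ)) / 2 = 2 ^ (-((k : ℤ) + 1)) := by
      rw [← Real.rpow_intCast]; push_cast
      rw [neg_add, Real.rpow_add (by norm_num), Real.rpow_neg_one]; ring
    rw [this]
    exact zpow_le_zpow_right₀ (by norm_num) (by omega)
  have hlow : ENNReal.ofReal (c * 2 ^ (-(k * α))) * volume P.farChild.toSet ≤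
      weightMeasure d n α P.toSet := by
    refine le_trans ?_ (measure_mono P.farChild_subset)
    rw [weightMeasure_eq, withDensity_apply _ P.farChild.measurableSet_toSet, ← setLIntegral_const]
    refine setLIntegral_mono' P.farChild.measurableSet_toSet fun y hy => ?_
    refine ENNReal.ofReal_le_ofReal (hw _ _ ?_ ?_)
    · have h1 := DyadicCube.le_abs_of_mem_farChild hy (Sum.inr ⟨0, hn⟩)
      have h2 : |y (Sum.inr ⟨0, hn⟩)| ≤ ‖fiberPart y‖ := by
        rw [← Real.norm_eq_abs]; exact PiLp.norm_apply_le (fiberPart y) ⟨0, hn⟩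
      linarith
    · have h1 := Metric.mem_closedBall.1 (hP (P.farChild_subset hy))
      have h2 := dist_fiberPart_le y (embed n x)
      rw [fiberPart_embed, dist_zero_right] at h2
      linarith
  have hvol : (2 : ℝ≥0∞) ^ (-((k + 2) * ((d : ℝ) + n))) ≤ volume P.farChild.toSet := by
    rw [DyadicCube.volume_toSet]
    refine two_rpow_mono ?_
    have h2 : ((P.level : ℤ) : ℝ) ≤ k + 1 := by exact_mod_cast hl
    simp only [DyadicCube.farChild, Fintype.card_sum, Fintype.card_fin]
    push_cast
    rw [neg_le_neg_iff]
    exact mul_le_mul_of_nonneg_right (by linarith) (by positivity)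
  calc (weightMeasure d n α P.toSet)⁻¹ ≤ (ENNReal.ofReal (c * 2 ^ (-(k * α))) *
        (2 : ℝ≥0∞) ^ (-((k + 2) * ((d : ℝ) + n))))⁻¹ :=
        ENNReal.inv_le_inv.2 (le_trans (by gcongr) hlow)
    _ = _ := by
        rw [← ofReal_two_rpow, ← ENNReal.ofReal_mul (by positivity),
          ← ENNReal.ofReal_inv_of_pos (by positivity), ← ofReal_two_rpow]
        change _ = ENNReal.ofReal _ * _
        rw [← ENNReal.ofReal_mul (by positivity)]
        congr 1
        rw [mul_inv, mul_inv, ← Real.rpow_neg (by norm_num), ← Real.rpow_neg (by norm_num),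
          mul_assoc, mul_assoc, ← Real.rpow_add (by norm_num), ← Real.rpow_add (by norm_num)]
        ring_nf

/-- The part of `ℝ^n` in the negative orthant at scale `2 ^ (-k)`. The negative orthant is chosen
because the dyadic cubes are open on the left: a point of the layer and the origin lie in the same
dyadic cube of generation `k`. -/
def negativeLayer (n k : ℕ) : Set (EuclideanSpace ℝ (Fin n)) :=
  {v | ∀ j, -(2 : ℝ) ^ (-(k : ℤ)) < v j ∧ v j ≤ -(2 : ℝ) ^ (-((k : ℤ) + 1))}

theorem negativeLayer_eq (n k : ℕ) : negativeLayer n k =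
    (DyadicCube.mk ((k : ℤ) + 1) fun _ : Fin n => -2).toSet := by
  ext v
  have : (2 : ℝ) ^ (-(k : ℤ)) = 2 * 2 ^ (-((k : ℤ) + 1)) := by
    rw [neg_add, zpow_add₀ (by norm_num)]; norm_num; ring
  simp only [negativeLayer, DyadicCube.toSet, DyadicCube.edge, mem_ofPred_eq, this]
  refine forall_congr' fun j => ?_
  push_cast
  ring_nf

theorem exists_le_setLIntegral_negativeLayer (hn : 1 ≤ n) (α : ℝ) :
    ∃ c : ℝ≥0, 0 < c ∧ ∀ k : ℕ, c * (2 : ℝ≥0∞) ^ (-((k : ℝ) * (n + α))) ≤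
      ∫⁻ v in negativeLayer n k, ENNReal.ofReal (weight n α v) := by
  have hR : (1 : ℝ) ≤ n := by exact_mod_cast hn
  obtain ⟨c, hc, hw⟩ := exists_le_weight n α hR
  refine ⟨Real.toNNReal (c * 2 ^ (-(n : ℝ))), by simpa using by positivity, fun k => ?_⟩
  have hm : MeasurableSet (negativeLayer n k) := by
    rw [negativeLayer_eq]; exact DyadicCube.measurableSet_toSet _
  have hk : (2 : ℝ) ^ (-(k : ℝ)) = 2 ^ (-(k : ℤ)) := by
    rw [← Real.rpow_intCast]; push_cast; rfl
  have hk' : (2 : ℝ) ^ (-((k : ℤ) + 1)) = 2 ^ (-(k : ℤ)) / 2 := by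
    rw [neg_add, zpow_add₀ (by norm_num)]; norm_num; ring
  have hpos : (0 : ℝ) < 2 ^ (-(k : ℤ)) := by positivity
  calc _ = ENNReal.ofReal (c * 2 ^ (-(k * α))) * volume (negativeLayer n k) := by
        rw [negativeLayer_eq, DyadicCube.volume_toSet, ← ofReal_two_rpow, ← ofReal_two_rpow,
          ← ENNReal.ofReal_mul (by positivity)]
        change ENNReal.ofReal _ * _ = _
        rw [← ENNReal.ofReal_mul (by positivity), mul_assoc, mul_assoc,
          ← Real.rpow_add (by norm_num), ← Real.rpow_add (by norm_num)]
        congr 3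
        push_cast
        rw [Fintype.card_fin]; ring
    _ = ∫⁻ v in negativeLayer n k, ENNReal.ofReal (c * 2 ^ (-(k * α))) :=
        (setLIntegral_const _ _).symm
    _ ≤ _ := by
        refine setLIntegral_mono' hm fun v hv => ENNReal.ofReal_le_ofReal (hw v k ?_ ?_)
        · have h2 : |v ⟨0, hn⟩| ≤ ‖v‖ := by
            rw [← Real.norm_eq_abs]; exact PiLp.norm_apply_le v ⟨0, hn⟩
          have h3 := (hv ⟨0, hn⟩).2
          rw [hk'] at h3
          rw [hk]
          have := neg_le_abs (v ⟨0, hn⟩)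
          linarith
        · rw [hk, ← dist_zero_right]
          simpa using DyadicCube.dist_le_of_abs_le hpos.le (x := v) (y := 0) fun j => by
            have h3 := hv j
            rw [hk'] at h3
            simp only [PiLp.zero_apply, sub_zero, abs_le]
            constructor <;> linarith [h3.1, h3.2]

end

/-! ### Oscillation bounds and the Besov energy -/

section

variable {ι : Type}

/-- The largest difference of the values attached to a cube and to one of its neighbours. -/
noncomputable def maxJump (a : DyadicCube ι → ℂ) (Q : DyadicCube ι) : ℝ≥0∞ :=
  ⨆ Q' : {Q' : DyadicCube ι // Q.Neighbor Q'}, ‖a Q - a Q'.1‖ₑ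

theorem le_maxJump (a : DyadicCube ι → ℂ) {Q Q' : DyadicCube ι} (h : Q.Neighbor Q') :
    ‖a Q - a Q'‖ₑ ≤ maxJump a Q :=
  le_iSup (fun Q' : {Q' : DyadicCube ι // Q.Neighbor Q'} => ‖a Q - a Q'.1‖ₑ) ⟨Q', h⟩

/-- The sum of the jumps at all scales `k, k + 1, …` along the cubes containing a point. -/
noncomputable def jumpTail (a : DyadicCube ι → ℂ) (k : ℕ) (z : EuclideanSpace ℝ ι) : ℝ≥0∞ :=
  ∑' j : ℕ, maxJump a (DyadicCube.at_ ((k + j : ℕ) : ℤ) z)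

theorem maxJump_le_jumpTail (a : DyadicCube ι → ℂ) (k : ℕ) (z : EuclideanSpace ℝ ι) :
    maxJump a (DyadicCube.at_ k z) ≤ jumpTail a k z :=
  ENNReal.le_tsum (f := fun j : ℕ => maxJump a (DyadicCube.at_ ((k + j : ℕ) : ℤ) z)) 0

theorem edist_at_succ_le (a : DyadicCube ι → ℂ) (k : ℕ) (z : EuclideanSpace ℝ ι) :
    edist (a (DyadicCube.at_ k z)) (a (DyadicCube.at_ ((k + 1 : ℕ) : ℤ) z)) ≤
      maxJump a (DyadicCube.at_ k z) := by
  rw [edist_eq_enorm_sub]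
  push_cast
  exact le_maxJump a (DyadicCube.neighbor_at_succ _ _)

theorem edist_le_jumpTail {a : DyadicCube ι → ℂ} {z : EuclideanSpace ℝ ι} {b : ℂ}
    (h : Tendsto (fun k : ℕ => a (DyadicCube.at_ k z)) atTop (𝓝 b)) (k : ℕ) :
    ‖a (DyadicCube.at_ k z) - b‖ₑ ≤ jumpTail a k z := by
  rw [← edist_eq_enorm_sub]
  exact edist_le_tsum_of_edist_le_of_tendsto (fun k : ℕ => maxJump a (DyadicCube.at_ k z))
    (fun k => edist_at_succ_le a k z) h k

theorem tsum_neighbor_le {N : ℕ}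
    (hN : ∀ Q : DyadicCube ι, {Q' : DyadicCube ι | Q.Neighbor Q'}.encard ≤ N) (Q : DyadicCube ι)
    {F : DyadicCube ι → ℝ≥0∞} {A : ℝ≥0∞} (h : ∀ Q', Q.Neighbor Q' → F Q' ≤ A) :
    ∑' Q' : {Q' : DyadicCube ι // Q.Neighbor Q'}, F Q'.1 ≤ N * A := by
  calc _ ≤ ∑' _Q' : {Q' : DyadicCube ι // Q.Neighbor Q'}, A :=
        ENNReal.tsum_le_tsum fun Q' => h _ Q'.2
    _ = ({Q' : DyadicCube ι | Q.Neighbor Q'}.encard : ℝ≥0∞) * A := ENNReal.tsum_set_const _ _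
    _ ≤ _ := by
        gcongr
        exact_mod_cast hN Q

variable [Fintype ι]

/-- `M i x` bounds the mean oscillation of `g` over the ball of radius `2 ^ (m - i)` around `x`, up
to a constant factor depending on `m`. For the finitely many coarse scales `i < m` it even bounds
the mean of `|g|`. -/
def IsOscBound (m : ℕ) (g : EuclideanSpace ℝ ι → ℂ) (M : ℕ → EuclideanSpace ℝ ι → ℝ≥0∞) : Prop :=
  ∀ i x, ∃ c : ℂ, (i < m → c = 0) ∧
    (2 : ℝ≥0∞) ^ ((i : ℝ) * Fintype.card ι) *
      ∫⁻ z in Metric.ball x ((2 : ℝ) ^ ((m : ℤ) - i)), ‖g z - c‖ₑ ≤ M i x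

theorem measurable_jumpTail (a : DyadicCube ι → ℂ) (k : ℕ) : Measurable (jumpTail a k) :=
  Measurable.tsum fun _ => DyadicCube.measurable_comp_at _ _

theorem lintegral_jumpTail_rpow_le {p σ : ℝ} (hp : 0 < p) (a : DyadicCube ι → ℂ) (k : ℕ) :
    ∫⁻ z, jumpTail a k z ^ p ≤ (∑' j : ℕ, (2 : ℝ≥0∞) ^ (-(σ * j))) ^ p *
      ∑' j : ℕ, ∫⁻ z, (2 ^ (σ * j) * maxJump a (DyadicCube.at_ ((k + j : ℕ) : ℤ) z)) ^ p := by
  have hm : ∀ j : ℕ, Measurable fun z : EuclideanSpace ℝ ι =>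
      ((2 : ℝ≥0∞) ^ (σ * j) * maxJump a (DyadicCube.at_ ((k + j : ℕ) : ℤ) z)) ^ p := fun j =>
    DyadicCube.measurable_comp_at _ fun Q => ((2 : ℝ≥0∞) ^ (σ * j) * maxJump a Q) ^ p
  calc _ ≤ ∫⁻ z, (∑' j : ℕ, (2 : ℝ≥0∞) ^ (-(σ * j))) ^ p *
        ∑' j : ℕ, (2 ^ (σ * j) * maxJump a (DyadicCube.at_ ((k + j : ℕ) : ℤ) z)) ^ p :=
        lintegral_mono fun z => tsum_rpow_le hp _
    _ = _ := by
        rw [lintegral_const_mul _ (Measurable.tsum hm),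
          lintegral_tsum fun j => (hm j).aemeasurable]

/-- A discrete Hardy inequality for the tails of the jumps. -/
theorem exists_tsum_jumpTail_le {p σ : ℝ} (hp : 0 < p) (hσ : 0 < σ) :
    ∃ C : ℝ≥0, ∀ a : DyadicCube ι → ℂ,
      ∑' k : ℕ, ∫⁻ z, ((2 : ℝ≥0∞) ^ ((k : ℝ) * σ) * jumpTail a k z) ^ p ≤
        C * ∑' k : ℕ, ∫⁻ z, ((2 : ℝ≥0∞) ^ ((k : ℝ) * σ) * maxJump a (DyadicCube.at_ k z)) ^ p := by
  set K := (∑' j : ℕ, (2 : ℝ≥0∞) ^ (-(σ / 2 * j))) ^ p with hK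
  set W := ∑' j : ℕ, (2 : ℝ≥0∞) ^ (-(σ / 2 * p * j)) with hW
  have hKt : K ≠ ∞ := ENNReal.rpow_ne_top_of_nonneg hp.le (tsum_two_rpow_lt_top (by positivity)).ne
  have hWt : W ≠ ∞ := (tsum_two_rpow_lt_top (by positivity)).ne
  refine ⟨(K * W).toNNReal, fun a => ?_⟩
  rw [ENNReal.coe_toNNReal (ENNReal.mul_ne_top hKt hWt)]
  set F : ℕ → ℝ≥0∞ := fun k =>
    ∫⁻ z, ((2 : ℝ≥0∞) ^ ((k : ℝ) * σ) * maxJump a (DyadicCube.at_ k z)) ^ p with hF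
  have hpull : ∀ (c : ℝ) (h : EuclideanSpace ℝ ι → ℝ≥0∞),
      ∫⁻ z, ((2 : ℝ≥0∞) ^ c * h z) ^ p = 2 ^ (c * p) * ∫⁻ z, h z ^ p := fun c h => by
    simp_rw [ENNReal.mul_rpow_of_nonneg _ _ hp.le, two_rpow_rpow]
    exact lintegral_const_mul' _ _ (two_rpow_ne_top _)
  calc _ ≤ ∑' k : ℕ, 2 ^ ((k : ℝ) * σ * p) * (K * ∑' j : ℕ, 2 ^ (σ / 2 * j * p) *
        ∫⁻ z, maxJump a (DyadicCube.at_ ((k + j : ℕ) : ℤ) z) ^ p) := by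
        refine ENNReal.tsum_le_tsum fun k => ?_
        rw [hpull]
        gcongr
        refine (lintegral_jumpTail_rpow_le (σ := σ / 2) hp a k).trans (le_of_eq ?_)
        congr 2
        ext j
        rw [hpull]
    _ = K * ∑' k : ℕ, ∑' j : ℕ, 2 ^ (-(σ / 2 * p * j)) * F (k + j) := by
        rw [← ENNReal.tsum_mul_left]
        refine tsum_congr fun k => ?_
        rw [mul_left_comm, ← ENNReal.tsum_mul_left]
        congr 2
        ext j
        rw [hF]
        simp only
        rw [hpull, ← mul_assoc, ← mul_assoc, ← two_rpow_add, ← two_rpow_add]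
        congr 2
        push_cast; ring
    _ = K * ∑' j : ℕ, 2 ^ (-(σ / 2 * p * j)) * ∑' k : ℕ, F (k + j) := by
        rw [ENNReal.tsum_comm]
        simp_rw [ENNReal.tsum_mul_left]
    _ ≤ K * ∑' j : ℕ, 2 ^ (-(σ / 2 * p * j)) * ∑' k : ℕ, F k := by
        refine mul_le_mul_right (ENNReal.tsum_le_tsum fun j => mul_le_mul_right ?_ _) _
        exact ENNReal.tsum_comp_le_tsum_of_injective (f := fun k : ℕ => k + j)
          (add_left_injective j) F
    _ = _ := by rw [ENNReal.tsum_mul_right, mul_assoc]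

/-- A function that is the limit of values attached to the dyadic cubes has its oscillation
controlled by the jumps of these values. -/
theorem exists_isOscBound {p σ : ℝ} (hp : 1 ≤ p) (hσ : 0 < σ) (m : ℕ) :
    ∃ C : ℝ≥0, ∀ (a : DyadicCube ι → ℂ) (g : EuclideanSpace ℝ ι → ℂ),
      AEStronglyMeasurable g volume →
      (∀ᵐ x, Tendsto (fun k : ℕ => a (DyadicCube.at_ k x)) atTop (𝓝 (g x))) →
      ∃ M : ℕ → EuclideanSpace ℝ ι → ℝ≥0∞, (∀ i, Measurable (M i)) ∧ IsOscBound m g M ∧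
        ∑' i : ℕ, ∫⁻ x, ((2 : ℝ≥0∞) ^ ((i : ℝ) * σ) * M i x) ^ p ≤
          C * ((∫⁻ x, ‖g x‖ₑ ^ p) + ∑' k : ℕ, ∫⁻ x,
            ((2 : ℝ≥0∞) ^ ((k : ℝ) * σ) * maxJump a (DyadicCube.at_ k x)) ^ p) := by
  have hp0 : 0 < p := by linarith
  obtain ⟨C₁, hC₁⟩ := exists_tsum_jumpTail_le (ι := ι) hp0 hσ
  set D : ℝ := ((Fintype.card ι : ℕ) : ℝ)
  set V : ℝ → ℝ≥0∞ := fun r => volume (Metric.ball (0 : EuclideanSpace ℝ ι) r) with hV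
  have hVt : ∀ r, V r ≠ ∞ := fun r => measure_ball_lt_top.ne
  set K₀ : ℝ≥0∞ := ∑ i ∈ Finset.range m,
    ((2 : ℝ≥0∞) ^ ((i : ℝ) * σ + i * D)) ^ p * V ((2 : ℝ) ^ ((m : ℤ) - i)) ^ p with hK₀
  have hK₀t : K₀ ≠ ∞ := ENNReal.sum_ne_top.2 fun i _ => ENNReal.mul_ne_top
    (ENNReal.rpow_ne_top_of_nonneg hp0.le (two_rpow_ne_top _))
    (ENNReal.rpow_ne_top_of_nonneg hp0.le (hVt _))
  set K₁ : ℝ≥0∞ := (2 * 2 ^ ((m : ℝ) * (σ + D)) * V 1) ^ p with hK₁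
  have hK₁t : K₁ ≠ ∞ := ENNReal.rpow_ne_top_of_nonneg hp0.le
    (ENNReal.mul_ne_top (ENNReal.mul_ne_top (by simp) (two_rpow_ne_top _)) (hVt _))
  refine ⟨(K₀ + K₁ * C₁).toNNReal, fun a g hg hlim => ?_⟩
  rw [ENNReal.coe_toNNReal (ENNReal.add_ne_top.2 ⟨hK₀t, ENNReal.mul_ne_top hK₁t (by simp)⟩)]
  set g' : EuclideanSpace ℝ ι → ℂ := hg.mk g with hg'
  have hg'm : Measurable fun z => ‖g' z‖ₑ := hg.stronglyMeasurable_mk.measurable.enorm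
  have hgg' : ∀ᵐ z, ‖g z‖ₑ = ‖g' z‖ₑ := hg.ae_eq_mk.mono fun z hz => by rw [hg', ← hz]
  -- for `i ≥ m` the comparison constant is the value at scale `i - m`, because the points of a ball
  -- of radius `2 ^ (m - i)` lie in neighbouring cubes of that generation
  refine ⟨fun i x => if i < m then 2 ^ ((i : ℝ) * D) *
      ∫⁻ z in Metric.ball x ((2 : ℝ) ^ ((m : ℤ) - i)), ‖g' z‖ₑ
    else 2 ^ ((i : ℝ) * D) * (2 *
      ∫⁻ z in Metric.ball x ((2 : ℝ) ^ ((m : ℤ) - i)), jumpTail a (i - m) z), fun i => ?_,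
      fun i x => ?_, ?_⟩
  · by_cases hi : i < m <;> simp only [hi, if_true, if_false]
    · exact (measurable_setLIntegral_ball measurable_id _ hg'm).const_mul _
    · exact ((measurable_setLIntegral_ball measurable_id _ (measurable_jumpTail _ _)).const_mul
        _).const_mul _
  · by_cases hi : i < m
    · refine ⟨0, fun _ => rfl, ?_⟩
      simp only [hi, if_true, sub_zero]
      exact mul_le_mul_right (lintegral_congr_ae (ae_restrict_of_ae hgg')).le _
    · refine ⟨a (DyadicCube.at_ ((i - m : ℕ) : ℤ) x), fun h => absurd h hi, ?_⟩
      simp only [hi, if_false]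
      gcongr
      rw [← lintegral_const_mul _ (measurable_jumpTail _ _)]
      refine lintegral_mono_ae ?_
      filter_upwards [ae_restrict_of_ae hlim, ae_restrict_mem Metric.isOpen_ball.measurableSet]
        with z hz hzx
      have h1 := edist_le_jumpTail hz (i - m)
      have h2 : (DyadicCube.at_ ((i - m : ℕ) : ℤ) z).Neighbor
          (DyadicCube.at_ ((i - m : ℕ) : ℤ) x) := by
        refine DyadicCube.neighbor_at_of_abs_le fun j =>
          (DyadicCube.abs_coord_sub_le z x j).trans ?_
        rw [Metric.mem_ball] at hzx
        refine hzx.le.trans (le_of_eq ?_)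
        congr 1
        omega
      have h3 := (le_maxJump a h2).trans (maxJump_le_jumpTail a _ z)
      calc ‖g z - a (DyadicCube.at_ ((i - m : ℕ) : ℤ) x)‖ₑ
          = ‖(a (DyadicCube.at_ ((i - m : ℕ) : ℤ) z) - a (DyadicCube.at_ ((i - m : ℕ) : ℤ) x)) -
            (a (DyadicCube.at_ ((i - m : ℕ) : ℤ) z) - g z)‖ₑ := by congr 1; ring
        _ ≤ _ := enorm_sub_le
        _ ≤ _ := by rw [two_mul]; exact add_le_add h3 h1
  · rw [← ENNReal.summable.sum_add_tsum_nat_add' (k := m), mul_add, add_mul, add_mul]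
    have hA : ∑ i ∈ Finset.range m, ∫⁻ x, ((2 : ℝ≥0∞) ^ ((i : ℝ) * σ) *
        (if i < m then 2 ^ ((i : ℝ) * D) *
          ∫⁻ z in Metric.ball x ((2 : ℝ) ^ ((m : ℤ) - i)), ‖g' z‖ₑ
        else 2 ^ ((i : ℝ) * D) * (2 *
          ∫⁻ z in Metric.ball x ((2 : ℝ) ^ ((m : ℤ) - i)), jumpTail a (i - m) z))) ^ p ≤
        K₀ * ∫⁻ x, ‖g x‖ₑ ^ p := by
      rw [hK₀, Finset.sum_mul]
      refine Finset.sum_le_sum fun i hi => ?_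
      simp only [Finset.mem_range.1 hi, if_true, ← mul_assoc, ← two_rpow_add]
      simp_rw [ENNReal.mul_rpow_of_nonneg _ _ hp0.le]
      rw [lintegral_const_mul' _ _ (ENNReal.rpow_ne_top_of_nonneg hp0.le (two_rpow_ne_top _)),
        mul_assoc]
      gcongr
      refine (lintegral_rpow_setLIntegral_ball_le hp hg'm).trans (le_of_eq ?_)
      congr 1
      exact lintegral_congr_ae (hgg'.mono fun z hz => by simp only [hz])
    have hB : ∑' k : ℕ, ∫⁻ x, ((2 : ℝ≥0∞) ^ (((k + m : ℕ) : ℝ) * σ) *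
        (if k + m < m then 2 ^ (((k + m : ℕ) : ℝ) * D) *
          ∫⁻ z in Metric.ball x ((2 : ℝ) ^ ((m : ℤ) - (k + m : ℕ))), ‖g' z‖ₑ
        else 2 ^ (((k + m : ℕ) : ℝ) * D) * (2 *
          ∫⁻ z in Metric.ball x ((2 : ℝ) ^ ((m : ℤ) - (k + m : ℕ))),
            jumpTail a (k + m - m) z))) ^ p ≤
        K₁ * C₁ * ∑' k : ℕ, ∫⁻ x,
            ((2 : ℝ≥0∞) ^ ((k : ℝ) * σ) * maxJump a (DyadicCube.at_ k x)) ^ p := by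
      rw [mul_assoc]
      refine le_trans ?_ (mul_le_mul_right (hC₁ a) K₁)
      rw [← ENNReal.tsum_mul_left]
      refine ENNReal.tsum_le_tsum fun k => ?_
      have hk : ¬ k + m < m := by omega
      have hk2 : (m : ℤ) - (k + m : ℕ) = -(k : ℤ) := by push_cast; ring
      simp only [hk, if_false, hk2, Nat.add_sub_cancel, ← mul_assoc, ← two_rpow_add]
      simp_rw [ENNReal.mul_rpow_of_nonneg _ (_ : ℝ≥0∞) hp0.le]
      have hc1 : ((2 : ℝ≥0∞) ^ (((k + m : ℕ) : ℝ) * σ + ((k + m : ℕ) : ℝ) * D)) ^ p * 2 ^ p ≠ ∞ :=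
        ENNReal.mul_ne_top (ENNReal.rpow_ne_top_of_nonneg hp0.le (two_rpow_ne_top _))
          (two_rpow_ne_top _)
      have hc2 : ((2 : ℝ≥0∞) ^ ((k : ℝ) * σ)) ^ p ≠ ∞ :=
        ENNReal.rpow_ne_top_of_nonneg hp0.le (two_rpow_ne_top _)
      rw [lintegral_const_mul' _ _ hc1, lintegral_const_mul' _ _ hc2]
      refine (mul_le_mul_right (lintegral_rpow_setLIntegral_ball_le hp
        (measurable_jumpTail a k)) _).trans (le_of_eq ?_)
      have hv := volume_ball_two_zpow (0 : EuclideanSpace ℝ ι) one_pos k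
      rw [one_mul] at hv
      rw [hv, hK₁, ← mul_assoc, ← mul_assoc]
      congr 1
      rw [← ENNReal.mul_rpow_of_nonneg _ _ hp0.le, ← ENNReal.mul_rpow_of_nonneg _ _ hp0.le,
        ← ENNReal.mul_rpow_of_nonneg _ _ hp0.le]
      congr 1
      have : (2 : ℝ≥0∞) ^ (((k + m : ℕ) : ℝ) * σ + ((k + m : ℕ) : ℝ) * D) =
          2 ^ ((m : ℝ) * (σ + D)) * 2 ^ ((k : ℝ) * σ) * 2 ^ ((k : ℝ) * D) := by
        rw [← two_rpow_add, ← two_rpow_add]; congr 1; push_cast; ring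
      rw [this]
      have h1 := two_rpow_neg_mul ((k : ℝ) * D)
      calc _ = 2 * 2 ^ ((m : ℝ) * (σ + D)) * V 1 * 2 ^ ((k : ℝ) * σ) *
            (2 ^ (-((k : ℝ) * D)) * 2 ^ ((k : ℝ) * D)) := by
            push_cast; ring
        _ = _ := by rw [h1, mul_one]
    calc _ ≤ _ := add_le_add hA hB
      _ ≤ _ := by
        rw [add_assoc]
        gcongr
        exact le_add_self.trans le_add_self

theorem lqNorm_ofReal_rpow {p : ℝ} (hp : 0 < p) {κ : Type} (b : κ → ℝ≥0∞) :
    lqNorm (ENNReal.ofReal p) b ^ p = ∑' j, b j ^ p := by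
  rw [lqNorm, if_neg ENNReal.ofReal_ne_top, ENNReal.toReal_ofReal hp.le, ← ENNReal.rpow_mul,
    one_div_mul_cancel hp.ne', ENNReal.rpow_one]

theorem besovEnergy_rpow {p : ℝ} (hp : 0 < p) (σ : ℝ) (f : EuclideanSpace ℝ ι → ℂ) :
    besovEnergy σ p (ENNReal.ofReal p) volume f ^ p = ∑' k : ℕ, ∫⁻ x,
      ((2 : ℝ≥0∞) ^ ((k : ℝ) * σ)) ^ p *
        ∑' Q' : {Q' : DyadicCube ι // (DyadicCube.at_ k x).Neighbor Q'},
          avgDiff volume f (DyadicCube.at_ k x) Q'.1 ^ p := by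
  rw [besovEnergy, lqNorm_ofReal_rpow hp]
  refine tsum_congr fun k => ?_
  rw [ENNReal.mul_rpow_of_nonneg _ _ hp.le, ← ENNReal.rpow_mul _ (1 / p), one_div_mul_cancel hp.ne',
    ENNReal.rpow_one, DyadicCube.tsum_measure_mul_eq volume k fun Q =>
      ∑' Q' : {Q' : DyadicCube ι // Q.Neighbor Q'}, avgDiff volume f Q Q'.1 ^ p,
    lintegral_const_mul' _ _ (ENNReal.rpow_ne_top_of_nonneg hp.le (two_rpow_ne_top _))]

/-- The jumps of the averages over cubes are controlled by the Besov energy. -/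
theorem tsum_maxJump_average_le {p : ℝ} (hp : 0 < p) (σ : ℝ) (f : EuclideanSpace ℝ ι → ℂ) :
    ∑' k : ℕ, ∫⁻ x, ((2 : ℝ≥0∞) ^ ((k : ℝ) * σ) *
      maxJump (fun Q => ⨍ y in Q.toSet, f y) (DyadicCube.at_ k x)) ^ p ≤
      besovEnergy σ p (ENNReal.ofReal p) volume f ^ p := by
  rw [besovEnergy_rpow hp]
  refine ENNReal.tsum_le_tsum fun k => lintegral_mono fun x => ?_
  rw [ENNReal.mul_rpow_of_nonneg _ _ hp.le]
  gcongr
  rw [← ENNReal.le_rpow_inv_iff hp]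
  refine iSup_le fun Q' => ?_
  rw [ENNReal.le_rpow_inv_iff hp]
  exact ENNReal.le_tsum (f := fun Q' : {Q' : DyadicCube ι // (DyadicCube.at_ k x).Neighbor Q'} =>
    avgDiff volume f (DyadicCube.at_ k x) Q'.1 ^ p) Q'

/-- Conversely, oscillation bounds control the Besov energy, as soon as `m` is so large that the
balls contain the neighbouring cubes. -/
theorem exists_besovEnergy_le {p σ : ℝ} (hp : 1 ≤ p) {m : ℕ}
    (hm : 3 * (Fintype.card ι : ℝ) + 1 ≤ 2 ^ m) :
    ∃ C : ℝ≥0, ∀ (g : EuclideanSpace ℝ ι → ℂ) (M : ℕ → EuclideanSpace ℝ ι → ℝ≥0∞),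
      LocallyIntegrable g → IsOscBound m g M →
      besovEnergy σ p (ENNReal.ofReal p) volume g ^ p ≤
        C * ∑' i : ℕ, ∫⁻ x, ((2 : ℝ≥0∞) ^ ((i : ℝ) * σ) * M i x) ^ p := by
  have hp0 : 0 < p := by linarith
  obtain ⟨N, hN⟩ := DyadicCube.exists_card_neighbor_le ι
  set D : ℝ := ((Fintype.card ι : ℕ) : ℝ) with hD
  set K : ℝ≥0∞ := N * (1 + 2 ^ D) ^ p with hK
  have hKt : K ≠ ∞ := ENNReal.mul_ne_top (by simp)
    (ENNReal.rpow_ne_top_of_nonneg hp0.le (ENNReal.add_ne_top.2 ⟨by simp, two_rpow_ne_top _⟩))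
  refine ⟨K.toNNReal, fun g M hg hM => ?_⟩
  rw [ENNReal.coe_toNNReal hKt, besovEnergy_rpow hp0, ← ENNReal.tsum_mul_left]
  refine ENNReal.tsum_le_tsum fun k => ?_
  rw [← lintegral_const_mul' _ _ hKt]
  refine lintegral_mono fun x => ?_
  obtain ⟨c, -, hc⟩ := hM k x
  set B := Metric.ball x ((2 : ℝ) ^ ((m : ℤ) - k)) with hB
  have hball : Metric.closedBall x (3 * D * (DyadicCube.at_ (k : ℤ) x).edge) ⊆ B := by
    refine Metric.closedBall_subset_ball ?_
    rw [DyadicCube.edge_at, sub_eq_add_neg, zpow_add₀ (by norm_num), zpow_natCast]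
    refine mul_lt_mul_of_pos_right ?_ (by positivity)
    linarith
  have hgB : IntegrableOn g B := (hg.integrableOn_isCompact (isCompact_closedBall x _)).mono_set
    Metric.ball_subset_closedBall
  have havg : ∀ Q' : DyadicCube ι, Q'.level ≤ k + 1 → Q'.toSet ⊆ B →
      ‖(⨍ y in Q'.toSet, g y) - c‖ₑ ≤ 2 ^ D * M k x := by
    intro Q' hl hQ'
    have hv := DyadicCube.volume_toSet Q'
    refine (enorm_setAverage_sub_le (by rw [hv]; exact two_rpow_ne_zero _)
      (by rw [hv]; exact two_rpow_ne_top _) (hgB.mono_set hQ') c).trans ?_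
    calc _ ≤ 2 ^ ((k + 1) * D) * ∫⁻ y in B, ‖g y - c‖ₑ := by
          gcongr
          rw [hv, ← ENNReal.rpow_neg, neg_neg]
          refine two_rpow_mono (mul_le_mul_of_nonneg_right ?_ (by positivity))
          exact_mod_cast hl
      _ = 2 ^ D * (2 ^ (k * D) * ∫⁻ y in B, ‖g y - c‖ₑ) := by
          rw [← mul_assoc, ← two_rpow_add]; congr 2; ring
      _ ≤ _ := by gcongr
  have h0 : ‖(⨍ y in (DyadicCube.at_ k x).toSet, g y) - c‖ₑ ≤ M k x := by
    have hv := DyadicCube.volume_toSet (DyadicCube.at_ k x)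
    have hQ : (DyadicCube.at_ k x).toSet ⊆ B :=
      (DyadicCube.Neighbor.subset_closedBall (DyadicCube.neighbor_of_mem (by simp)
        (DyadicCube.mem_at k x) (DyadicCube.mem_at k x)) (DyadicCube.mem_at k x)).trans hball
    refine (enorm_setAverage_sub_le (by rw [hv]; exact two_rpow_ne_zero _)
      (by rw [hv]; exact two_rpow_ne_top _) (hgB.mono_set hQ) c).trans (le_trans ?_ hc)
    gcongr
    · rw [hv, ← ENNReal.rpow_neg, neg_neg]; rfl
  have key : ∀ Q', (DyadicCube.at_ k x).Neighbor Q' →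
      avgDiff volume g (DyadicCube.at_ k x) Q' ^ p ≤ ((1 + 2 ^ D) * M k x) ^ p := by
    intro Q' hQ'
    gcongr
    have hl : Q'.level ≤ k + 1 := by
      have := (DyadicCube.neighbor_iff.1 hQ').1
      have h1 : (DyadicCube.at_ (k : ℤ) x).level = k := rfl
      rw [h1, abs_le] at this
      omega
    have h1 := havg Q' hl ((hQ'.subset_closedBall (DyadicCube.mem_at k x)).trans hball)
    calc avgDiff volume g (DyadicCube.at_ k x) Q' =
          ‖((⨍ y in (DyadicCube.at_ k x).toSet, g y) - c) - ((⨍ y in Q'.toSet, g y) - c)‖ₑ := by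
          rw [avgDiff, sub_sub_sub_cancel_right]
      _ ≤ _ := enorm_sub_le
      _ ≤ M k x + 2 ^ D * M k x := add_le_add h0 h1
      _ = _ := by ring
  calc _ ≤ ((2 : ℝ≥0∞) ^ ((k : ℝ) * σ)) ^ p * (N * ((1 + 2 ^ D) * M k x) ^ p) := by
        gcongr
        exact tsum_neighbor_le (F := fun Q' => avgDiff volume g (DyadicCube.at_ k x) Q' ^ p)
          hN _ key
    _ = _ := by
        rw [ENNReal.mul_rpow_of_nonneg _ _ hp0.le, ENNReal.mul_rpow_of_nonneg _ _ hp0.le, hK]; ring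

theorem eLpNorm_ofReal_rpow {X : Type*} [MeasurableSpace X] {μ : Measure X} {p : ℝ} (hp : 0 < p)
    (f : X → ℂ) : eLpNorm f (ENNReal.ofReal p) μ ^ p = ∫⁻ x, ‖f x‖ₑ ^ p ∂μ := by
  rw [eLpNorm_eq_lintegral_rpow_enorm_toReal (by simpa using hp) ENNReal.ofReal_ne_top,
    ENNReal.toReal_ofReal hp.le, ← ENNReal.rpow_mul, one_div_mul_cancel hp.ne', ENNReal.rpow_one]

theorem le_of_rpow_le {p : ℝ} (hp : 0 < p) {a b : ℝ≥0∞} {C : ℝ≥0}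
    (h : a ^ p ≤ C * b ^ p) : a ≤ (C ^ (1 / p) : ℝ≥0) * b := by
  rw [← ENNReal.rpow_le_rpow_iff hp, ENNReal.mul_rpow_of_nonneg _ _ hp.le,
    ENNReal.coe_rpow_of_nonneg _ (by positivity), ← ENNReal.rpow_mul, one_div_mul_cancel hp.ne',
    ENNReal.rpow_one]
  exact h

/-- Functions in the Besov space have their oscillation controlled by the Besov norm. -/
theorem exists_isOscBound_of_besov {p σ : ℝ} (hp : 1 ≤ p) (hσ : 0 < σ) (m : ℕ) :
    ∃ C : ℝ≥0, ∀ f : EuclideanSpace ℝ ι → ℂ, LocallyIntegrable f →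
      ∃ M : ℕ → EuclideanSpace ℝ ι → ℝ≥0∞, (∀ i, Measurable (M i)) ∧ IsOscBound m f M ∧
        ∑' i : ℕ, ∫⁻ x, ((2 : ℝ≥0∞) ^ ((i : ℝ) * σ) * M i x) ^ p ≤
          C * besovNorm σ p (ENNReal.ofReal p) volume f ^ p := by
  have hp0 : 0 < p := by linarith
  obtain ⟨C, hC⟩ := exists_isOscBound (ι := ι) hp hσ m
  refine ⟨C * 2, fun f hf => ?_⟩
  obtain ⟨M, h1, h2, h3⟩ := hC (fun Q => ⨍ y in Q.toSet, f y) f hf.aestronglyMeasurable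
    (ae_tendsto_average_at hf)
  refine ⟨M, h1, h2, h3.trans ?_⟩
  rw [ENNReal.coe_mul, mul_assoc, ENNReal.coe_ofNat, two_mul]
  gcongr
  · rw [← eLpNorm_ofReal_rpow hp0]
    gcongr
    exact le_self_add
  · refine (tsum_maxJump_average_le hp0 σ f).trans ?_
    gcongr
    exact le_add_self

end

/-! ### Whitney cubes and the extension operator -/

section

variable {d n : ℕ}

/-- The projection of a cube of `ℝ^{d+n}` to `ℝ^d`. -/
def baseCube (P : DyadicCube (Fin d ⊕ Fin n)) : DyadicCube (Fin d) where
  level := P.level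
  corner := fun i => P.corner (Sum.inl i)

theorem baseCube_at (k : ℤ) (y : EuclideanSpace ℝ (Fin d ⊕ Fin n)) :
    baseCube (DyadicCube.at_ k y) = DyadicCube.at_ k (basePart y) := rfl

theorem basePart_mem_baseCube {P : DyadicCube (Fin d ⊕ Fin n)}
    {y : EuclideanSpace ℝ (Fin d ⊕ Fin n)} (h : y ∈ P.toSet) : basePart y ∈ (baseCube P).toSet :=
  fun i => h (Sum.inl i)

theorem join_mem_of_mem {P : DyadicCube (Fin d ⊕ Fin n)}
    {y : EuclideanSpace ℝ (Fin d ⊕ Fin n)} (h : y ∈ P.toSet) {w : EuclideanSpace ℝ (Fin d)}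
    (hw : w ∈ (baseCube P).toSet) : join w (fiberPart y) ∈ P.toSet := by
  rintro (i | j)
  · exact hw i
  · exact h (Sum.inr j)

/-- `P` is one of the Whitney cubes of edge length at most `1` used by the extension operator. -/
def IsWhitneyCube (P : DyadicCube (Fin d ⊕ Fin n)) : Prop :=
  0 ≤ P.level ∧ P ∈ whitneyCubes n (baseCube P)

theorem eq_baseCube {Q : DyadicCube (Fin d)} {P : DyadicCube (Fin d ⊕ Fin n)}
    (h : P ∈ whitneyCubes n Q) : Q = baseCube P := by
  obtain ⟨y, hy⟩ := P.toSet_nonempty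
  have h1 : basePart y ∈ Q.toSet := (h.2 hy).1.1
  rw [← DyadicCube.eq_at_of_mem h1, ← h.1, ← baseCube_at, DyadicCube.eq_at_of_mem hy]

theorem IsWhitneyCube.edge_le {P : DyadicCube (Fin d ⊕ Fin n)} (h : IsWhitneyCube P) :
    P.edge ≤ 1 :=
  zpow_le_one_of_nonpos₀ (by norm_num) (by have := h.1; omega)

theorem IsWhitneyCube.norm_fiberPart_le {P : DyadicCube (Fin d ⊕ Fin n)} (h : IsWhitneyCube P)
    {y : EuclideanSpace ℝ (Fin d ⊕ Fin n)} (hy : y ∈ P.toSet) :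
    ‖fiberPart y‖ ≤ 2 * n * P.edge := by
  have h1 := (h.2.2 hy).1.2
  have he : (baseCube P).edge = P.edge := rfl
  rw [he] at h1
  have := P.edge_pos
  have h2 := DyadicCube.dist_le_of_abs_le (x := fiberPart y) (y := 0) (a := 2 * P.edge)
    (by positivity) fun j => by
      rw [PiLp.zero_apply, sub_zero, abs_le]; exact ⟨(h1 j).1, (h1 j).2⟩
  rw [dist_zero_right, Fintype.card_fin] at h2
  linarith

theorem IsWhitneyCube.le_norm_fiberPart {P : DyadicCube (Fin d ⊕ Fin n)} (h : IsWhitneyCube P)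
    {y : EuclideanSpace ℝ (Fin d ⊕ Fin n)} (hy : y ∈ P.toSet) : P.edge ≤ ‖fiberPart y‖ := by
  have h1 := (h.2.2 hy).2
  have he : (baseCube P).edge = P.edge := rfl
  by_contra! hlt
  refine h1 ⟨basePart_mem_baseCube hy, fun j => ?_⟩
  have h2 : |y (Sum.inr j)| ≤ ‖fiberPart y‖ := by
    rw [← Real.norm_eq_abs]; exact PiLp.norm_apply_le (fiberPart y) j
  rw [he]
  exact abs_lt.1 (h2.trans_lt hlt)

/-- The Whitney cubes cover a punctured neighbourhood of the subspace. -/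
theorem exists_isWhitneyCube_mem {y : EuclideanSpace ℝ (Fin d ⊕ Fin n)} (h0 : fiberPart y ≠ 0)
    (h2 : ‖fiberPart y‖ < 2) : ∃ P, IsWhitneyCube P ∧ y ∈ P.toSet := by
  classical
  set G : ℕ → Prop := fun k =>
    ∀ j, -(2 * (2 : ℝ) ^ (-(k : ℤ))) < y (Sum.inr j) ∧ y (Sum.inr j) ≤ 2 * 2 ^ (-(k : ℤ)) with hG
  have hcoord : ∀ j, |y (Sum.inr j)| ≤ ‖fiberPart y‖ := fun j => by
    rw [← Real.norm_eq_abs]; exact PiLp.norm_apply_le (fiberPart y) j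
  have hG0 : G 0 := fun j => by
    have := abs_lt.1 ((hcoord j).trans_lt h2)
    simp only [Nat.cast_zero, neg_zero, zpow_zero, mul_one]
    exact ⟨this.1, this.2.le⟩
  have hex : ∃ k, ¬ G k := by
    obtain ⟨j, hj⟩ : ∃ j, y (Sum.inr j) ≠ 0 := by
      by_contra! h
      exact h0 (by ext j; exact h j)
    have hpos : 0 < |y (Sum.inr j)| := abs_pos.2 hj
    obtain ⟨k, hk⟩ := exists_pow_lt_of_lt_one (half_pos hpos) (by norm_num : (2 : ℝ)⁻¹ < 1)
    refine ⟨k, fun hGk => ?_⟩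
    have h3 := abs_le.2 ⟨(hGk j).1.le, (hGk j).2⟩
    rw [zpow_neg, zpow_natCast, ← inv_pow] at h3
    linarith
  -- `k` is the last generation for which all normal coordinates of `y` have size at most
  -- `2 * 2 ^ (-k)`
  have hk0 : Nat.find hex ≠ 0 := fun h => (h ▸ Nat.find_spec hex) hG0
  obtain ⟨k, hk⟩ := Nat.exists_eq_succ_of_ne_zero hk0
  have hGk : G k := not_not.1 (Nat.find_min hex (m := k) (by omega))
  have hGk1 : ¬ G (k + 1) := by
    have h := Nat.find_spec hex
    rwa [hk] at h
  have h2k : (0 : ℝ) < 2 ^ (k : ℤ) := by positivity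
  have he : (2 : ℝ) ^ (-(k : ℤ)) = (2 ^ (k : ℤ))⁻¹ := zpow_neg _ _
  have he1 : 2 * (2 : ℝ) ^ (-((k + 1 : ℕ) : ℤ)) = 2 ^ (-(k : ℤ)) := by
    push_cast
    rw [neg_add, zpow_add₀ (by norm_num)]; norm_num; ring
  have hmul : (2 : ℝ) ^ (k : ℤ) * 2 ^ (-(k : ℤ)) = 1 := by
    rw [he]; exact mul_inv_cancel₀ h2k.ne'
  have hep : (0 : ℝ) < 2 ^ (-(k : ℤ)) := by positivity
  refine ⟨DyadicCube.at_ k y, ⟨by simp [DyadicCube.at_], rfl, fun x hx => ⟨⟨?_, fun j => ?_⟩, ?_⟩⟩,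
    DyadicCube.mem_at _ _⟩
  · exact basePart_mem_baseCube hx
  · have hxj := hx (Sum.inr j)
    have heq : (baseCube (DyadicCube.at_ (k : ℤ) y)).edge = 2 ^ (-(k : ℤ)) := rfl
    rw [DyadicCube.edge_at] at hxj
    rw [heq]
    have hc1 : (-2 : ℝ) ≤ (DyadicCube.at_ (k : ℤ) y).corner (Sum.inr j) := by
      have : -2 < ⌈(2 : ℝ) ^ (k : ℤ) * y (Sum.inr j)⌉ := by
        rw [Int.lt_ceil]; push_cast
        have := mul_lt_mul_of_pos_left (hGk j).1 h2k
        linarith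
      have h' : -2 ≤ (DyadicCube.at_ (k : ℤ) y).corner (Sum.inr j) := by
        simp only [DyadicCube.at_]; omega
      exact_mod_cast h'
    have hc2 : ((DyadicCube.at_ (k : ℤ) y).corner (Sum.inr j) : ℝ) ≤ 1 := by
      have : ⌈(2 : ℝ) ^ (k : ℤ) * y (Sum.inr j)⌉ ≤ 2 := by
        rw [Int.ceil_le]; push_cast
        have := mul_le_mul_of_nonneg_left (hGk j).2 h2k.le
        linarith
      have h' : (DyadicCube.at_ (k : ℤ) y).corner (Sum.inr j) ≤ 1 := by
        simp only [DyadicCube.at_]; omega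
      exact_mod_cast h'
    constructor
    · nlinarith [hxj.1]
    · nlinarith [hxj.2]
  · rintro ⟨-, hin⟩
    refine hGk1 fun j => ?_
    have hxj := hx (Sum.inr j)
    have hinj := hin j
    have heq : (baseCube (DyadicCube.at_ (k : ℤ) y)).edge = 2 ^ (-(k : ℤ)) := rfl
    rw [heq] at hinj
    rw [DyadicCube.edge_at] at hxj
    rw [he1]
    have hc1 : (-2 : ℝ) < (DyadicCube.at_ (k : ℤ) y).corner (Sum.inr j) := by
      nlinarith [hxj.2, hinj.1]
    have hc2 : ((DyadicCube.at_ (k : ℤ) y).corner (Sum.inr j) : ℝ) < 1 := by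
      nlinarith [hxj.1, hinj.2]
    have hc1' : -2 < (DyadicCube.at_ (k : ℤ) y).corner (Sum.inr j) := by exact_mod_cast hc1
    have hc2' : (DyadicCube.at_ (k : ℤ) y).corner (Sum.inr j) < 1 := by exact_mod_cast hc2
    have hyj := DyadicCube.mem_at (k : ℤ) y (Sum.inr j)
    rw [DyadicCube.edge_at] at hyj
    have hc3 : (-1 : ℝ) ≤ (DyadicCube.at_ (k : ℤ) y).corner (Sum.inr j) := by
      exact_mod_cast (by omega : -1 ≤ (DyadicCube.at_ (k : ℤ) y).corner (Sum.inr j))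
    have hc4 : ((DyadicCube.at_ (k : ℤ) y).corner (Sum.inr j) : ℝ) ≤ 0 := by
      exact_mod_cast (by omega : (DyadicCube.at_ (k : ℤ) y).corner (Sum.inr j) ≤ 0)
    constructor
    · nlinarith [hyj.1]
    · nlinarith [hyj.2]

open Classical in
/-- The double sum over the base cubes and the Whitney cubes above them is a sum over all Whitney
cubes. -/
theorem tsum_tsum_whitneyCubes {E : Type*} [NormedAddCommGroup E] [CompleteSpace E]
    (F : DyadicCube (Fin d ⊕ Fin n) → E) (hF : {P | IsWhitneyCube P ∧ F P ≠ 0}.Finite) :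
    ∑' Q : {Q : DyadicCube (Fin d) // 0 ≤ Q.level}, ∑' P : whitneyCubes n Q.1, F P.1 =
      ∑' P, if IsWhitneyCube P then F P else 0 := by
  let e : (Σ Q : {Q : DyadicCube (Fin d) // 0 ≤ Q.level}, whitneyCubes n Q.1) ≃
      {P : DyadicCube (Fin d ⊕ Fin n) // IsWhitneyCube P} :=
    { toFun := fun q => ⟨q.2.1, by
        have h := eq_baseCube q.2.2
        exact ⟨by rw [q.2.2.1]; exact q.1.2, h ▸ q.2.2⟩⟩
      invFun := fun P => ⟨⟨baseCube P.1, P.2.1⟩, ⟨P.1, P.2.2⟩⟩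
      left_inv := by
        rintro ⟨⟨Q, hQ⟩, ⟨P, hP⟩⟩
        obtain rfl := eq_baseCube hP
        rfl
      right_inv := fun P => rfl }
  have hs : Summable fun P : {P : DyadicCube (Fin d ⊕ Fin n) // IsWhitneyCube P} => F P.1 := by
    refine summable_of_hasFiniteSupport ?_
    refine Set.Finite.of_finite_image (f := Subtype.val) (hF.subset ?_)
      Subtype.val_injective.injOn
    rintro _ ⟨P, hP, rfl⟩
    exact ⟨P.2, hP⟩
  set G : {P : DyadicCube (Fin d ⊕ Fin n) // IsWhitneyCube P} → E := fun P => F P.1 with hG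
  have hs' : Summable (G ∘ e) := e.summable_iff.2 hs
  calc _ = ∑' q, (G ∘ e) q := hs'.tsum_sigma.symm
    _ = ∑' P, G P := e.tsum_eq G
    _ = ∑' P, {P | IsWhitneyCube P}.indicator F P := tsum_subtype {P | IsWhitneyCube P} F
    _ = _ := tsum_congr fun P => by simp [indicator]

variable {ψ : DyadicCube (Fin d ⊕ Fin n) → EuclideanSpace ℝ (Fin d ⊕ Fin n) → ℝ}

theorem IsWhitneyBumpFamily.exists_mem_dist_lt (hψ : IsWhitneyBumpFamily ψ)
    {P : DyadicCube (Fin d ⊕ Fin n)} (hP : IsWhitneyCube P)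
    {z : EuclideanSpace ℝ (Fin d ⊕ Fin n)} (hz : ψ P z ≠ 0) :
    ∃ x ∈ P.toSet, dist z x < P.edge / 4 :=
  Metric.mem_thickening_iff.1
    (hψ.support (baseCube P) hP.1 P hP.2 (subset_tsupport _ hz))

theorem IsWhitneyBumpFamily.le_norm_fiberPart (hψ : IsWhitneyBumpFamily ψ)
    {P : DyadicCube (Fin d ⊕ Fin n)} (hP : IsWhitneyCube P)
    {z : EuclideanSpace ℝ (Fin d ⊕ Fin n)} (hz : ψ P z ≠ 0) :
    3 / 4 * P.edge ≤ ‖fiberPart z‖ := by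
  obtain ⟨x, hx, hzx⟩ := hψ.exists_mem_dist_lt hP hz
  have h1 := hP.le_norm_fiberPart hx
  have h2 := (dist_fiberPart_le z x).trans hzx.le
  have h3 := norm_sub_norm_le (fiberPart x) (fiberPart z)
  rw [dist_comm, dist_eq_norm] at h2
  linarith

theorem IsWhitneyBumpFamily.norm_fiberPart_le (hψ : IsWhitneyBumpFamily ψ) (hn : 1 ≤ n)
    {P : DyadicCube (Fin d ⊕ Fin n)} (hP : IsWhitneyCube P)
    {z : EuclideanSpace ℝ (Fin d ⊕ Fin n)} (hz : ψ P z ≠ 0) :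
    ‖fiberPart z‖ ≤ 9 / 4 * n * P.edge := by
  obtain ⟨x, hx, hzx⟩ := hψ.exists_mem_dist_lt hP hz
  have h1 := hP.norm_fiberPart_le hx
  have h2 := (dist_fiberPart_le z x).trans hzx.le
  have h3 := norm_sub_norm_le (fiberPart z) (fiberPart x)
  have h4 : (1 : ℝ) ≤ n := by exact_mod_cast hn
  have := P.edge_pos
  rw [dist_eq_norm] at h2
  nlinarith

/-- Near a point at distance about `2 ^ (-j)` from the subspace only boundedly many Whitney cubes
matter, and all of them have size and distance comparable to `2 ^ (-j)`. -/
theorem exists_active_finset (hψ : IsWhitneyBumpFamily ψ) (hn : 1 ≤ n) :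
    ∃ N κ A : ℕ, ∀ (j : ℤ) (y : EuclideanSpace ℝ (Fin d ⊕ Fin n)),
      (2 : ℝ) ^ (-j) ≤ ‖fiberPart y‖ → ‖fiberPart y‖ < 2 ^ (1 - j) →
      ∃ S : Finset (DyadicCube (Fin d ⊕ Fin n)), S.card ≤ N ∧
        (∀ P ∈ S, IsWhitneyCube P ∧ |P.level - j| ≤ κ ∧
          P.toSet ⊆ Metric.closedBall y (A * 2 ^ (-j))) ∧
        ∀ z, dist z y ≤ ‖fiberPart y‖ / 4 → ∀ P, IsWhitneyCube P → ψ P z ≠ 0 → P ∈ S := by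
  obtain ⟨N, hN⟩ := DyadicCube.exists_encard_le (ι := Fin d ⊕ Fin n) (3 * n + 2)
    (4 * (d + n) + 2)
  refine ⟨N, 3 * n + 2, 4 * (d + n) + 2, fun j y h1 h2 => ?_⟩
  have hfin : {P : DyadicCube (Fin d ⊕ Fin n) | IsWhitneyCube P ∧
      |P.level - j| ≤ (3 * n + 2 : ℕ) ∧
      P.toSet ⊆ Metric.closedBall y ((4 * (d + n) + 2 : ℕ) * 2 ^ (-j))}.Finite := by
    refine (Set.finite_of_encard_le_coe (hN j y)).subset ?_
    rintro P ⟨-, hP⟩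
    exact hP
  refine ⟨hfin.toFinset, ?_, fun P hP => by simpa using hP, fun z hz P hP hPz => ?_⟩
  · have : (hfin.toFinset.card : ℕ∞) ≤ N := by
      rw [← encard_coe_eq_coe_finsetCard, hfin.coe_toFinset]
      refine (encard_le_encard ?_).trans (hN j y)
      rintro P ⟨-, hP⟩
      exact hP
    exact_mod_cast this
  · rw [hfin.mem_toFinset]
    have hj : (0 : ℝ) < 2 ^ (-j) := by positivity
    have e1 : (2 : ℝ) ^ (1 - j) = 2 * 2 ^ (-j) := by
      rw [sub_eq_add_neg, zpow_add₀ (by norm_num), zpow_one]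
    rw [e1] at h2
    have h3 := hψ.le_norm_fiberPart hP hPz
    have h4 := hψ.norm_fiberPart_le hn hP hPz
    have h5 := (dist_fiberPart_le z y).trans hz
    rw [dist_eq_norm] at h5
    have h6 := norm_sub_norm_le (fiberPart z) (fiberPart y)
    have h7 := norm_sub_norm_le (fiberPart y) (fiberPart z)
    rw [norm_sub_rev] at h7
    have hup : P.edge < 2 ^ (-j + 2) := by
      have e4 : (2 : ℝ) ^ (2 : ℤ) = 4 := by norm_num
      rw [zpow_add₀ (by norm_num), e4]; linarith
    -- the factor `3 * n` between distance and size costs at most `3 * n` generations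
    have hlow : (2 : ℝ) ^ (-j - 3 * n) ≤ P.edge := by
      have hn2 : (3 * n : ℝ) ≤ 2 ^ (3 * n : ℤ) := by
        have := (Nat.lt_two_pow_self (n := 3 * n)).le
        exact_mod_cast this
      have hn0 : (0 : ℝ) < 3 * n := by positivity
      have hb : (2 : ℝ) ^ (-j) ≤ 3 * n * P.edge := by nlinarith
      rw [zpow_sub₀ (by norm_num), div_le_iff₀ (by positivity)]
      nlinarith [P.edge_pos]
    refine ⟨hP, ?_, ?_⟩
    · have l1 : -P.level < -j + 2 := (zpow_lt_zpow_iff_right₀ (by norm_num)).1 hup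
      have l2 : -j - 3 * n ≤ -P.level := (zpow_le_zpow_iff_right₀ (by norm_num)).1 hlow
      rw [abs_le]; push_cast; constructor <;> omega
    · intro x hx
      obtain ⟨x₀, hx₀, hzx⟩ := hψ.exists_mem_dist_lt hP hPz
      have h8 := DyadicCube.dist_le_of_mem (subset_closure hx) (subset_closure hx₀)
      have e4 : (2 : ℝ) ^ (2 : ℤ) = 4 := by norm_num
      rw [zpow_add₀ (by norm_num), e4] at hup
      rw [Fintype.card_sum, Fintype.card_fin, Fintype.card_fin] at h8
      rw [Metric.mem_closedBall]
      have hN0 : (0 : ℝ) ≤ (d : ℝ) + n := by positivity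
      push_cast at h8 ⊢
      calc dist x y ≤ dist x x₀ + dist x₀ z + dist z y := dist_triangle4 _ _ _ _
        _ ≤ ((d : ℝ) + n) * P.edge + P.edge / 4 + ‖fiberPart y‖ / 4 := by
          rw [dist_comm x₀ z]; gcongr
        _ ≤ _ := by nlinarith

open Classical in
theorem whitneyExt_eq_tsum (hψ : IsWhitneyBumpFamily ψ) (hn : 1 ≤ n)
    (f : EuclideanSpace ℝ (Fin d) → ℂ)
    (z : EuclideanSpace ℝ (Fin d ⊕ Fin n)) :
    {P | IsWhitneyCube P ∧ ψ P z ≠ 0}.Finite ∧ whitneyExt ψ f z =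
      ∑' P, if IsWhitneyCube P then (⨍ y in (baseCube P).toSet, f y) * (ψ P z : ℂ) else 0 := by
  have hfin : {P | IsWhitneyCube P ∧ ψ P z ≠ 0}.Finite := by
    by_cases h0 : fiberPart z = 0
    · refine Set.Finite.subset (finite_empty) fun P hP => ?_
      have h := hψ.le_norm_fiberPart hP.1 hP.2
      rw [h0, norm_zero] at h
      linarith [P.edge_pos]
    · obtain ⟨N, κ, A, h⟩ := exists_active_finset hψ hn
      obtain ⟨j, hj1, hj2⟩ := exists_mem_Ico_zpow (norm_pos_iff.2 h0) (one_lt_two (α := ℝ))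
      obtain ⟨S, -, -, hS⟩ := h (-j) z (by simpa using hj1)
        (by rw [sub_neg_eq_add, add_comm]; exact hj2)
      exact S.finite_toSet.subset fun P hP => hS z (by rw [dist_self]; positivity) P hP.1 hP.2
  refine ⟨hfin, ?_⟩
  have h := tsum_tsum_whitneyCubes (d := d) (n := n)
    (fun P => (⨍ y in (baseCube P).toSet, f y) * (ψ P z : ℂ)) (hfin.subset fun P hP =>
      ⟨hP.1, fun h => hP.2 (by simp [h])⟩)
  rw [whitneyExt, ← h]
  refine tsum_congr fun Q => tsum_congr fun P => ?_
  rw [← eq_baseCube P.2]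

theorem whitneyExt_eq_sum (hψ : IsWhitneyBumpFamily ψ) (hn : 1 ≤ n)
    (f : EuclideanSpace ℝ (Fin d) → ℂ) (z : EuclideanSpace ℝ (Fin d ⊕ Fin n))
    {S : Finset (DyadicCube (Fin d ⊕ Fin n))} (hS : ∀ P ∈ S, IsWhitneyCube P)
    (hS' : ∀ P, IsWhitneyCube P → ψ P z ≠ 0 → P ∈ S) :
    whitneyExt ψ f z = ∑ P ∈ S, (⨍ y in (baseCube P).toSet, f y) * (ψ P z : ℂ) := by
  classical
  rw [(whitneyExt_eq_tsum hψ hn f z).2, tsum_eq_sum (s := S)]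
  · exact Finset.sum_congr rfl fun P hP => if_pos (hS P hP)
  · intro P hP
    split_ifs with h
    · have : ψ P z = 0 := not_not.1 fun h' => hP (hS' P h h')
      simp [this]
    · rfl

theorem sum_bump_eq_one (hψ : IsWhitneyBumpFamily ψ)
    {z : EuclideanSpace ℝ (Fin d ⊕ Fin n)} (h0 : fiberPart z ≠ 0) (h2 : ‖fiberPart z‖ < 2)
    {S : Finset (DyadicCube (Fin d ⊕ Fin n))} (hS : ∀ P ∈ S, IsWhitneyCube P)
    (hS' : ∀ P, IsWhitneyCube P → ψ P z ≠ 0 → P ∈ S) : ∑ P ∈ S, ψ P z = 1 := by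
  classical
  obtain ⟨P₀, hP₀, hz⟩ := exists_isWhitneyCube_mem h0 h2
  rw [← hψ.sum_eq_one _ hP₀.1 P₀ hP₀.2 z hz, tsum_tsum_whitneyCubes (fun P => ψ P z)
    (S.finite_toSet.subset fun P hP => hS' P hP.1 hP.2), tsum_eq_sum (s := S)]
  · exact Finset.sum_congr rfl fun P hP => (if_pos (hS P hP)).symm
  · intro P hP
    split_ifs with h
    · exact not_not.1 fun h' => hP (hS' P h h')
    · rfl

theorem whitneyExt_eq_zero (hψ : IsWhitneyBumpFamily ψ) (hn : 1 ≤ n)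
    (f : EuclideanSpace ℝ (Fin d) → ℂ) {z : EuclideanSpace ℝ (Fin d ⊕ Fin n)}
    (hz : 3 * (n : ℝ) < ‖fiberPart z‖) : whitneyExt ψ f z = 0 := by
  rw [whitneyExt_eq_sum hψ hn f z (S := ∅) (by simp), Finset.sum_empty]
  intro P hP hPz
  exfalso
  have h1 := hψ.norm_fiberPart_le hn hP hPz
  have h2 := hP.edge_le
  have h3 : (1 : ℝ) ≤ n := by exact_mod_cast hn
  nlinarith [P.edge_pos]

theorem measurable_whitneyExt (hψ : IsWhitneyBumpFamily ψ) (hn : 1 ≤ n)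
    (f : EuclideanSpace ℝ (Fin d) → ℂ) : Measurable (whitneyExt ψ f) := by
  classical
  refine measurable_of_tendsto_metrizable' (u := (atTop : Filter (Finset
    (DyadicCube (Fin d ⊕ Fin n))))) (f := fun S z => ∑ P ∈ S, if IsWhitneyCube P then
      (⨍ y in (baseCube P).toSet, f y) * (ψ P z : ℂ) else 0) (fun S => ?_) ?_
  · refine Finset.measurable_sum _ fun P _ => ?_
    by_cases hP : IsWhitneyCube P
    · simp only [hP, if_true]
      have : Continuous (ψ P) := (hψ.smooth (baseCube P) hP.1 P hP.2).continuous
      exact (Complex.continuous_ofReal.comp this).measurable.const_mul _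
    · simp only [hP, if_false]
      exact measurable_const
  · rw [tendsto_pi_nhds]
    intro z
    obtain ⟨h1, h2⟩ := whitneyExt_eq_tsum hψ hn f z
    rw [h2]
    have hs : Summable fun P => if IsWhitneyCube P then
        (⨍ y in (baseCube P).toSet, f y) * (ψ P z : ℂ) else 0 := by
      refine summable_of_hasFiniteSupport (h1.subset fun P hP => ?_)
      simp only [Function.mem_support, ne_eq, ite_eq_right_iff, mul_eq_zero,
        Complex.ofReal_eq_zero, Classical.not_imp, not_or] at hP
      exact ⟨hP.1, hP.2.2⟩
    have := hs.hasSum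
    rwa [HasSum, SummationFilter.unconditional_filter] at this

/-- The local estimates for the extension: near a point at distance about `2 ^ (-j)` from the
subspace, both its deviation from a constant and its Lipschitz constant are controlled by a mean
over a ball of radius about `2 ^ (-j)`. The constant must be `0` far from the subspace, where the
bump functions do not add up to `1`. -/
theorem exists_whitneyExt_local_le (hψ : IsWhitneyBumpFamily ψ) (hn : 1 ≤ n) :
    ∃ (C : ℝ≥0) (A : ℕ), 1 ≤ A ∧ ∀ (f : EuclideanSpace ℝ (Fin d) → ℂ), LocallyIntegrable f →
      ∀ (j : ℤ) (y : EuclideanSpace ℝ (Fin d ⊕ Fin n)) (c : ℂ),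
      (2 : ℝ) ^ (-j) ≤ ‖fiberPart y‖ → ‖fiberPart y‖ < 2 ^ (1 - j) →
      (c = 0 ∨ ‖fiberPart y‖ ≤ 1) →
      ‖whitneyExt ψ f y - c‖ₑ ≤ C * ((2 : ℝ≥0∞) ^ ((j : ℝ) * d) *
        ∫⁻ w in Metric.ball (basePart y) (A * 2 ^ (-j)), ‖f w - c‖ₑ) ∧
      ∀ z, dist z y ≤ ‖fiberPart y‖ / 4 → ‖whitneyExt ψ f z - whitneyExt ψ f y‖ₑ ≤
        C * ENNReal.ofReal (dist z y * 2 ^ j) * ((2 : ℝ≥0∞) ^ ((j : ℝ) * d) *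
          ∫⁻ w in Metric.ball (basePart y) (A * 2 ^ (-j)), ‖f w - c‖ₑ) := by
  obtain ⟨N, κ, A, hact⟩ := exists_active_finset hψ hn
  obtain ⟨L, hL⟩ := hψ.lipschitz
  set K₁ : ℝ≥0∞ := N * 2 ^ ((κ : ℝ) * d) with hK₁
  set K₂ : ℝ≥0∞ := K₁ * ENNReal.ofReal (|L| * 2 ^ κ) with hK₂
  have hK₁t : K₁ ≠ ∞ := ENNReal.mul_ne_top (by simp) (two_rpow_ne_top _)
  have hK₂t : K₂ ≠ ∞ := ENNReal.mul_ne_top hK₁t ENNReal.ofReal_ne_top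
  refine ⟨(K₁ + K₂).toNNReal, A + 1, by omega, fun f hf j y c h1 h2 hc => ?_⟩
  rw [ENNReal.coe_toNNReal (ENNReal.add_ne_top.2 ⟨hK₁t, hK₂t⟩)]
  obtain ⟨S, hcard, hS, hS'⟩ := hact j y h1 h2
  set I : ℝ≥0∞ := ∫⁻ w in Metric.ball (basePart y) ((A + 1 : ℕ) * 2 ^ (-j)), ‖f w - c‖ₑ with hI
  have hj : (0 : ℝ) < 2 ^ (-j) := by positivity
  have hW : ∀ P ∈ S, IsWhitneyCube P := fun P hP => (hS P hP).1
  have havg : ∀ P ∈ S, ‖(⨍ w in (baseCube P).toSet, f w) - c‖ₑ ≤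
      2 ^ ((κ : ℝ) * d) * (2 ^ ((j : ℝ) * d) * I) := by
    intro P hP
    obtain ⟨-, hPl, hPs⟩ := hS P hP
    obtain ⟨x₀, hx₀⟩ := P.toSet_nonempty
    have hsub : (baseCube P).toSet ⊆ Metric.ball (basePart y) ((A + 1 : ℕ) * 2 ^ (-j)) := by
      intro w hw
      have h3 := Metric.mem_closedBall.1 (hPs (join_mem_of_mem hx₀ hw))
      have h4 := dist_basePart_le (join w (fiberPart x₀)) y
      rw [basePart_join] at h4
      rw [Metric.mem_ball]
      refine (h4.trans h3).trans_lt ?_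
      push_cast
      linarith
    have hv := DyadicCube.volume_toSet (baseCube P)
    refine (enorm_setAverage_sub_le (by rw [hv]; exact two_rpow_ne_zero _)
      (by rw [hv]; exact two_rpow_ne_top _) ((hf.integrableOn_isCompact (isCompact_closedBall
        (basePart y) ((A + 1 : ℕ) * 2 ^ (-j)))).mono_set
        (hsub.trans Metric.ball_subset_closedBall)) c).trans ?_
    rw [← mul_assoc, ← two_rpow_add]
    gcongr
    · rw [hv, ← ENNReal.rpow_neg, neg_neg, Fintype.card_fin, ← add_mul]
      refine two_rpow_mono (mul_le_mul_of_nonneg_right ?_ (by positivity))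
      have : (baseCube P).level ≤ κ + j := by
        have h := (abs_le.1 hPl).2
        have h' : (baseCube P).level = P.level := rfl
        omega
      exact_mod_cast this
    · exact lintegral_mono_set hsub
  have hone : ∀ z, dist z y ≤ ‖fiberPart y‖ / 4 → c = 0 ∨ ∑ P ∈ S, ψ P z = 1 := by
    intro z hz
    refine hc.imp id fun hc => ?_
    have h5 := (dist_fiberPart_le z y).trans hz
    rw [dist_eq_norm] at h5
    have h6 := norm_sub_norm_le (fiberPart z) (fiberPart y)
    have h7 := norm_sub_norm_le (fiberPart y) (fiberPart z)
    rw [norm_sub_rev] at h7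
    refine sum_bump_eq_one hψ (norm_pos_iff.1 ?_) ?_ hW (hS' z hz)
    · linarith
    · linarith
  -- subtracting `c` from all averages is harmless: `c = 0`, or the bump functions add up to `1`
  have hrep : ∀ z, dist z y ≤ ‖fiberPart y‖ / 4 → whitneyExt ψ f z - c =
      ∑ P ∈ S, ((⨍ w in (baseCube P).toSet, f w) - c) * (ψ P z : ℂ) := by
    intro z hz
    rw [whitneyExt_eq_sum hψ hn f z hW (hS' z hz)]
    simp_rw [sub_mul]
    rw [Finset.sum_sub_distrib, ← Finset.mul_sum]
    rcases hone z hz with h | h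
    · rw [h, zero_mul]
    · rw [← Complex.ofReal_sum, h, Complex.ofReal_one, mul_one]
  have hyy : dist y y ≤ ‖fiberPart y‖ / 4 := by rw [dist_self]; positivity
  have hsum : ∀ (T : ℝ≥0∞) (φ : DyadicCube (Fin d ⊕ Fin n) → ℝ),
      (∀ P ∈ S, ‖φ P‖ₑ ≤ T) →
      ‖∑ P ∈ S, ((⨍ w in (baseCube P).toSet, f w) - c) * (φ P : ℂ)‖ₑ ≤
        K₁ * T * (2 ^ ((j : ℝ) * d) * I) := by
    intro T φ hφ
    calc _ ≤ ∑ P ∈ S, ‖((⨍ w in (baseCube P).toSet, f w) - c) * (φ P : ℂ)‖ₑ := enorm_sum_le _ _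
      _ ≤ ∑ P ∈ S, 2 ^ ((κ : ℝ) * d) * (2 ^ ((j : ℝ) * d) * I) * T := by
          refine Finset.sum_le_sum fun P hP => ?_
          rw [enorm_mul]
          have : ‖(φ P : ℂ)‖ₑ = ‖φ P‖ₑ := by simp [enorm_eq_nnnorm]
          rw [this]
          exact mul_le_mul' (havg P hP) (hφ P hP)
      _ = S.card * (2 ^ ((κ : ℝ) * d) * (2 ^ ((j : ℝ) * d) * I) * T) := by
          rw [Finset.sum_const, nsmul_eq_mul]
      _ ≤ N * (2 ^ ((κ : ℝ) * d) * (2 ^ ((j : ℝ) * d) * I) * T) := by gcongr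
      _ = _ := by rw [hK₁]; ring
  constructor
  · rw [hrep y hyy]
    refine (hsum 1 (fun P => ψ P y) fun P hP => ?_).trans ?_
    · have h := hψ.range (baseCube P) (hW P hP).1 P (hW P hP).2 y
      rw [Real.enorm_eq_ofReal h.1, ← ENNReal.ofReal_one]
      exact ENNReal.ofReal_le_ofReal h.2
    · rw [mul_one]
      gcongr
      exact le_self_add
  · intro z hz
    have h3 : whitneyExt ψ f z - whitneyExt ψ f y =
        ∑ P ∈ S, ((⨍ w in (baseCube P).toSet, f w) - c) * ((ψ P z - ψ P y : ℝ) : ℂ) := by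
      have h4 := hrep z hz
      have h5 := hrep y hyy
      rw [← sub_sub_sub_cancel_right _ _ c, h4, h5, ← Finset.sum_sub_distrib]
      refine Finset.sum_congr rfl fun P _ => ?_
      push_cast; ring
    rw [h3]
    refine (hsum (ENNReal.ofReal (|L| * 2 ^ κ) * ENNReal.ofReal (dist z y * 2 ^ j)) _
      fun P hP => ?_).trans ?_
    · rw [Real.enorm_eq_ofReal_abs, ← ENNReal.ofReal_mul (by positivity)]
      refine ENNReal.ofReal_le_ofReal ?_
      refine (hL (baseCube P) (hW P hP).1 P (hW P hP).2 z y).trans ?_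
      have hle : P.edge⁻¹ ≤ 2 ^ κ * 2 ^ j := by
        rw [DyadicCube.edge, zpow_neg, inv_inv, ← zpow_natCast, ← zpow_add₀ (by norm_num)]
        refine zpow_le_zpow_right₀ (by norm_num) ?_
        have h := (abs_le.1 (hS P hP).2.1).2
        omega
      calc L / P.edge * dist z y ≤ |L| * P.edge⁻¹ * dist z y := by
            rw [div_eq_mul_inv]
            have := P.edge_pos
            gcongr
            exact le_abs_self L
        _ ≤ |L| * (2 ^ κ * 2 ^ j) * dist z y := by gcongr
        _ = _ := by ring
    · rw [← mul_assoc K₁, ← hK₂]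
      gcongr
      exact le_add_self

end

/-! ### Integral estimates for the extension -/

section

variable {d n : ℕ} {ψ : DyadicCube (Fin d ⊕ Fin n) → EuclideanSpace ℝ (Fin d ⊕ Fin n) → ℝ}

theorem exists_scale {t : ℝ} (ht : 0 < t) :
    ∃ j : ℤ, (2 : ℝ) ^ (-j) ≤ t ∧ t < 2 ^ (1 - j) := by
  obtain ⟨j, h1, h2⟩ := exists_mem_Ico_zpow ht (one_lt_two (α := ℝ))
  exact ⟨-j, by simpa using h1, by rwa [sub_neg_eq_add, add_comm]⟩

/-- Mean oscillation of the extension over balls centred on the subspace. -/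
theorem exists_setLIntegral_whitneyExt_le (hψ : IsWhitneyBumpFamily ψ) (hn : 1 ≤ n) {α R : ℝ}
    (hα : -(n : ℝ) < α) (hR : 1 ≤ R) :
    ∃ (C : ℝ≥0) (A : ℝ), 0 < A ∧ ∀ f : EuclideanSpace ℝ (Fin d) → ℂ, LocallyIntegrable f →
      ∀ (x : EuclideanSpace ℝ (Fin d)) (k : ℕ) (c : ℂ),
      (c = 0 ∨ R * 2 ^ (-(k : ℤ)) ≤ 1) →
      ∫⁻ y in Metric.ball (embed n x) (R * 2 ^ (-(k : ℤ))), ‖whitneyExt ψ f y - c‖ₑ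
        ∂weightMeasure d n α ≤ C * ((2 : ℝ≥0∞) ^ (-((k : ℝ) * (n + α))) *
          ∫⁻ w in Metric.ball x (A * 2 ^ (-(k : ℤ))), ‖f w - c‖ₑ) := by
  obtain ⟨C₀, A, hA, hloc⟩ := exists_whitneyExt_local_le hψ hn
  obtain ⟨C₁, hC₁⟩ := exists_setLIntegral_weight_le hn hR hα
  have hA0 : (0 : ℝ) < A := by exact_mod_cast hA
  set V : ℝ≥0∞ := volume (Metric.ball (0 : EuclideanSpace ℝ (Fin d)) A) with hV
  have hVt : V ≠ ∞ := measure_ball_lt_top.ne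
  set K : ℝ≥0∞ := C₀ * V * C₁ * ENNReal.ofReal (R ^ (n + α)) with hK
  have hKt : K ≠ ∞ := ENNReal.mul_ne_top (ENNReal.mul_ne_top (ENNReal.mul_ne_top (by simp) hVt)
    (by simp)) ENNReal.ofReal_ne_top
  refine ⟨K.toNNReal, (1 + A) * R, by positivity, fun f hf x k c hc => ?_⟩
  rw [ENNReal.coe_toNNReal hKt]
  set r : ℝ := R * 2 ^ (-(k : ℤ)) with hr
  have hr0 : 0 < r := by positivity
  have hrR : r ≤ R := mul_le_of_le_one_right (by linarith)
    (zpow_le_one_of_nonpos₀ (by norm_num) (by simp))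
  have hfm := hf.aestronglyMeasurable
  set f' := hfm.mk f with hf'
  set h : EuclideanSpace ℝ (Fin d) → ℝ≥0∞ := fun w => ‖f' w - c‖ₑ with hh
  have hhm : Measurable h := (hfm.stronglyMeasurable_mk.measurable.sub_const c).enorm
  have hfh : ∀ B : Set (EuclideanSpace ℝ (Fin d)), ∫⁻ w in B, ‖f w - c‖ₑ = ∫⁻ w in B, h w :=
    fun B => lintegral_congr_ae (ae_restrict_of_ae (hfm.ae_eq_mk.mono fun w hw => by
      simp only [hh, hf']; rw [← hw]))
  have hu := measurable_whitneyExt hψ hn f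
  have hm : MeasurableSet (Metric.ball (embed n x) r) := Metric.isOpen_ball.measurableSet
  have e : (1 + (A : ℝ)) * R * 2 ^ (-(k : ℤ)) = r + A * r := by rw [hr]; ring
  rw [e, hfh, ← lintegral_indicator hm, lintegral_weightMeasure _
    ((hu.sub_const c).enorm.indicator hm)]
  set I : ℝ≥0∞ := ∫⁻ w in Metric.ball x (r + A * r), h w with hI
  calc _ ≤ ∫⁻ v, (Metric.ball (0 : EuclideanSpace ℝ (Fin n)) r).indicator
        (fun v => ENNReal.ofReal (weight n α v)) v * (C₀ * V * I) := by
        refine lintegral_mono_ae ?_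
        filter_upwards [ae_ne_zero hn] with v hv0
        by_cases hv : v ∈ Metric.ball (0 : EuclideanSpace ℝ (Fin n)) r
        · simp only [indicator_of_mem hv]
          gcongr
          obtain ⟨j, hj1, hj2⟩ := exists_scale (norm_pos_iff.2 hv0)
          have hvr : ‖v‖ < r := mem_ball_zero_iff.1 hv
          calc _ ≤ ∫⁻ x', (Metric.ball x r).indicator (fun x' => C₀ * ((2 : ℝ≥0∞) ^ ((j : ℝ) * d) *
                ∫⁻ w in Metric.ball x' (A * 2 ^ (-j)), h w)) x' := by
                refine lintegral_mono fun x' => ?_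
                by_cases hx' : join x' v ∈ Metric.ball (embed n x) r
                · have : x' ∈ Metric.ball x r :=
                    lt_of_le_of_lt (dist_basePart_le (join x' v) (embed n x)) hx'
                  rw [indicator_of_mem hx', indicator_of_mem this, ← hfh]
                  refine (hloc f hf j (join x' v) c hj1 hj2 (hc.imp id fun h => ?_)).1
                  rw [fiberPart_join]; linarith
                · rw [indicator_of_notMem hx']; exact zero_le
            _ = C₀ * ((2 : ℝ≥0∞) ^ ((j : ℝ) * d) * ∫⁻ x' in Metric.ball x r,
                ∫⁻ w in Metric.ball x' (A * 2 ^ (-j)), h w) := by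
                rw [lintegral_indicator Metric.isOpen_ball.measurableSet,
                  lintegral_const_mul' _ _ (by simp),
                  lintegral_const_mul' _ _ (two_rpow_ne_top _)]
            _ ≤ C₀ * ((2 : ℝ≥0∞) ^ ((j : ℝ) * d) *
                (volume (Metric.ball (0 : EuclideanSpace ℝ (Fin d)) (A * 2 ^ (-j))) *
                ∫⁻ w in Metric.ball x (r + A * 2 ^ (-j)), h w)) := by
                gcongr
                exact setLIntegral_setLIntegral_ball_le x hhm
            _ ≤ C₀ * ((2 : ℝ≥0∞) ^ ((j : ℝ) * d) *
                (V * 2 ^ (-((j : ℝ) * d)) * I)) := by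
                rw [volume_ball_two_zpow _ hA0, Fintype.card_fin]
                gcongr
                refine lintegral_mono_set (Metric.ball_subset_ball ?_)
                gcongr; linarith
            _ = C₀ * V * I * (2 ^ (-((j : ℝ) * d)) * (2 : ℝ≥0∞) ^ ((j : ℝ) * d)) := by ring
            _ = _ := by rw [two_rpow_neg_mul, mul_one]
        · have : ∀ z, join z v ∉ Metric.ball (embed n x) r := fun z hz => hv
            (lt_of_le_of_lt (dist_fiberPart_le (join z v) (embed n x)) hz)
          simp [indicator, this]
    _ ≤ C₁ * ENNReal.ofReal (r ^ (n + α)) * (C₀ * V * I) := by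
        have hmw : Measurable ((Metric.ball (0 : EuclideanSpace ℝ (Fin n)) r).indicator
            (fun v => ENNReal.ofReal (weight n α v))) :=
          ((measurable_weight α).ennreal_ofReal).indicator Metric.isOpen_ball.measurableSet
        rw [lintegral_mul_const _ hmw, lintegral_indicator Metric.isOpen_ball.measurableSet]
        gcongr
        exact hC₁ r hr0 hrR
    _ = _ := by
        have : ENNReal.ofReal (r ^ (n + α)) = ENNReal.ofReal (R ^ (n + α)) *
            2 ^ (-((k : ℝ) * (n + α))) := by
          rw [hr, Real.mul_rpow (by linarith) (by positivity), ENNReal.ofReal_mul (by positivity),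
            ← Real.rpow_intCast, ← Real.rpow_mul (by norm_num), ofReal_two_rpow]
          push_cast; rw [neg_mul]
        rw [this, hK]; ring

/-- The extension operator is bounded from `L^p` to the weighted `L^p`. -/
theorem exists_lintegral_whitneyExt_rpow_le (hψ : IsWhitneyBumpFamily ψ) (hn : 1 ≤ n) {α p : ℝ}
    (hα : -(n : ℝ) < α) (hp : 1 ≤ p) :
    ∃ C : ℝ≥0, ∀ f : EuclideanSpace ℝ (Fin d) → ℂ, LocallyIntegrable f →
      ∫⁻ y, ‖whitneyExt ψ f y‖ₑ ^ p ∂weightMeasure d n α ≤ C * ∫⁻ x, ‖f x‖ₑ ^ p := by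
  have hp0 : 0 < p := by linarith
  have hn' : (1 : ℝ) ≤ n := by exact_mod_cast hn
  obtain ⟨C₀, A, hA, hloc⟩ := exists_whitneyExt_local_le hψ hn
  have hR : (1 : ℝ) ≤ 3 * n + 1 := by linarith
  obtain ⟨C₁, hC₁⟩ := exists_setLIntegral_weight_le hn hR hα
  have hA0 : (0 : ℝ) < A := by exact_mod_cast hA
  set V : ℝ≥0∞ := volume (Metric.ball (0 : EuclideanSpace ℝ (Fin d)) A) with hV
  have hVt : V ≠ ∞ := measure_ball_lt_top.ne
  set r : ℝ := 3 * n + 1 with hr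
  set K : ℝ≥0∞ := C₁ * ENNReal.ofReal (r ^ (n + α)) * (C₀ * V) ^ p with hK
  have hKt : K ≠ ∞ := ENNReal.mul_ne_top (ENNReal.mul_ne_top (by simp) ENNReal.ofReal_ne_top)
    (ENNReal.rpow_ne_top_of_nonneg hp0.le (ENNReal.mul_ne_top (by simp) hVt))
  refine ⟨K.toNNReal, fun f hf => ?_⟩
  rw [ENNReal.coe_toNNReal hKt]
  have hfm := hf.aestronglyMeasurable
  set f' := hfm.mk f with hf'
  set h : EuclideanSpace ℝ (Fin d) → ℝ≥0∞ := fun w => ‖f' w‖ₑ with hh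
  have hhm : Measurable h := hfm.stronglyMeasurable_mk.measurable.enorm
  have hfh : ∀ᵐ w, ‖f w‖ₑ = h w := hfm.ae_eq_mk.mono fun w hw => by
      simp only [hh, hf']; rw [← hw]
  have hfp : ∫⁻ x, ‖f x‖ₑ ^ p = ∫⁻ x, h x ^ p :=
    lintegral_congr_ae (hfh.mono fun w hw => by simp only [hw])
  have hu := measurable_whitneyExt hψ hn f
  rw [hfp, lintegral_weightMeasure _ (hu.enorm.pow_const p)]
  set I : ℝ≥0∞ := ∫⁻ x, h x ^ p with hI
  calc _ ≤ ∫⁻ v, (Metric.ball (0 : EuclideanSpace ℝ (Fin n)) r).indicator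
        (fun v => ENNReal.ofReal (weight n α v)) v * ((C₀ * V) ^ p * I) := by
        refine lintegral_mono_ae ?_
        filter_upwards [ae_ne_zero hn] with v hv0
        by_cases hv : v ∈ Metric.ball (0 : EuclideanSpace ℝ (Fin n)) r
        · simp only [indicator_of_mem hv]
          gcongr
          obtain ⟨j, hj1, hj2⟩ := exists_scale (norm_pos_iff.2 hv0)
          have hc1 : (C₀ * (2 : ℝ≥0∞) ^ ((j : ℝ) * d)) ^ p ≠ ∞ :=
            ENNReal.rpow_ne_top_of_nonneg hp0.le (ENNReal.mul_ne_top (by simp) (two_rpow_ne_top _))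
          calc _ ≤ ∫⁻ x', (C₀ * (2 : ℝ≥0∞) ^ ((j : ℝ) * d)) ^ p *
                (∫⁻ w in Metric.ball x' (A * 2 ^ (-j)), h w) ^ p := by
                refine lintegral_mono fun x' => ?_
                rw [← ENNReal.mul_rpow_of_nonneg _ _ hp0.le]
                gcongr
                have := (hloc f hf j (join x' v) 0 hj1 hj2 (Or.inl rfl)).1
                simp only [sub_zero, basePart_join] at this
                refine this.trans (le_of_eq ?_)
                rw [← mul_assoc]
                congr 1
                exact lintegral_congr_ae (ae_restrict_of_ae hfh)
            _ ≤ (C₀ * (2 : ℝ≥0∞) ^ ((j : ℝ) * d)) ^ p *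
                (volume (Metric.ball (0 : EuclideanSpace ℝ (Fin d)) (A * 2 ^ (-j))) ^ p * I) := by
                rw [lintegral_const_mul' _ _ hc1]
                gcongr
                exact lintegral_rpow_setLIntegral_ball_le hp hhm
            _ = (C₀ * V * (2 ^ (-((j : ℝ) * d)) * (2 : ℝ≥0∞) ^ ((j : ℝ) * d))) ^ p * I := by
                rw [volume_ball_two_zpow _ hA0, Fintype.card_fin, ← mul_assoc,
                  ← ENNReal.mul_rpow_of_nonneg _ _ hp0.le]
                congr 2; ring
            _ = _ := by rw [two_rpow_neg_mul, mul_one]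
        · have : ∀ z, whitneyExt ψ f (join z v) = 0 := fun z => by
            refine whitneyExt_eq_zero hψ hn f ?_
            rw [mem_ball_zero_iff, not_lt] at hv
            rw [fiberPart_join]; linarith
          simp [this, hp0]
    _ ≤ C₁ * ENNReal.ofReal (r ^ (n + α)) * ((C₀ * V) ^ p * I) := by
        have hmw : Measurable ((Metric.ball (0 : EuclideanSpace ℝ (Fin n)) r).indicator
            (fun v => ENNReal.ofReal (weight n α v))) :=
          ((measurable_weight α).ennreal_ofReal).indicator Metric.isOpen_ball.measurableSet
        rw [lintegral_mul_const _ hmw, lintegral_indicator Metric.isOpen_ball.measurableSet]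
        gcongr
        exact hC₁ r (by linarith) le_rfl
    _ = _ := by rw [hK]; ring

theorem weightMeasure_toSet_ne_zero (hn : 1 ≤ n) (α : ℝ) (P : DyadicCube (Fin d ⊕ Fin n)) :
    weightMeasure d n α P.toSet ≠ 0 := by
  obtain ⟨y, hy⟩ := P.toSet_nonempty
  set k : ℕ := P.level.toNat
  set R : ℝ := 1 + ((Fintype.card (Fin d ⊕ Fin n) : ℝ) * P.edge + ‖fiberPart y‖) * 2 ^ (k : ℝ)
    with hR
  have he := P.edge_pos
  have hR1 : 1 ≤ R := by rw [hR]; linarith [show 0 ≤ ((Fintype.card (Fin d ⊕ Fin n) : ℝ) *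
    P.edge + ‖fiberPart y‖) * 2 ^ (k : ℝ) by positivity]
  obtain ⟨C, hC⟩ := exists_inv_weightMeasure_toSet_le (d := d) hn α hR1
  have h := hC P k (basePart y) (by omega) ?_
  · intro h0
    rw [h0, ENNReal.inv_zero, top_le_iff] at h
    exact ENNReal.mul_ne_top (by simp) (two_rpow_ne_top _) h
  · intro z hz
    have h1 := DyadicCube.dist_le_of_mem (subset_closure hz) (subset_closure hy)
    have h2 := dist_embed_le y (basePart y)
    rw [dist_self, zero_add] at h2
    have h3 := dist_triangle z y (embed n (basePart y))
    have h4 : (2 : ℝ) ^ (k : ℝ) * 2 ^ (-(k : ℝ)) = 1 := by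
      rw [← Real.rpow_add (by norm_num)]; simp
    have h5 : (0 : ℝ) < 2 ^ (-(k : ℝ)) := by positivity
    rw [Metric.mem_closedBall, hR, add_mul, mul_assoc, h4]
    linarith

theorem weightMeasure_toSet_ne_top (hn : 1 ≤ n) {α : ℝ} (hα : -(n : ℝ) < α)
    (P : DyadicCube (Fin d ⊕ Fin n)) : weightMeasure d n α P.toSet ≠ ∞ := by
  have := isLocallyFiniteMeasure_weightMeasure (d := d) hn hα
  obtain ⟨y, hy⟩ := P.toSet_nonempty
  refine ((measure_mono fun z hz => ?_).trans_lt (isCompact_closedBall y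
    (Fintype.card (Fin d ⊕ Fin n) * P.edge)).measure_lt_top).ne
  exact DyadicCube.dist_le_of_mem (subset_closure hz) (subset_closure hy)

theorem integrableOn_toSet_weightMeasure {α : ℝ} {u : EuclideanSpace ℝ (Fin d ⊕ Fin n) → ℂ}
    (hu : LocallyIntegrable u (weightMeasure d n α)) (P : DyadicCube (Fin d ⊕ Fin n)) :
    IntegrableOn u P.toSet (weightMeasure d n α) := by
  obtain ⟨y, hy⟩ := P.toSet_nonempty
  refine (hu.integrableOn_isCompact (isCompact_closedBall y
    (Fintype.card (Fin d ⊕ Fin n) * P.edge))).mono_set fun z hz => ?_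
  exact DyadicCube.dist_le_of_mem (subset_closure hz) (subset_closure hy)

theorem enorm_average_sub_le_of_forall (hn : 1 ≤ n) {α : ℝ} (hα : -(n : ℝ) < α)
    {u : EuclideanSpace ℝ (Fin d ⊕ Fin n) → ℂ}
    (hu : LocallyIntegrable u (weightMeasure d n α)) (P : DyadicCube (Fin d ⊕ Fin n)) (c : ℂ)
    {B : ℝ≥0∞} (hB : ∀ z ∈ P.toSet, ‖u z - c‖ₑ ≤ B) :
    ‖(⨍ z in P.toSet, u z ∂weightMeasure d n α) - c‖ₑ ≤ B := by
  have h0 := weightMeasure_toSet_ne_zero hn α P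
  have ht := weightMeasure_toSet_ne_top hn hα P
  refine (enorm_setAverage_sub_le h0 ht (integrableOn_toSet_weightMeasure hu P) c).trans ?_
  calc _ ≤ (weightMeasure d n α P.toSet)⁻¹ * ∫⁻ _z in P.toSet, B ∂weightMeasure d n α := by
        exact mul_le_mul_right (setLIntegral_mono' P.measurableSet_toSet hB) _
    _ = B := by
        rw [setLIntegral_const, mul_comm B, ← mul_assoc, ENNReal.inv_mul_cancel h0 ht, one_mul]

theorem avgDiff_le_add {ι : Type} [Fintype ι] (μ : Measure (EuclideanSpace ℝ ι))
    (u : EuclideanSpace ℝ ι → ℂ) (P P' : DyadicCube ι) (c : ℂ) :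
    avgDiff μ u P P' ≤ ‖(⨍ z in P.toSet, u z ∂μ) - c‖ₑ + ‖(⨍ z in P'.toSet, u z ∂μ) - c‖ₑ := by
  rw [avgDiff, ← sub_sub_sub_cancel_right _ _ c]
  exact enorm_sub_le

/-- The differences of the averages of the extension over neighbouring cubes, at a point at
distance about `2 ^ (-j)` from the subspace. Scales `k ≤ j` see the oscillation of `f` at scale `k`;
at the finer scales the smoothness of the bump functions gives the gain `2 ^ (-(k - j))`. -/
theorem exists_avgDiff_whitneyExt_le (hψ : IsWhitneyBumpFamily ψ) (hn : 1 ≤ n)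
    {α : ℝ} (hα : -(n : ℝ) < α) :
    ∃ (C : ℝ≥0) (m : ℕ) (R : ℝ), 2 ≤ R ∧ ∀ (f : EuclideanSpace ℝ (Fin d) → ℂ)
      (M : ℕ → EuclideanSpace ℝ (Fin d) → ℝ≥0∞), LocallyIntegrable f →
      LocallyIntegrable (whitneyExt ψ f) (weightMeasure d n α) → IsOscBound m f M →
      ∀ (y : EuclideanSpace ℝ (Fin d ⊕ Fin n)) (j : ℕ), (2 : ℝ) ^ (-(j : ℤ)) ≤ ‖fiberPart y‖ →
      (j ≠ 0 → ‖fiberPart y‖ < 2 ^ (1 - (j : ℤ))) →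
      ∀ (k : ℕ) (P' : DyadicCube (Fin d ⊕ Fin n)), (DyadicCube.at_ k y).Neighbor P' →
      (R ≤ ‖fiberPart y‖ → avgDiff (weightMeasure d n α) (whitneyExt ψ f)
        (DyadicCube.at_ k y) P' = 0) ∧
      avgDiff (weightMeasure d n α) (whitneyExt ψ f) (DyadicCube.at_ k y) P' ≤
        C * (2 ^ (-((k : ℝ) - (min j k : ℕ))) * M (min j k) (basePart y)) := by
  have hn' : (1 : ℝ) ≤ n := by exact_mod_cast hn
  -- all neighbours of the cube of generation `k` around `y` lie within `ρ * 2 ^ (-k)` of `y`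
  set ρ : ℝ := 3 * (d + n) with hρ
  have hρ1 : 3 ≤ ρ := by rw [hρ]; linarith [(Nat.cast_nonneg d : (0 : ℝ) ≤ d)]
  have hρn : 3 * n ≤ ρ := by rw [hρ]; linarith [(Nat.cast_nonneg d : (0 : ℝ) ≤ d)]
  have hR6 : 1 ≤ 6 * ρ := by linarith
  obtain ⟨C₀, A₀, hA₀, hloc⟩ := exists_whitneyExt_local_le hψ hn
  obtain ⟨C₁, A₁, hA₁, hint⟩ := exists_setLIntegral_whitneyExt_le hψ hn hα hR6
  obtain ⟨C₂, hinv⟩ := exists_inv_weightMeasure_toSet_le (d := d) hn α hR6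
  have hA₀' : (1 : ℝ) ≤ A₀ := by exact_mod_cast hA₀
  obtain ⟨m, hm⟩ := pow_unbounded_of_one_lt (A₁ + 6 * ρ + A₀ * (4 * ρ)) one_lt_two
  have hmA₁ : A₁ ≤ 2 ^ m := by nlinarith
  have hmρ : 6 * ρ ≤ 2 ^ m := by nlinarith
  have hmA₀ : A₀ * (4 * ρ) ≤ 2 ^ m := by nlinarith
  have hm1 : 1 ≤ m := by
    rcases Nat.eq_zero_or_pos m with h | h
    · rw [h, pow_zero] at hmρ; linarith
    · exact h
  set K : ℝ≥0∞ := 2 * (C₀ * ENNReal.ofReal ρ) + 2 * (C₂ * C₁ * 2 ^ ((m : ℝ) * d + m)) with hK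
  have hKt : K ≠ ∞ := ENNReal.add_ne_top.2 ⟨ENNReal.mul_ne_top (by simp) (ENNReal.mul_ne_top
    (by simp) ENNReal.ofReal_ne_top), ENNReal.mul_ne_top (by simp) (ENNReal.mul_ne_top
    (ENNReal.mul_ne_top (by simp) (by simp)) (two_rpow_ne_top _))⟩
  refine ⟨K.toNNReal, m, 4 * ρ, by linarith, fun f M hf hu hM y j hj1 hj2 k P' hP' => ?_⟩
  rw [ENNReal.coe_toNNReal hKt]
  set μ := weightMeasure d n α with hμ
  set t : ℝ := ‖fiberPart y‖ with ht
  have hk0 : (0 : ℝ) < 2 ^ (-(k : ℤ)) := by positivity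
  have hk1 : (2 : ℝ) ^ (-(k : ℤ)) ≤ 1 := zpow_le_one_of_nonpos₀ (by norm_num) (by simp)
  have ht0 : 0 < t := lt_of_lt_of_le (by positivity) hj1
  have hcard : 3 * (Fintype.card (Fin d ⊕ Fin n) : ℝ) * (DyadicCube.at_ (k : ℤ) y).edge =
      ρ * 2 ^ (-(k : ℤ)) := by
    rw [DyadicCube.edge_at, Fintype.card_sum, Fintype.card_fin, Fintype.card_fin]; push_cast; rfl
  have hself : (DyadicCube.at_ (k : ℤ) y).Neighbor (DyadicCube.at_ (k : ℤ) y) :=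
    DyadicCube.neighbor_of_mem (by simp) (DyadicCube.mem_at _ _) (DyadicCube.mem_at _ _)
  have hsub : ∀ P, (DyadicCube.at_ (k : ℤ) y).Neighbor P →
      P.toSet ⊆ Metric.closedBall y (ρ * 2 ^ (-(k : ℤ))) := fun P hP => by
    rw [← hcard]; exact hP.subset_closedBall (DyadicCube.mem_at _ _)
  have hlevel : ∀ P, (DyadicCube.at_ (k : ℤ) y).Neighbor P → P.level ≤ k + 1 := fun P hP => by
    have h1 := (abs_le.1 (DyadicCube.neighbor_iff.1 hP).1).2
    have h2 : (DyadicCube.at_ (k : ℤ) y).level = k := rfl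
    omega
  -- either the cubes are small compared with their distance to the subspace, where the Lipschitz
  -- bound applies, or they are close to the subspace, where the mean oscillation bound applies
  rcases le_or_gt (4 * (ρ * 2 ^ (-(k : ℤ)))) t with hfar | hnear
  · have hz4 : ∀ P, (DyadicCube.at_ (k : ℤ) y).Neighbor P → ∀ z ∈ P.toSet, dist z y ≤ t / 4 :=
      fun P hP z hz => (Metric.mem_closedBall.1 (hsub P hP hz)).trans (by linarith)
    have hbound : ∀ B : ℝ≥0∞, (∀ z, dist z y ≤ ρ * 2 ^ (-(k : ℤ)) →
        ‖whitneyExt ψ f z - whitneyExt ψ f y‖ₑ ≤ B) →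
        avgDiff μ (whitneyExt ψ f) (DyadicCube.at_ k y) P' ≤ 2 * B := by
      intro B hB
      refine (avgDiff_le_add μ _ _ _ (whitneyExt ψ f y)).trans ?_
      rw [two_mul]
      exact add_le_add
        (enorm_average_sub_le_of_forall hn hα hu _ _ fun z hz => hB z (hsub _ hself hz))
        (enorm_average_sub_le_of_forall hn hα hu _ _ fun z hz => hB z (hsub _ hP' hz))
    have hzero : 4 * ρ ≤ t →
        avgDiff μ (whitneyExt ψ f) (DyadicCube.at_ k y) P' = 0 := by
      intro hRt
      have h := hbound 0 fun z hz => ?_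
      · simpa using h
      · have h5 := (dist_fiberPart_le z y).trans hz
        rw [dist_eq_norm] at h5
        have h7 := norm_sub_norm_le (fiberPart y) (fiberPart z)
        rw [norm_sub_rev] at h7
        rw [whitneyExt_eq_zero hψ hn f (by linarith), whitneyExt_eq_zero hψ hn f (by linarith)]
        simp
    refine ⟨hzero, ?_⟩
    rcases le_or_gt (4 * ρ) t with hRt | hRt
    · rw [hzero hRt]; exact zero_le
    have hjk : min j k = j := by
      rw [min_eq_left_iff]
      by_contra! hkj
      have h1 := hj2 (by omega)
      have h2 : (2 : ℝ) ^ (1 - (j : ℤ)) ≤ 2 ^ (-(k : ℤ)) :=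
        zpow_le_zpow_right₀ (by norm_num) (by omega)
      nlinarith
    rw [hjk]
    -- for `j = 0` the distance may exceed `2`, and then `2 ^ (-j')` is its true size
    obtain ⟨j', hj'1, hj'2, hj'j, hj'A⟩ : ∃ j' : ℤ, (2 : ℝ) ^ (-j') ≤ t ∧ t < 2 ^ (1 - j') ∧
        j' ≤ j ∧ (A₀ : ℝ) * 2 ^ (-j') ≤ 2 ^ ((m : ℤ) - j) := by
      by_cases h0 : j = 0
      · obtain ⟨j', h1, h2⟩ := exists_scale ht0
        refine ⟨j', h1, h2, ?_, ?_⟩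
        · rw [h0, Nat.cast_zero, neg_zero, zpow_zero] at hj1
          have : (1 : ℝ) < 2 ^ (1 - j') := by linarith
          rw [one_lt_zpow_iff_right₀ (by norm_num)] at this
          omega
        · rw [h0, Nat.cast_zero, sub_zero, zpow_natCast]
          refine le_trans ?_ hmA₀
          gcongr; linarith
      · refine ⟨j, hj1, hj2 h0, le_rfl, ?_⟩
        rw [sub_eq_add_neg, zpow_add₀ (by norm_num), zpow_natCast]
        gcongr
        nlinarith
    obtain ⟨c, hc, hcM⟩ := hM j (basePart y)
    have hc' : c = 0 ∨ t ≤ 1 := by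
      by_cases h : j < m
      · exact Or.inl (hc h)
      · refine Or.inr ((hj2 (by omega)).le.trans ?_)
        exact zpow_le_one_of_nonpos₀ (by norm_num) (by omega)
    have hJ : (2 : ℝ≥0∞) ^ ((j' : ℝ) * d) * ∫⁻ w in Metric.ball (basePart y) (A₀ * 2 ^ (-j')),
        ‖f w - c‖ₑ ≤ M j (basePart y) := by
      refine le_trans ?_ hcM
      rw [Fintype.card_fin]
      have hj'j' : (j' : ℝ) ≤ j := by exact_mod_cast hj'j
      refine mul_le_mul' (two_rpow_mono (mul_le_mul_of_nonneg_right hj'j' (by positivity)))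
        (lintegral_mono_set (Metric.ball_subset_ball hj'A))
    have hmain := hbound (C₀ * ENNReal.ofReal ρ * (2 ^ (-((k : ℝ) - j)) * M j (basePart y)))
      fun z hz => ?_
    · refine hmain.trans ?_
      rw [← mul_assoc 2 _ (2 ^ (-((k : ℝ) - j)) * M j (basePart y))]
      exact mul_le_mul_left le_self_add _
    · refine ((hloc f hf j' y c hj'1 hj'2 hc').2 z (by linarith)).trans ?_
      rw [mul_assoc (C₀ : ℝ≥0∞), mul_assoc (C₀ : ℝ≥0∞), ← mul_assoc (ENNReal.ofReal ρ)]
      refine mul_le_mul_right (mul_le_mul' ?_ hJ) _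
      rw [← ofReal_two_rpow, ← ENNReal.ofReal_mul (by linarith)]
      refine ENNReal.ofReal_le_ofReal ?_
      calc dist z y * 2 ^ j' ≤ ρ * 2 ^ (-(k : ℤ)) * 2 ^ (j : ℤ) := by
            gcongr
            norm_num
        _ = _ := by
            rw [mul_assoc, ← zpow_add₀ (by norm_num), ← Real.rpow_intCast]
            push_cast; ring_nf
  · refine ⟨fun h => absurd hnear (by nlinarith), ?_⟩
    set i := min j k with hi
    have hik : i ≤ k := min_le_right _ _
    -- being close to the subspace forces `k ≤ j + m`, so the scales `k` and `i` are comparable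
    have hkim : k ≤ i + m := by
      rcases min_choice j k with h | h
      · have h1 : (2 : ℝ) ^ (-(j : ℤ)) < 2 ^ ((m : ℤ) - k) := by
          refine (hj1.trans_lt hnear).trans_le ?_
          rw [sub_eq_add_neg, zpow_add₀ (by norm_num), ← mul_assoc, zpow_natCast]
          gcongr; linarith
        rw [zpow_lt_zpow_iff_right₀ (by norm_num)] at h1
        omega
      · omega
    obtain ⟨c, hc, hcM⟩ := hM i (basePart y)
    have hc' : c = 0 ∨ 6 * ρ * 2 ^ (-(k : ℤ)) ≤ 1 := by
      by_cases h : i < m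
      · exact Or.inl (hc h)
      · refine Or.inr ?_
        calc 6 * ρ * 2 ^ (-(k : ℤ)) ≤ 2 ^ (m : ℤ) * 2 ^ (-(k : ℤ)) := by
              rw [zpow_natCast]; gcongr
          _ = 2 ^ ((m : ℤ) - k) := by rw [← zpow_add₀ (by norm_num)]; ring_nf
          _ ≤ 1 := zpow_le_one_of_nonpos₀ (by norm_num) (by omega)
    set J : ℝ≥0∞ := ∫⁻ w in Metric.ball (basePart y) (A₁ * 2 ^ (-(k : ℤ))), ‖f w - c‖ₑ with hJ
    have hJM : (2 : ℝ≥0∞) ^ ((k : ℝ) * d) * J ≤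
        2 ^ ((m : ℝ) * d + m) * (2 ^ (-((k : ℝ) - i)) * M i (basePart y)) := by
      have hkim' : (k : ℝ) ≤ i + m := by exact_mod_cast hkim
      calc _ ≤ (2 : ℝ≥0∞) ^ ((m : ℝ) * d + m + -((k : ℝ) - i) + (i : ℝ) * d) *
            ∫⁻ w in Metric.ball (basePart y) ((2 : ℝ) ^ ((m : ℤ) - i)), ‖f w - c‖ₑ := by
            refine mul_le_mul' (two_rpow_mono ?_)
              (lintegral_mono_set (Metric.ball_subset_ball ?_))
            · have : (k : ℝ) * d ≤ (i + m) * d := by gcongr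
              linarith
            · calc A₁ * 2 ^ (-(k : ℤ)) ≤ 2 ^ (m : ℤ) * 2 ^ (-(i : ℤ)) := by
                    rw [zpow_natCast]
                    gcongr
                    norm_num
                _ = _ := by rw [← zpow_add₀ (by norm_num)]; rfl
        _ = (2 : ℝ≥0∞) ^ ((m : ℝ) * d + m + -((k : ℝ) - i)) * ((2 : ℝ≥0∞) ^ ((i : ℝ) * d) *
            ∫⁻ w in Metric.ball (basePart y) ((2 : ℝ) ^ ((m : ℤ) - i)), ‖f w - c‖ₑ) := by
            rw [two_rpow_add _ ((i : ℝ) * d), mul_assoc]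
        _ ≤ _ := by
            rw [two_rpow_add, mul_assoc]
            rw [Fintype.card_fin] at hcM
            gcongr
    have hkz : (2 : ℝ) ^ (-(k : ℝ)) = 2 ^ (-(k : ℤ)) := by
      rw [← Real.rpow_intCast]; push_cast; rfl
    have hone : ∀ P, (DyadicCube.at_ (k : ℤ) y).Neighbor P →
        ‖(⨍ z in P.toSet, whitneyExt ψ f z ∂μ) - c‖ₑ ≤
          C₂ * C₁ * 2 ^ ((m : ℝ) * d + m) * (2 ^ (-((k : ℝ) - i)) * M i (basePart y)) := by
      intro P hP
      have hP5 : P.toSet ⊆ Metric.closedBall (embed n (basePart y)) (5 * ρ * 2 ^ (-(k : ℤ))) := by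
        intro z hz
        have h1 := Metric.mem_closedBall.1 (hsub P hP hz)
        have h2 := dist_embed_le y (basePart y)
        rw [dist_self, zero_add] at h2
        have h3 := dist_triangle z y (embed n (basePart y))
        rw [Metric.mem_closedBall]
        linarith
      have hP6 : P.toSet ⊆ Metric.ball (embed n (basePart y)) (6 * ρ * 2 ^ (-(k : ℤ))) :=
        hP5.trans (Metric.closedBall_subset_ball (by nlinarith))
      refine (enorm_setAverage_sub_le (weightMeasure_toSet_ne_zero hn α P)
        (weightMeasure_toSet_ne_top hn hα P) (integrableOn_toSet_weightMeasure hu P) c).trans ?_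
      have h1 := hinv P k (basePart y) (hlevel P hP)
        (by rw [hkz]; exact hP6.trans Metric.ball_subset_closedBall)
      have h2 := hint f hf (basePart y) k c hc'
      calc _ ≤ C₂ * 2 ^ ((k : ℝ) * (d + n + α)) * (C₁ * ((2 : ℝ≥0∞) ^ (-((k : ℝ) * (n + α))) *
            J)) := mul_le_mul' h1 ((lintegral_mono_set hP6).trans h2)
        _ = C₂ * C₁ * ((2 ^ ((k : ℝ) * (d + n + α)) * (2 : ℝ≥0∞) ^ (-((k : ℝ) * (n + α)))) *
            J) := by ring
        _ = C₂ * C₁ * (2 ^ ((k : ℝ) * d) * J) := by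
            rw [← two_rpow_add]; congr 3; ring
        _ ≤ _ := by
            rw [mul_assoc (C₂ * C₁ : ℝ≥0∞)]
            gcongr
    refine (avgDiff_le_add μ _ _ _ c).trans ((add_le_add (hone _ hself) (hone _ hP')).trans ?_)
    rw [← two_mul, ← mul_assoc 2]
    exact mul_le_mul_left le_add_self _

end

/-! ### Boundedness of the extension -/

/-- Summation over all scales at a point at distance about `2 ^ (-j)` from the subspace: the scales
finer than `2 ^ (-j)` are dominated by the scale `j`, because `s < 1`. -/
theorem exists_lqNorm_min_rpow_le {q : ℝ≥0∞} (hq : 0 < q) {s ε p : ℝ} (hs : s < 1) (hε : 0 < ε)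
    (hp : 0 < p) :
    ∃ C : ℝ≥0, ∀ (j : ℕ) (b : ℕ → ℝ≥0∞),
      lqNorm q (fun k : ℕ => (2 : ℝ≥0∞) ^ ((k : ℝ) * s) *
        (2 ^ (-((k : ℝ) - (min j k : ℕ))) * b (min j k))) ^ p ≤
      C * ∑' i : ℕ, if i ≤ j then (2 ^ (ε * ((j : ℝ) - i)) * (2 ^ ((i : ℝ) * s) * b i)) ^ p
        else 0 := by
  set δ := min ε (1 - s) with hδ
  have hδ0 : 0 < δ := lt_min hε (by linarith)
  have hδ1 : δ ≤ ε := min_le_left _ _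
  have hδ2 : δ ≤ 1 - s := min_le_right _ _
  obtain ⟨C, hC⟩ := exists_lqNorm_two_rpow_le hq hδ0
  refine ⟨C ^ p, fun j b => ?_⟩
  set b' : ℕ → ℝ≥0∞ := fun i => if i ≤ j then 2 ^ ((i : ℝ) * s) * b i else 0 with hb'
  set S : ℝ≥0∞ := (∑' i : ℕ, (2 ^ (ε * |(i : ℝ) - j|) * b' i) ^ p) ^ (1 / p) with hS
  have hSp : S ^ p = ∑' i : ℕ, if i ≤ j then
      (2 ^ (ε * ((j : ℝ) - i)) * (2 ^ ((i : ℝ) * s) * b i)) ^ p else 0 := by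
    rw [hS, ← ENNReal.rpow_mul, one_div_mul_cancel hp.ne', ENNReal.rpow_one]
    refine tsum_congr fun i => ?_
    by_cases h : i ≤ j
    · have : |(i : ℝ) - j| = j - i := by
        rw [abs_sub_comm, abs_of_nonneg]
        rw [sub_nonneg]; exact_mod_cast h
      simp only [hb', h, if_true, this]
    · simp [hb', h, hp]
  rw [← hSp, ENNReal.coe_rpow_of_nonneg _ hp.le, ← ENNReal.mul_rpow_of_nonneg _ _ hp.le]
  gcongr
  calc _ ≤ lqNorm q (fun k : ℕ => (2 : ℝ≥0∞) ^ (-(δ * |(k : ℝ) - j|)) * S) := by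
        refine lqNorm_mono fun k => ?_
        have hw := sum_le_of_weight_le (a := ε) hp b' j (min j k)
        have hb : b' (min j k) = 2 ^ (((min j k : ℕ) : ℝ) * s) * b (min j k) := by
          simp [hb']
        calc _ = 2 ^ (-((1 - s) * ((k : ℝ) - (min j k : ℕ)))) * b' (min j k) := by
              rw [hb, ← mul_assoc, ← mul_assoc, ← two_rpow_add, ← two_rpow_add]
              congr 2; ring
          _ ≤ 2 ^ (-((1 - s) * ((k : ℝ) - (min j k : ℕ)))) *
              (2 ^ (-(ε * |((min j k : ℕ) : ℝ) - j|)) * S) := by gcongr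
          _ ≤ _ := by
              rw [← mul_assoc, ← two_rpow_add]
              refine mul_le_mul_left (two_rpow_mono ?_) _
              rcases le_total j k with h | h
              · have h' : (j : ℝ) ≤ k := by exact_mod_cast h
                rw [min_eq_left h, sub_self, abs_zero, abs_of_nonneg (by linarith)]
                nlinarith
              · have h' : (k : ℝ) ≤ j := by exact_mod_cast h
                rw [min_eq_right h, sub_self, abs_of_nonpos (by linarith)]
                nlinarith
    _ ≤ _ := by
        rw [lqNorm_mul_right hq]
        gcongr
        exact hC j

/-- Inner quasinorms over boundedly many indices can be replaced by a uniform bound. -/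
theorem lqNorm_lqNorm_le {q : ℝ≥0∞} (hq : 0 < q) {κ : ℕ → Type} {N : ℕ}
    (hN : ∀ k, ENat.card (κ k) ≤ N) (w B : ℕ → ℝ≥0∞) (F : ∀ k, κ k → ℝ≥0∞) {L : ℝ≥0∞}
    (h : ∀ k j, F k j ≤ L * B k) :
    lqNorm q (fun k => w k * lqNorm q (F k)) ≤
      lqNorm q (fun k => w k * B k) * ((N : ℝ≥0∞) ^ (1 / q.toReal) * L) := by
  rw [← lqNorm_mul_right hq]
  refine lqNorm_mono fun k => ?_
  calc _ ≤ w k * ((N : ℝ≥0∞) ^ (1 / q.toReal) * (L * B k)) :=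
        mul_le_mul_right ((lqNorm_mono (h k)).trans (lqNorm_const_le hq (hN k) _)) _
    _ = _ := by ring

section

variable {d n : ℕ} {ψ : DyadicCube (Fin d ⊕ Fin n) → EuclideanSpace ℝ (Fin d ⊕ Fin n) → ℝ}

/-- The integrand of the Triebel--Lizorkin energy of the extension, at a point over `x`: the scales
`2 ^ (-i)` down to the distance from the subspace contribute the oscillation of `f` at `x`. -/
theorem exists_triebelIntegrand_whitneyExt_le (hψ : IsWhitneyBumpFamily ψ) (hn : 1 ≤ n)
    {α s p η : ℝ} {q : ℝ≥0∞} (hα : -(n : ℝ) < α) (hs : s < 1) (hp : 0 < p) (hq : 0 < q)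
    (hη : 0 < η) :
    ∃ (C : ℝ≥0) (m : ℕ) (R : ℝ), 1 ≤ R ∧ ∀ (f : EuclideanSpace ℝ (Fin d) → ℂ)
      (M : ℕ → EuclideanSpace ℝ (Fin d) → ℝ≥0∞), LocallyIntegrable f →
      LocallyIntegrable (whitneyExt ψ f) (weightMeasure d n α) → IsOscBound m f M →
      ∀ y : EuclideanSpace ℝ (Fin d ⊕ Fin n), fiberPart y ≠ 0 →
      (lqNorm q fun k : ℕ => (2 : ℝ≥0∞) ^ ((k : ℝ) * s) *
        lqNorm q fun Q' : {Q' : DyadicCube (Fin d ⊕ Fin n) // (DyadicCube.at_ k y).Neighbor Q'} =>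
          avgDiff (weightMeasure d n α) (whitneyExt ψ f) (DyadicCube.at_ k y) Q'.1) ^ p ≤
      C * ∑' i : ℕ, (Metric.ball (0 : EuclideanSpace ℝ (Fin n)) (R * 2 ^ (-(i : ℤ)))).indicator
        (fun v => ENNReal.ofReal (‖v‖ ^ (-η))) (fiberPart y) * (2 ^ (-((i : ℝ) * η)) *
          (2 ^ ((i : ℝ) * s) * M i (basePart y)) ^ p) := by
  obtain ⟨C₀, m, R, hR, hdiff⟩ := exists_avgDiff_whitneyExt_le (d := d) hψ hn hα
  obtain ⟨N, hN⟩ := DyadicCube.exists_card_neighbor_le (Fin d ⊕ Fin n)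
  obtain ⟨C₁, hC₁⟩ := exists_lqNorm_min_rpow_le (s := s) (p := p) (ε := η / p) hq hs
    (by positivity) hp
  set L : ℝ≥0∞ := (N : ℝ≥0∞) ^ (1 / q.toReal) * C₀ with hL
  have hLt : L ≠ ∞ := ENNReal.mul_ne_top
    (ENNReal.rpow_ne_top_of_nonneg (by positivity) (by simp)) (by simp)
  set K : ℝ≥0∞ := L ^ p * C₁ * ENNReal.ofReal (R ^ η) with hK
  have hKt : K ≠ ∞ := ENNReal.mul_ne_top (ENNReal.mul_ne_top
    (ENNReal.rpow_ne_top_of_nonneg hp.le hLt) (by simp)) ENNReal.ofReal_ne_top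
  refine ⟨K.toNNReal, m, R, by linarith, fun f M hf hu hM y hy => ?_⟩
  rw [ENNReal.coe_toNNReal hKt]
  set t : ℝ := ‖fiberPart y‖ with ht
  have ht0 : 0 < t := norm_pos_iff.2 hy
  obtain ⟨j, hj1, hj2⟩ : ∃ j : ℕ, (2 : ℝ) ^ (-(j : ℤ)) ≤ t ∧ (j ≠ 0 → t < 2 ^ (1 - (j : ℤ))) := by
    rcases le_or_gt 1 t with h1 | h1
    · exact ⟨0, by simpa using h1, fun h => absurd rfl h⟩
    · obtain ⟨j, h2, h3⟩ := exists_scale ht0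
      have h4 : (2 : ℝ) ^ (-j) < 2 ^ (0 : ℤ) := by rw [zpow_zero]; linarith
      rw [zpow_lt_zpow_iff_right₀ (by norm_num)] at h4
      lift j to ℕ using by omega
      exact ⟨j, h2, fun _ => h3⟩
  have hcard : ∀ k : ℕ, ENat.card {Q' : DyadicCube (Fin d ⊕ Fin n) //
      (DyadicCube.at_ k y).Neighbor Q'} ≤ N := fun k => hN (DyadicCube.at_ k y)
  have hd := hdiff f M hf hu hM y j hj1 hj2
  rcases le_or_gt R t with hRt | hRt
  · have h0 := lqNorm_lqNorm_le hq hcard (fun k : ℕ => (2 : ℝ≥0∞) ^ ((k : ℝ) * s)) 0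
      (fun k Q' => avgDiff (weightMeasure d n α) (whitneyExt ψ f) (DyadicCube.at_ k y) Q'.1)
      (L := 0) fun k Q' => by simpa using (hd k Q'.1 Q'.2).1 hRt
    rw [mul_zero, mul_zero] at h0
    rw [le_zero_iff.1 h0, ENNReal.zero_rpow_of_pos hp]
    exact zero_le
  have hmain := lqNorm_lqNorm_le hq hcard (fun k : ℕ => (2 : ℝ≥0∞) ^ ((k : ℝ) * s))
    (fun k : ℕ => 2 ^ (-((k : ℝ) - (min j k : ℕ))) * M (min j k) (basePart y))
    (fun k Q' => avgDiff (weightMeasure d n α) (whitneyExt ψ f) (DyadicCube.at_ k y) Q'.1)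
    (L := C₀) fun k Q' => (hd k Q'.1 Q'.2).2
  calc _ ≤ ((lqNorm q fun k : ℕ => (2 : ℝ≥0∞) ^ ((k : ℝ) * s) *
        (2 ^ (-((k : ℝ) - (min j k : ℕ))) * M (min j k) (basePart y))) * L) ^ p :=
        ENNReal.rpow_le_rpow hmain hp.le
    _ ≤ C₁ * (∑' i : ℕ, if i ≤ j then (2 ^ (η / p * ((j : ℝ) - i)) *
        (2 ^ ((i : ℝ) * s) * M i (basePart y))) ^ p else 0) * L ^ p := by
        rw [ENNReal.mul_rpow_of_nonneg _ _ hp.le]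
        gcongr
        exact hC₁ j fun i => M i (basePart y)
    _ ≤ C₁ * (∑' i : ℕ, ENNReal.ofReal (R ^ η) * ((Metric.ball (0 : EuclideanSpace ℝ (Fin n))
        (R * 2 ^ (-(i : ℤ)))).indicator (fun v => ENNReal.ofReal (‖v‖ ^ (-η))) (fiberPart y) *
          (2 ^ (-((i : ℝ) * η)) * (2 ^ ((i : ℝ) * s) * M i (basePart y)) ^ p))) * L ^ p := by
        gcongr with i
        split_ifs with hij
        · have hij' : (2 : ℝ) ^ (-(j : ℤ)) ≤ 2 ^ (-(i : ℤ)) :=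
            zpow_le_zpow_right₀ (by norm_num) (by omega)
          have htj : t < R * 2 ^ (-(j : ℤ)) := by
            by_cases h0 : j = 0
            · simpa [h0] using hRt
            · refine (hj2 h0).trans_le ?_
              rw [sub_eq_add_neg, zpow_add₀ (by norm_num), zpow_one]
              gcongr
          have hmem : fiberPart y ∈ Metric.ball (0 : EuclideanSpace ℝ (Fin n))
              (R * 2 ^ (-(i : ℤ))) := by
            rw [mem_ball_zero_iff]
            exact htj.trans_le (by gcongr)
          rw [indicator_of_mem hmem, ENNReal.mul_rpow_of_nonneg _ _ hp.le, two_rpow_rpow,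
            ← mul_assoc, ← mul_assoc]
          refine mul_le_mul_left ?_ _
          rw [← ofReal_two_rpow, ← ofReal_two_rpow, ← ENNReal.ofReal_mul (by positivity),
            ← ENNReal.ofReal_mul (by positivity)]
          refine ENNReal.ofReal_le_ofReal ?_
          have hji : (2 : ℝ) ^ ((j : ℝ) - i) ≤ R * t⁻¹ * 2 ^ (-(i : ℝ)) := by
            rw [sub_eq_add_neg, Real.rpow_add (by norm_num)]
            gcongr
            rw [← div_eq_mul_inv, le_div_iff₀ ht0]
            have : (2 : ℝ) ^ (j : ℝ) * 2 ^ (-(j : ℤ)) = 1 := by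
              rw [zpow_neg, zpow_natCast, Real.rpow_natCast, mul_inv_cancel₀ (by positivity)]
            calc (2 : ℝ) ^ (j : ℝ) * t ≤ 2 ^ (j : ℝ) * (R * 2 ^ (-(j : ℤ))) := by gcongr
              _ = R * (2 ^ (j : ℝ) * 2 ^ (-(j : ℤ))) := by ring
              _ = R := by rw [this, mul_one]
          calc (2 : ℝ) ^ (η / p * ((j : ℝ) - i) * p) = ((2 : ℝ) ^ ((j : ℝ) - i)) ^ η := by
                rw [← Real.rpow_mul (by norm_num)]; congr 1; field_simp
            _ ≤ (R * t⁻¹ * 2 ^ (-(i : ℝ))) ^ η := by gcongr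
            _ = _ := by
                rw [Real.mul_rpow (by positivity) (by positivity),
                  Real.mul_rpow (by positivity) (by positivity), Real.inv_rpow ht0.le,
                  ← Real.rpow_neg ht0.le, ← Real.rpow_mul (by norm_num), neg_mul]
        · exact zero_le
    _ = _ := by rw [ENNReal.tsum_mul_left, hK]; ring

/-- Integrating over the fibres turns the smoothness `s` into `s - (α + n) / p`. -/
theorem exists_triebelEnergy_whitneyExt_le (hψ : IsWhitneyBumpFamily ψ) (hn : 1 ≤ n)
    {α s p : ℝ} {q : ℝ≥0∞} (hα : -(n : ℝ) < α) (hs : s < 1) (hp : 0 < p) (hq : 0 < q) :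
    ∃ (C : ℝ≥0) (m : ℕ), ∀ (f : EuclideanSpace ℝ (Fin d) → ℂ)
      (M : ℕ → EuclideanSpace ℝ (Fin d) → ℝ≥0∞), LocallyIntegrable f →
      LocallyIntegrable (whitneyExt ψ f) (weightMeasure d n α) → (∀ i, Measurable (M i)) →
      IsOscBound m f M →
      triebelEnergy s p q (weightMeasure d n α) (whitneyExt ψ f) ^ p ≤
        C * ∑' i : ℕ, ∫⁻ x, ((2 : ℝ≥0∞) ^ ((i : ℝ) * (s - (α + n) / p)) * M i x) ^ p := by
  -- half of the available decay `n + α` makes the sums over scales converge, the other half keeps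
  -- the weighted integral over the fibres finite
  set η : ℝ := (n + α) / 2 with hη
  have hη0 : 0 < η := by rw [hη]; linarith
  obtain ⟨C₀, m, R, hR, hpt⟩ := exists_triebelIntegrand_whitneyExt_le (d := d) (s := s) hψ hn hα
    hs hp hq hη0
  obtain ⟨C₁, hC₁⟩ := exists_setLIntegral_weight_rpow_le hn hR (α := α) (η := η)
    (by rw [hη]; linarith)
  set K : ℝ≥0∞ := C₀ * (C₁ * ENNReal.ofReal (R ^ (n + (α - η)))) with hK
  have hKt : K ≠ ∞ := ENNReal.mul_ne_top (by simp) (ENNReal.mul_ne_top (by simp)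
    ENNReal.ofReal_ne_top)
  refine ⟨K.toNNReal, m, fun f M hf hu hMm hM => ?_⟩
  rw [ENNReal.coe_toNNReal hKt, triebelEnergy, ← ENNReal.rpow_mul, one_div_mul_cancel hp.ne',
    ENNReal.rpow_one]
  set G : ℕ → EuclideanSpace ℝ (Fin n) → ℝ≥0∞ := fun i =>
    (Metric.ball (0 : EuclideanSpace ℝ (Fin n)) (R * 2 ^ (-(i : ℤ)))).indicator
      (fun v => ENNReal.ofReal (‖v‖ ^ (-η))) with hG
  have hGm : ∀ i, Measurable (G i) := fun i =>
    (measurable_norm.pow_const _).ennreal_ofReal.indicator Metric.isOpen_ball.measurableSet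
  set H : ℕ → EuclideanSpace ℝ (Fin d) → ℝ≥0∞ := fun i x =>
    2 ^ (-((i : ℝ) * η)) * (2 ^ ((i : ℝ) * s) * M i x) ^ p with hH
  have hHm : ∀ i, Measurable (H i) := fun i => (((hMm i).const_mul _).pow_const p).const_mul _
  have hint : ∀ i : ℕ, ∫⁻ v, ENNReal.ofReal (weight n α v) * G i v ≤
      C₁ * (ENNReal.ofReal (R ^ (n + (α - η))) * 2 ^ (-((i : ℝ) * (n + (α - η))))) := by
    intro i
    have h1 := hC₁ (R * 2 ^ (-(i : ℤ))) (by positivity) (mul_le_of_le_one_right (by linarith)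
      (zpow_le_one_of_nonpos₀ (by norm_num) (by simp)))
    have h2 : ENNReal.ofReal ((R * 2 ^ (-(i : ℤ))) ^ (n + (α - η))) =
        ENNReal.ofReal (R ^ (n + (α - η))) * 2 ^ (-((i : ℝ) * (n + (α - η)))) := by
      rw [Real.mul_rpow (by linarith) (by positivity), ENNReal.ofReal_mul (by positivity),
        ← Real.rpow_intCast, ← Real.rpow_mul (by norm_num), ofReal_two_rpow]
      push_cast; rw [neg_mul]
    rw [h2, ← lintegral_indicator Metric.isOpen_ball.measurableSet] at h1
    refine le_trans (le_of_eq (lintegral_congr fun v => ?_)) h1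
    simp only [hG, indicator]
    split_ifs <;> simp
  calc _ ≤ ∫⁻ y, C₀ * ∑' i : ℕ, G i (fiberPart y) * H i (basePart y) ∂weightMeasure d n α := by
        refine lintegral_mono_ae ?_
        filter_upwards [(weightMeasure_absolutelyContinuous α).ae_le (ae_fiberPart_ne_zero hn)]
          with y hy
        exact hpt f M hf hu hM y hy
    _ = C₀ * ∑' i : ℕ, (∫⁻ v, ENNReal.ofReal (weight n α v) * G i v) * ∫⁻ x, H i x := by
        have hm : ∀ i, Measurable fun y : EuclideanSpace ℝ (Fin d ⊕ Fin n) =>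
            G i (fiberPart y) * H i (basePart y) := fun i =>
          ((hGm i).comp measurable_fiberPart).mul ((hHm i).comp measurable_basePart)
        rw [lintegral_const_mul _ (Measurable.tsum hm), lintegral_tsum fun i => (hm i).aemeasurable]
        congr 1
        refine tsum_congr fun i => ?_
        rw [lintegral_weightMeasure _ (hm i)]
        have hwm : Measurable fun v => ENNReal.ofReal (weight n α v) * G i v :=
          (measurable_weight α).ennreal_ofReal.mul (hGm i)
        rw [← lintegral_mul_const _ hwm]
        refine lintegral_congr fun v => ?_
        simp only [fiberPart_join, basePart_join]
        rw [lintegral_const_mul _ (hHm i), mul_assoc]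
    _ ≤ C₀ * ∑' i : ℕ, (C₁ * (ENNReal.ofReal (R ^ (n + (α - η))) *
          2 ^ (-((i : ℝ) * (n + (α - η)))))) * ∫⁻ x, H i x := by
        gcongr with i
        exact hint i
    _ = _ := by
        rw [hK, mul_assoc (C₀ : ℝ≥0∞)]
        congr 1
        rw [← ENNReal.tsum_mul_left]
        refine tsum_congr fun i => ?_
        have h2 : (2 : ℝ≥0∞) ^ ((i : ℝ) * (s - (α + n) / p) * p) =
            2 ^ (-((i : ℝ) * (n + (α - η)))) * (2 ^ (-((i : ℝ) * η)) * 2 ^ ((i : ℝ) * s * p)) := by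
          rw [← two_rpow_add, ← two_rpow_add]; congr 1; field_simp; ring
        simp only [hH]
        simp_rw [ENNReal.mul_rpow_of_nonneg _ _ hp.le, two_rpow_rpow]
        rw [lintegral_const_mul' _ _ (two_rpow_ne_top _), lintegral_const_mul' _ _
          (two_rpow_ne_top _), lintegral_const_mul' _ _ (two_rpow_ne_top _), h2]
        ring

/-- The extension operator maps the Besov space boundedly into the Triebel--Lizorkin space. -/
theorem exists_triebelNorm_whitneyExt_le (hψ : IsWhitneyBumpFamily ψ) (hn : 1 ≤ n)
    {α s p : ℝ} {q : ℝ≥0∞} (hα : -(n : ℝ) < α) (hα' : α < s * p - n) (hs : s < 1) (hp : 1 ≤ p)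
    (hq : 0 < q) :
    ∃ C : ℝ≥0, ∀ f ∈ besovSpace (s - (α + n) / p) p (ENNReal.ofReal p)
        (volume : Measure (EuclideanSpace ℝ (Fin d))),
      whitneyExt ψ f ∈ triebelSpace s p q (weightMeasure d n α) ∧
      triebelNorm s p q (weightMeasure d n α) (whitneyExt ψ f) ≤
        C * besovNorm (s - (α + n) / p) p (ENNReal.ofReal p) volume f := by
  have hp0 : 0 < p := by linarith
  have hp1 : 1 ≤ ENNReal.ofReal p := by simpa using ENNReal.ofReal_le_ofReal hp
  have hσ : 0 < s - (α + n) / p := by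
    rw [sub_pos, div_lt_iff₀ hp0]; linarith
  have := isLocallyFiniteMeasure_weightMeasure (d := d) hn hα
  have hn' : (1 : ℝ) ≤ n := by exact_mod_cast hn
  obtain ⟨C₁, hC₁⟩ := exists_lintegral_whitneyExt_rpow_le (d := d) hψ hn hα hp
  obtain ⟨C₂, hC₂⟩ := exists_lintegral_whitneyExt_rpow_le (d := d) (α := 0) hψ hn (by linarith) hp
  obtain ⟨C₃, m, hC₃⟩ := exists_triebelEnergy_whitneyExt_le (d := d) (s := s) hψ hn hα hs hp0 hq
  obtain ⟨C₄, hC₄⟩ := exists_isOscBound_of_besov (ι := Fin d) hp hσ m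
  refine ⟨C₁ ^ (1 / p) + (C₃ * C₄) ^ (1 / p), fun f ⟨hf, _, hfn⟩ => ?_⟩
  have hm := measurable_whitneyExt hψ hn f
  have hLp : eLpNorm (whitneyExt ψ f) (ENNReal.ofReal p) (weightMeasure d n α) ≤
      (C₁ ^ (1 / p) : ℝ≥0) * eLpNorm f (ENNReal.ofReal p) volume := by
    refine le_of_rpow_le hp0 ?_
    rw [eLpNorm_ofReal_rpow hp0, eLpNorm_ofReal_rpow hp0]
    exact hC₁ f hf
  have hLp0 : eLpNorm (whitneyExt ψ f) (ENNReal.ofReal p) volume ≤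
      (C₂ ^ (1 / p) : ℝ≥0) * eLpNorm f (ENNReal.ofReal p) volume := by
    refine le_of_rpow_le hp0 ?_
    rw [eLpNorm_ofReal_rpow hp0, eLpNorm_ofReal_rpow hp0, ← weightMeasure_zero]
    exact hC₂ f hf
  have hft : eLpNorm f (ENNReal.ofReal p) volume < ∞ := le_self_add.trans_lt hfn
  -- Lebesgue measure is the weighted measure for `α = 0`
  have hu0 : LocallyIntegrable (whitneyExt ψ f) :=
    MemLp.locallyIntegrable ⟨hm.aestronglyMeasurable,
      hLp0.trans_lt (ENNReal.mul_lt_top (by simp) hft)⟩ hp1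
  have hu : LocallyIntegrable (whitneyExt ψ f) (weightMeasure d n α) :=
    MemLp.locallyIntegrable ⟨hm.aestronglyMeasurable,
      hLp.trans_lt (ENNReal.mul_lt_top (by simp) hft)⟩ hp1
  obtain ⟨M, hM1, hM2, hM3⟩ := hC₄ f hf
  have hE : triebelEnergy s p q (weightMeasure d n α) (whitneyExt ψ f) ≤
      ((C₃ * C₄) ^ (1 / p) : ℝ≥0) * besovNorm (s - (α + n) / p) p (ENNReal.ofReal p) volume f := by
    refine le_of_rpow_le hp0 ((hC₃ f M hf hu hM1 hM2).trans ?_)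
    rw [ENNReal.coe_mul, mul_assoc]
    gcongr
  have hN : triebelNorm s p q (weightMeasure d n α) (whitneyExt ψ f) ≤
      (C₁ ^ (1 / p) + (C₃ * C₄) ^ (1 / p) : ℝ≥0) *
        besovNorm (s - (α + n) / p) p (ENNReal.ofReal p) volume f := by
    rw [ENNReal.coe_add, add_mul]
    refine add_le_add (hLp.trans ?_) hE
    gcongr
    exact le_self_add
  exact ⟨⟨hu0, hm.aestronglyMeasurable, hN.trans_lt (ENNReal.mul_lt_top (by simp) hfn)⟩, hN⟩

end

/-! ### Convergence of the means over balls -/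

section

variable {d n : ℕ}

/-- Balls centred on the subspace contain dyadic cubes of comparable size. -/
theorem exists_inv_weightMeasure_ball_le (hn : 1 ≤ n) (α : ℝ) :
    ∃ C : ℝ≥0, ∀ (x : EuclideanSpace ℝ (Fin d)) (k : ℕ) (r : ℝ), 2 ^ (-((k : ℝ) + 1)) < r →
      (weightMeasure d n α (Metric.ball (embed n x) r))⁻¹ ≤ C * 2 ^ ((k : ℝ) * (d + n + α)) := by
  set D : ℕ := Fintype.card (Fin d ⊕ Fin n) with hD
  have hD1 : (1 : ℝ) ≤ D := by
    rw [hD, Fintype.card_sum, Fintype.card_fin, Fintype.card_fin]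
    exact_mod_cast le_add_left hn
  obtain ⟨C, hC⟩ := exists_inv_weightMeasure_toSet_le (d := d) hn α hD1
  refine ⟨C * (2 ^ (((D : ℝ) + 1) * (d + n + α)) : ℝ≥0∞).toNNReal, fun x k r hr => ?_⟩
  set k' : ℕ := k + (D + 1) with hk'
  set P := DyadicCube.at_ (k' : ℤ) (embed n x) with hP
  have he : P.edge = 2 ^ (-(k' : ℝ)) := by
    rw [hP, DyadicCube.edge_at, ← Real.rpow_intCast]; push_cast; rfl
  have hsub : P.toSet ⊆ Metric.closedBall (embed n x) (D * 2 ^ (-(k' : ℝ))) := fun z hz => by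
    rw [← he]
    exact DyadicCube.dist_le_of_mem (subset_closure hz) (subset_closure (DyadicCube.mem_at _ _))
  have hsmall : (D : ℝ) * 2 ^ (-(k' : ℝ)) < r := by
    refine lt_of_le_of_lt ?_ hr
    have h1 : (D : ℝ) ≤ 2 ^ (D : ℝ) := by
      rw [Real.rpow_natCast]; exact_mod_cast (Nat.lt_two_pow_self).le
    calc (D : ℝ) * 2 ^ (-(k' : ℝ)) ≤ 2 ^ (D : ℝ) * 2 ^ (-(k' : ℝ)) := by gcongr
      _ = _ := by
        rw [← Real.rpow_add (by norm_num), hk']; congr 1; push_cast; ring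
  calc _ ≤ (weightMeasure d n α P.toSet)⁻¹ := by
        rw [ENNReal.inv_le_inv]
        exact measure_mono (hsub.trans (Metric.closedBall_subset_ball hsmall))
    _ ≤ C * 2 ^ ((k' : ℝ) * (d + n + α)) := hC P k' x (by simp [hP, DyadicCube.at_]) hsub
    _ = _ := by
        rw [ENNReal.coe_mul, ENNReal.coe_toNNReal (two_rpow_ne_top _), mul_assoc, ← two_rpow_add]
        congr 2; rw [hk']; push_cast; ring

theorem tendsto_floor_neg_logb :
    Tendsto (fun r : ℝ => ⌊-Real.logb 2 r⌋₊) (𝓝[>] 0) atTop :=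
  tendsto_nat_floor_atTop.comp
    (tendsto_neg_atBot_atTop.comp (Real.tendsto_logb_nhdsGT_zero (by norm_num)))

/-- The means over balls centred on the subspace converge as soon as the mean oscillations over the
balls of radius `2 ^ (-k)`, around values converging to the limit, tend to zero. -/
theorem tendsto_ballMean (hn : 1 ≤ n) {α : ℝ} (hα : -(n : ℝ) < α)
    {u : EuclideanSpace ℝ (Fin d ⊕ Fin n) → ℂ} (hu : LocallyIntegrable u (weightMeasure d n α))
    (x : EuclideanSpace ℝ (Fin d)) {c : ℕ → ℂ} {b : ℂ} (hc : Tendsto c atTop (𝓝 b))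
    (h : Tendsto (fun k : ℕ => (2 : ℝ≥0∞) ^ ((k : ℝ) * (d + n + α)) *
      ∫⁻ y in Metric.ball (embed n x) (2 ^ (-(k : ℤ))), ‖u y - c k‖ₑ ∂weightMeasure d n α)
      atTop (𝓝 0)) :
    Tendsto (ballMean (weightMeasure d n α) u x) (𝓝[>] 0) (𝓝 b) := by
  have := isLocallyFiniteMeasure_weightMeasure (d := d) hn hα
  obtain ⟨C, hC⟩ := exists_inv_weightMeasure_ball_le (d := d) hn α
  rw [tendsto_iff_edist_tendsto_0]
  have hF : Tendsto (fun k : ℕ => C * ((2 : ℝ≥0∞) ^ ((k : ℝ) * (d + n + α)) *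
      ∫⁻ y in Metric.ball (embed n x) (2 ^ (-(k : ℤ))), ‖u y - c k‖ₑ ∂weightMeasure d n α) +
      edist (c k) b) atTop (𝓝 0) := by
    have h1 := ENNReal.Tendsto.const_mul (a := (C : ℝ≥0∞)) h (Or.inr (by simp))
    rw [mul_zero] at h1
    simpa using h1.add (tendsto_iff_edist_tendsto_0.1 hc)
  refine tendsto_of_tendsto_of_tendsto_of_le_of_le' tendsto_const_nhds
    (hF.comp tendsto_floor_neg_logb) (.of_forall fun _ => zero_le) ?_
  filter_upwards [Ioo_mem_nhdsGT (zero_lt_one' ℝ)] with r hr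
  -- the generation with `2 ^ (-(k + 1)) < r ≤ 2 ^ (-k)`
  set k := ⌊-Real.logb 2 r⌋₊ with hk
  have hl : 0 ≤ -Real.logb 2 r := by
    have := Real.logb_nonpos (b := 2) (by norm_num) hr.1.le hr.2.le
    linarith
  have h1 : (2 : ℝ) ^ (-((k : ℝ) + 1)) < r := by
    rw [← Real.lt_logb_iff_rpow_lt (by norm_num) hr.1]
    have := Nat.lt_floor_add_one (-Real.logb 2 r)
    rw [← hk] at this
    linarith
  have h2 : r ≤ 2 ^ (-(k : ℤ)) := by
    rw [← Real.rpow_intCast, ← Real.logb_le_iff_le_rpow (by norm_num) hr.1]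
    have := Nat.floor_le hl
    rw [← hk] at this
    push_cast; linarith
  have hinv := hC x k r h1
  have h0 : weightMeasure d n α (Metric.ball (embed n x) r) ≠ 0 := fun h0 => by
    rw [h0, ENNReal.inv_zero, top_le_iff] at hinv
    exact ENNReal.mul_ne_top (by simp) (two_rpow_ne_top _) hinv
  have ht : weightMeasure d n α (Metric.ball (embed n x) r) ≠ ∞ := measure_ball_lt_top.ne
  have hint : IntegrableOn u (Metric.ball (embed n x) r) (weightMeasure d n α) :=
    (hu.integrableOn_isCompact (isCompact_closedBall _ _)).mono_set Metric.ball_subset_closedBall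
  refine (edist_triangle _ (c k) _).trans ?_
  simp only [Function.comp_apply, ← hk]
  gcongr
  rw [edist_eq_enorm_sub, ballMean]
  refine (enorm_setAverage_sub_le h0 ht hint _).trans ?_
  rw [← mul_assoc]
  exact mul_le_mul' hinv (lintegral_mono_set (Metric.ball_subset_ball h2))

variable {ψ : DyadicCube (Fin d ⊕ Fin n) → EuclideanSpace ℝ (Fin d ⊕ Fin n) → ℝ}

/-- At a Lebesgue point of `f` the means of the extension converge to the value of `f`. -/
theorem ae_tendsto_ballMean_whitneyExt (hψ : IsWhitneyBumpFamily ψ) (hn : 1 ≤ n) {α : ℝ}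
    (hα : -(n : ℝ) < α) {f : EuclideanSpace ℝ (Fin d) → ℂ} (hf : LocallyIntegrable f)
    (hu : LocallyIntegrable (whitneyExt ψ f) (weightMeasure d n α)) :
    ∀ᵐ x, Tendsto (ballMean (weightMeasure d n α) (whitneyExt ψ f) x) (𝓝[>] 0) (𝓝 (f x)) := by
  obtain ⟨C, A, hA, hC⟩ := exists_setLIntegral_whitneyExt_le (d := d) hψ hn hα le_rfl
  filter_upwards [ae_tendsto_closedBall hf] with x hx
  refine tendsto_ballMean hn hα hu x (c := fun _ => f x) tendsto_const_nhds ?_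
  have hv : ∀ k : ℕ, volume (Metric.closedBall x (A * 2 ^ (-(k : ℤ)))) =
      volume (Metric.ball (0 : EuclideanSpace ℝ (Fin d)) A) * (2 : ℝ≥0∞) ^ (-((k : ℝ) * d)) := by
    intro k
    have h1 := volume_ball_two_zpow x hA k
    rw [volume_ball_eq _ (by positivity), Fintype.card_fin] at h1
    rw [volume_closedBall_eq _ (by positivity), Fintype.card_fin, h1]
    push_cast; rfl
  set V := volume (Metric.ball (0 : EuclideanSpace ℝ (Fin d)) A) with hV
  have hVt : V ≠ ∞ := measure_ball_lt_top.ne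
  have hV0 : V ≠ 0 := (Metric.measure_ball_pos volume _ hA).ne'
  have hlim := ENNReal.Tendsto.const_mul (a := (C : ℝ≥0∞) * V)
    (hx.comp (tendsto_two_zpow_neg hA)) (Or.inr (ENNReal.mul_ne_top (by simp) hVt))
  rw [mul_zero] at hlim
  refine tendsto_of_tendsto_of_tendsto_of_le_of_le tendsto_const_nhds hlim
    (fun _ => zero_le) fun k => ?_
  have h1 := hC f hf x k (f x) (Or.inr (by
    rw [one_mul]; exact zpow_le_one_of_nonpos₀ (by norm_num) (by simp)))
  rw [one_mul] at h1
  calc _ ≤ (2 : ℝ≥0∞) ^ ((k : ℝ) * (d + n + α)) * (C * ((2 : ℝ≥0∞) ^ (-((k : ℝ) * (n + α))) *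
        ∫⁻ w in Metric.closedBall x (A * 2 ^ (-(k : ℤ))), ‖f w - f x‖ₑ)) := by
        refine mul_le_mul_right (h1.trans ?_) _
        gcongr
        exact Metric.ball_subset_closedBall
    _ = C * ((2 ^ ((k : ℝ) * (d + n + α)) * (2 : ℝ≥0∞) ^ (-((k : ℝ) * (n + α)))) *
        ∫⁻ w in Metric.closedBall x (A * 2 ^ (-(k : ℤ))), ‖f w - f x‖ₑ) := by ring
    _ = C * (2 ^ ((k : ℝ) * d) *
        ∫⁻ w in Metric.closedBall x (A * 2 ^ (-(k : ℤ))), ‖f w - f x‖ₑ) := by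
        rw [← two_rpow_add]; congr 3; ring
    _ = _ := by
        simp only [Function.comp_apply]
        rw [hv, ENNReal.div_eq_inv_mul, ENNReal.mul_inv (Or.inl hV0) (Or.inl hVt),
          ← ENNReal.rpow_neg, neg_neg, mul_assoc, mul_assoc, ← mul_assoc V,
          ENNReal.mul_inv_cancel hV0 hVt, one_mul]

end

/-! ### The trace -/

section

variable {d n : ℕ}

/-- The cube `Q × (-ℓ(Q), 0]^n`, one of the dyadic cubes of `ℝ^{d+n}` that touch the subspace
along `Q`. -/
def lift (n : ℕ) (Q : DyadicCube (Fin d)) : DyadicCube (Fin d ⊕ Fin n) where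
  level := Q.level
  corner := Sum.elim Q.corner fun _ => -1

theorem at_embed (k : ℤ) (x : EuclideanSpace ℝ (Fin d)) :
    DyadicCube.at_ k (embed n x) = lift n (DyadicCube.at_ k x) := by
  simp only [DyadicCube.at_, lift, embed, DyadicCube.mk.injEq, true_and]
  funext i
  cases i <;> simp

/-- Above the layer of generation `k`, the dyadic cubes of generation `k` touch the subspace. -/
theorem at_join_of_mem_negativeLayer {k : ℕ} (x : EuclideanSpace ℝ (Fin d))
    {v : EuclideanSpace ℝ (Fin n)} (hv : v ∈ negativeLayer n k) :
    DyadicCube.at_ k (join x v) = lift n (DyadicCube.at_ k x) := by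
  simp only [DyadicCube.at_, lift, join, DyadicCube.mk.injEq, true_and]
  funext i
  cases i with
  | inl i => simp
  | inr j =>
    have h := hv j
    have h2 : (0 : ℝ) < 2 ^ (k : ℤ) := by positivity
    have h3 : (2 : ℝ) ^ (k : ℤ) * 2 ^ (-(k : ℤ)) = 1 := by
      rw [← zpow_add₀ (by norm_num)]; simp
    have h4 : (0 : ℝ) < 2 ^ (-((k : ℤ) + 1)) := by positivity
    have h5 : ⌈(2 : ℝ) ^ (k : ℤ) * v j⌉ = 0 := by
      rw [Int.ceil_eq_iff]
      push_cast
      exact ⟨by nlinarith [h.1], by nlinarith [h.2]⟩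
    change ⌈(2 : ℝ) ^ (k : ℤ) * v j⌉ - 1 = -1
    rw [h5]; rfl

theorem neighbor_lift {Q Q' : DyadicCube (Fin d)} (h : Q.Neighbor Q') :
    (lift n Q).Neighbor (lift n Q') := by
  rw [DyadicCube.neighbor_iff] at *
  obtain ⟨h1, w, hw, hw'⟩ := h
  rw [DyadicCube.mem_closure_toSet] at hw hw'
  have hmem : ∀ Q : DyadicCube (Fin d), (∀ i, w i ∈ Icc (Q.edge * (Q.corner i : ℝ))
      (Q.edge * ((Q.corner i : ℝ) + 1))) → embed n w ∈ closure (lift n Q).toSet := by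
    intro Q hQ
    rw [DyadicCube.mem_closure_toSet]
    intro i
    cases i with
    | inl i => exact hQ i
    | inr j =>
      have he : 0 ≤ (lift n Q).edge := (DyadicCube.edge_pos _).le
      change (0 : ℝ) ∈ Icc ((lift n Q).edge * ((-1 : ℤ) : ℝ))
        ((lift n Q).edge * (((-1 : ℤ) : ℝ) + 1))
      simpa using he
  exact ⟨h1, embed n w, hmem Q hw, hmem Q' hw'⟩

theorem maxJump_lift_le (A : DyadicCube (Fin d ⊕ Fin n) → ℂ) (Q : DyadicCube (Fin d)) :
    maxJump (fun Q => A (lift n Q)) Q ≤ maxJump A (lift n Q) :=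
  iSup_le fun Q' => le_maxJump A (neighbor_lift Q'.2)

/-- The largest weighted jump over all scales at a point. -/
noncomputable def jumpSup {ι : Type} (s : ℝ) (A : DyadicCube ι → ℂ) (y : EuclideanSpace ℝ ι) :
    ℝ≥0∞ :=
  ⨆ k : ℕ, (2 : ℝ≥0∞) ^ ((k : ℝ) * s) * maxJump A (DyadicCube.at_ k y)

theorem measurable_jumpSup {ι : Type} [Fintype ι] (s : ℝ) (A : DyadicCube ι → ℂ) :
    Measurable (jumpSup s A) :=
  Measurable.iSup fun _ => (DyadicCube.measurable_comp_at _ _).const_mul _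

/-- Every Triebel--Lizorkin energy dominates the one with `q = ∞`. -/
theorem lintegral_jumpSup_rpow_le {ι : Type} [Fintype ι] {s p : ℝ} {q : ℝ≥0∞} (hp : 0 < p)
    (hq : 0 < q) (μ : Measure (EuclideanSpace ℝ ι)) (f : EuclideanSpace ℝ ι → ℂ) :
    ∫⁻ y, jumpSup s (fun P => ⨍ z in P.toSet, f z ∂μ) y ^ p ∂μ ≤ triebelEnergy s p q μ f ^ p := by
  rw [triebelEnergy, ← ENNReal.rpow_mul, one_div_mul_cancel hp.ne', ENNReal.rpow_one]
  refine lintegral_mono fun y => ENNReal.rpow_le_rpow (iSup_le fun k => ?_) hp.le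
  refine le_trans (mul_le_mul_right (iSup_le fun Q' => ?_) _) (le_lqNorm hq _ k)
  exact le_lqNorm hq (fun Q' : {Q' : DyadicCube ι // (DyadicCube.at_ k y).Neighbor Q'} =>
    avgDiff μ f (DyadicCube.at_ k y) Q'.1) Q'

theorem jumpTail_le_jumpSup {ι : Type} (s : ℝ) (A : DyadicCube ι → ℂ) (k : ℕ)
    (y : EuclideanSpace ℝ ι) :
    jumpTail A k y ≤
      (∑' j : ℕ, (2 : ℝ≥0∞) ^ (-(s * j))) * (2 ^ (-((k : ℝ) * s)) * jumpSup s A y) := by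
  rw [← ENNReal.tsum_mul_right, jumpTail]
  refine ENNReal.tsum_le_tsum fun j => ?_
  have h : (2 : ℝ≥0∞) ^ (((k + j : ℕ) : ℝ) * s) * maxJump A (DyadicCube.at_ ((k + j : ℕ) : ℤ) y) ≤
      jumpSup s A y :=
    le_iSup (fun k : ℕ => (2 : ℝ≥0∞) ^ ((k : ℝ) * s) * maxJump A (DyadicCube.at_ k y)) (k + j)
  calc maxJump A (DyadicCube.at_ ((k + j : ℕ) : ℤ) y)
      = 2 ^ (-(((k + j : ℕ) : ℝ) * s)) * (2 ^ (((k + j : ℕ) : ℝ) * s) *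
        maxJump A (DyadicCube.at_ ((k + j : ℕ) : ℤ) y)) := by
        rw [← mul_assoc, two_rpow_neg_mul, one_mul]
    _ ≤ 2 ^ (-(((k + j : ℕ) : ℝ) * s)) * jumpSup s A y := by gcongr
    _ = _ := by
        rw [← mul_assoc, ← two_rpow_add]; congr 2; push_cast; ring

theorem measurableSet_negativeLayer (n k : ℕ) : MeasurableSet (negativeLayer n k) := by
  rw [negativeLayer_eq]; exact DyadicCube.measurableSet_toSet _

theorem pairwise_disjoint_negativeLayer (hn : 1 ≤ n) :
    Pairwise (Function.onFun Disjoint (negativeLayer n)) := by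
  have h : ∀ k l : ℕ, k < l → Disjoint (negativeLayer n k) (negativeLayer n l) := by
    intro k l hkl
    rw [Set.disjoint_left]
    intro v hv hv'
    have h1 := (hv ⟨0, hn⟩).2
    have h2 := (hv' ⟨0, hn⟩).1
    have h3 : (2 : ℝ) ^ (-(l : ℤ)) ≤ 2 ^ (-((k : ℤ) + 1)) :=
      zpow_le_zpow_right₀ (by norm_num) (by omega)
    linarith
  intro k l hkl
  rcases lt_or_gt_of_ne hkl with h' | h'
  · exact h k l h'
  · exact (h l k h').symm

/-- The jumps at scale `k` along the subspace are seen by the jumps in the layer of generation `k`.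
The layers are disjoint, so the contributions of the scales add up, and at each point a supremum
over the scales suffices; this is why the trace space does not depend on `q`. -/
theorem exists_tsum_maxJump_lift_le (hn : 1 ≤ n) (α : ℝ) {s p : ℝ} (hp : 0 < p) :
    ∃ C : ℝ≥0, ∀ A : DyadicCube (Fin d ⊕ Fin n) → ℂ,
      ∑' k : ℕ, ∫⁻ x, ((2 : ℝ≥0∞) ^ ((k : ℝ) * (s - (α + n) / p)) *
        maxJump (fun Q : DyadicCube (Fin d) => A (lift n Q)) (DyadicCube.at_ k x)) ^ p ≤
      C * ∫⁻ y, jumpSup s A y ^ p ∂weightMeasure d n α := by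
  obtain ⟨c, hc, hlayer⟩ := exists_le_setLIntegral_negativeLayer hn α
  refine ⟨c⁻¹, fun A => ?_⟩
  have hSm : Measurable fun y : EuclideanSpace ℝ (Fin d ⊕ Fin n) => jumpSup s A y ^ p :=
    (measurable_jumpSup s A).pow_const p
  set G : EuclideanSpace ℝ (Fin n) → ℝ≥0∞ := fun v =>
    ENNReal.ofReal (weight n α v) * ∫⁻ x : EuclideanSpace ℝ (Fin d), jumpSup s A (join x v) ^ p
    with hG
  have hk : ∀ k : ℕ, c * ∫⁻ x, ((2 : ℝ≥0∞) ^ ((k : ℝ) * (s - (α + n) / p)) *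
        maxJump (fun Q : DyadicCube (Fin d) => A (lift n Q)) (DyadicCube.at_ k x)) ^ p ≤
      ∫⁻ v in negativeLayer n k, G v := by
    intro k
    set I := ∫⁻ x, ((2 : ℝ≥0∞) ^ ((k : ℝ) * s) *
      maxJump A (lift n (DyadicCube.at_ (k : ℤ) x))) ^ p with hI
    calc _ ≤ c * (2 ^ (-((k : ℝ) * (n + α))) * I) := by
          rw [hI, ← lintegral_const_mul' _ _ (two_rpow_ne_top _)]
          gcongr with x
          have h2 : (k : ℝ) * (s - (α + n) / p) * p = -((k : ℝ) * (n + α)) + (k : ℝ) * s * p := by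
            field_simp; ring
          rw [ENNReal.mul_rpow_of_nonneg _ _ hp.le, ENNReal.mul_rpow_of_nonneg _ _ hp.le,
            two_rpow_rpow, two_rpow_rpow, ← mul_assoc, ← two_rpow_add, h2]
          gcongr
          exact maxJump_lift_le A _
      _ ≤ (∫⁻ v in negativeLayer n k, ENNReal.ofReal (weight n α v)) * I := by
          rw [← mul_assoc]
          exact mul_le_mul_left (hlayer k) _
      _ = ∫⁻ v in negativeLayer n k, ENNReal.ofReal (weight n α v) * I :=
          (lintegral_mul_const _ (measurable_weight α).ennreal_ofReal).symm
      _ ≤ _ := by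
          refine setLIntegral_mono' (measurableSet_negativeLayer n k) fun v hv => ?_
          refine mul_le_mul_right (lintegral_mono fun x => ?_) _
          refine ENNReal.rpow_le_rpow ?_ hp.le
          rw [← at_join_of_mem_negativeLayer x hv]
          exact le_iSup (fun k : ℕ => (2 : ℝ≥0∞) ^ ((k : ℝ) * s) *
            maxJump A (DyadicCube.at_ k (join x v))) k
  have hsum := ENNReal.tsum_le_tsum hk
  rw [ENNReal.tsum_mul_left, ← lintegral_iUnion (measurableSet_negativeLayer n)
    (pairwise_disjoint_negativeLayer hn)] at hsum
  replace hsum := hsum.trans (setLIntegral_le_lintegral _ _)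
  rw [hG, ← lintegral_weightMeasure α hSm] at hsum
  rw [ENNReal.coe_inv hc.ne', ← ENNReal.div_eq_inv_mul,
    ENNReal.le_div_iff_mul_le (Or.inl (by simpa using hc.ne')) (Or.inl (by simp)), mul_comm]
  exact hsum

theorem measurable_embed :
    Measurable (embed n : EuclideanSpace ℝ (Fin d) → EuclideanSpace ℝ (Fin d ⊕ Fin n)) := by
  refine LipschitzWith.continuous (K := 1) (LipschitzWith.of_dist_le_mul fun x z => ?_)
    |>.measurable
  simpa using dist_embed_le (embed n x) z

/-- Fubini's theorem for the integrals over the balls centred on the subspace. -/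
theorem lintegral_setLIntegral_ball_embed_le (α : ℝ) (r : ℝ)
    {g : EuclideanSpace ℝ (Fin d ⊕ Fin n) → ℝ≥0∞} (hg : Measurable g) :
    ∫⁻ x : EuclideanSpace ℝ (Fin d), ∫⁻ y in Metric.ball (embed n x) r, g y ∂weightMeasure d n α ≤
      volume (Metric.ball (0 : EuclideanSpace ℝ (Fin d)) r) *
        ∫⁻ y, g y ∂weightMeasure d n α := by
  have h := lintegral_setLIntegral_ball_le (ν := (volume : Measure (EuclideanSpace ℝ (Fin d))))
    (μ := weightMeasure d n α) (c := embed n) (r := r) (g := g) (B := univ)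
    (V := volume (Metric.ball (0 : EuclideanSpace ℝ (Fin d)) r)) measurable_embed hg
    (fun _ => subset_univ _) (fun z _ => ?_) MeasurableSet.univ
  · rwa [Measure.restrict_univ] at h
  · rw [← Measure.addHaar_ball_center volume (basePart z)]
    refine measure_mono fun x hx => ?_
    rw [Metric.mem_ball, dist_comm]
    exact lt_of_le_of_lt (by simpa using dist_basePart_le z (embed n x)) hx

end

section

variable {d n : ℕ}

/-- Near the subspace, a function differs from its averages over the cubes touching the subspace by
at most the sum of its jumps at the finer scales. -/
theorem ae_enorm_sub_average_lift_le (hn : 1 ≤ n) {α : ℝ} (hα : -(n : ℝ) < α)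
    {f : EuclideanSpace ℝ (Fin d ⊕ Fin n) → ℂ} (hf : LocallyIntegrable f (weightMeasure d n α)) :
    ∀ᵐ y ∂weightMeasure d n α, ∀ (k : ℕ) (x : EuclideanSpace ℝ (Fin d)),
      y ∈ Metric.ball (embed n x) (2 ^ (-(k : ℤ))) →
      ‖f y - ⨍ z in (lift n (DyadicCube.at_ k x)).toSet, f z ∂weightMeasure d n α‖ₑ ≤
        2 * jumpTail (fun P => ⨍ z in P.toSet, f z ∂weightMeasure d n α) k y := by
  filter_upwards [ae_tendsto_average_at_weightMeasure hn hα hf] with y hy k x hyx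
  set A : DyadicCube (Fin d ⊕ Fin n) → ℂ := fun P => ⨍ z in P.toSet, f z ∂weightMeasure d n α
    with hA
  have h1 := edist_le_jumpTail (a := A) hy k
  have h2 : (DyadicCube.at_ (k : ℤ) y).Neighbor (lift n (DyadicCube.at_ k x)) := by
    rw [← at_embed]
    exact DyadicCube.neighbor_at_of_abs_le fun i =>
      (DyadicCube.abs_coord_sub_le _ _ i).trans (Metric.mem_ball.1 hyx).le
  have h3 := (le_maxJump A h2).trans (maxJump_le_jumpTail A k y)
  calc ‖f y - A (lift n (DyadicCube.at_ k x))‖ₑ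
      = ‖(A (DyadicCube.at_ k y) - A (lift n (DyadicCube.at_ k x))) -
          (A (DyadicCube.at_ k y) - f y)‖ₑ := by congr 1; ring
    _ ≤ _ := enorm_sub_le
    _ ≤ _ := by rw [two_mul]; exact add_le_add h3 h1

/-- The mean oscillations over the balls of radius `2 ^ (-k)` centred on the subspace tend to zero
at almost every point, since their `p`-th powers have summable integrals. -/
theorem ae_tendsto_setLIntegral_sub_average_lift (hn : 1 ≤ n) {α s p : ℝ} (hα : -(n : ℝ) < α)
    (hα' : α < s * p - n) (hs : 0 < s) (hp : 1 ≤ p)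
    {f : EuclideanSpace ℝ (Fin d ⊕ Fin n) → ℂ} (hf : LocallyIntegrable f (weightMeasure d n α))
    (hS : ∫⁻ y, jumpSup s (fun P => ⨍ z in P.toSet, f z ∂weightMeasure d n α) y ^ p
      ∂weightMeasure d n α ≠ ∞) :
    ∀ᵐ x : EuclideanSpace ℝ (Fin d), Tendsto (fun k : ℕ => (2 : ℝ≥0∞) ^ ((k : ℝ) * (d + n + α)) *
      ∫⁻ y in Metric.ball (embed n x) (2 ^ (-(k : ℤ))),
        ‖f y - ⨍ z in (lift n (DyadicCube.at_ k x)).toSet, f z ∂weightMeasure d n α‖ₑ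
          ∂weightMeasure d n α) atTop (𝓝 0) := by
  have hp0 : 0 < p := by linarith
  set A : DyadicCube (Fin d ⊕ Fin n) → ℂ := fun P => ⨍ z in P.toSet, f z ∂weightMeasure d n α
    with hA
  set S := jumpSup s A with hSdef
  have hSm : Measurable S := measurable_jumpSup s A
  obtain ⟨C₁, hC₁⟩ := exists_weightMeasure_ball_le (d := d) hn le_rfl hα
  set W : ℝ≥0∞ := 2 * ∑' j : ℕ, (2 : ℝ≥0∞) ^ (-(s * j)) with hW
  have hWt : W ≠ ∞ := ENNReal.mul_ne_top (by simp) (tsum_two_rpow_lt_top hs).ne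
  set V : ℝ≥0∞ := volume (Metric.ball (0 : EuclideanSpace ℝ (Fin d)) 1) with hV
  have hVt : V ≠ ∞ := measure_ball_lt_top.ne
  set K : ℝ≥0∞ := W ^ p * (C₁ : ℝ≥0∞) ^ (p - 1) with hK
  have hKt : K ≠ ∞ := ENNReal.mul_ne_top (ENNReal.rpow_ne_top_of_nonneg hp0.le hWt)
    (ENNReal.rpow_ne_top_of_nonneg (by linarith) (by simp))
  -- up to a constant, `U k` bounds the `p`-th power of the oscillation at scale `2 ^ (-k)`; its
  -- integral decays like `2 ^ (-(s p - n - α) k)`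
  set U : ℕ → EuclideanSpace ℝ (Fin d) → ℝ≥0∞ := fun k x =>
    (2 : ℝ≥0∞) ^ ((k : ℝ) * (d + n + α - s * p)) *
      ∫⁻ y in Metric.ball (embed n x) (2 ^ (-(k : ℤ))), S y ^ p ∂weightMeasure d n α with hU
  have hUm : ∀ k, Measurable (U k) := fun k =>
    (measurable_setLIntegral_ball measurable_embed _ (hSm.pow_const p)).const_mul _
  have hUint : ∫⁻ x, ∑' k, U k x ≠ ∞ := by
    rw [lintegral_tsum fun k => (hUm k).aemeasurable]
    refine ne_top_of_le_ne_top (b := ∑' k : ℕ, (2 : ℝ≥0∞) ^ (-((s * p - n - α) * k)) *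
      (V * ∫⁻ y, S y ^ p ∂weightMeasure d n α)) ?_ (ENNReal.tsum_le_tsum fun k => ?_)
    · rw [ENNReal.tsum_mul_right]
      exact ENNReal.mul_ne_top (tsum_two_rpow_lt_top (by linarith)).ne (ENNReal.mul_ne_top hVt hS)
    · have hv := volume_ball_two_zpow (0 : EuclideanSpace ℝ (Fin d)) one_pos k
      rw [one_mul, Fintype.card_fin] at hv
      simp only [hU]
      rw [lintegral_const_mul' _ _ (two_rpow_ne_top _)]
      calc _ ≤ (2 : ℝ≥0∞) ^ ((k : ℝ) * (d + n + α - s * p)) *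
            (V * 2 ^ (-((k : ℝ) * d)) * ∫⁻ y, S y ^ p ∂weightMeasure d n α) := by
            refine mul_le_mul_right ((lintegral_setLIntegral_ball_embed_le α _
              (hSm.pow_const p)).trans (le_of_eq ?_)) _
            rw [hv]; push_cast; rfl
        _ = ((2 : ℝ≥0∞) ^ ((k : ℝ) * (d + n + α - s * p)) * 2 ^ (-((k : ℝ) * d))) *
            (V * ∫⁻ y, S y ^ p ∂weightMeasure d n α) := by ring
        _ = _ := by rw [← two_rpow_add]; congr 2; ring
  have hae := ae_enorm_sub_average_lift_le hn hα hf
  filter_upwards [ae_lt_top (Measurable.tsum hUm) hUint] with x hx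
  have hU0 : Tendsto (fun k => U k x) atTop (𝓝 0) := by
    simpa [Nat.cofinite_eq_atTop] using ENNReal.tendsto_cofinite_zero_of_tsum_ne_top hx.ne
  have hlim : Tendsto (fun k => (K * U k x) ^ (1 / p)) atTop (𝓝 0) := by
    have h1 := ENNReal.Tendsto.const_mul (a := K) hU0 (Or.inr hKt)
    have h2 := h1.ennrpow_const (1 / p)
    rwa [mul_zero, ENNReal.zero_rpow_of_pos (by positivity)] at h2
  refine tendsto_of_tendsto_of_tendsto_of_le_of_le tendsto_const_nhds hlim
    (fun _ => zero_le) fun k => ?_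
  set B := Metric.ball (embed n x) ((2 : ℝ) ^ (-(k : ℤ))) with hB
  have h1 : ∫⁻ y in B, ‖f y - A (lift n (DyadicCube.at_ k x))‖ₑ ∂weightMeasure d n α ≤
      W * 2 ^ (-((k : ℝ) * s)) * ∫⁻ y in B, S y ∂weightMeasure d n α := by
    rw [← lintegral_const_mul' _ _ (ENNReal.mul_ne_top hWt (two_rpow_ne_top _))]
    refine lintegral_mono_ae ?_
    filter_upwards [ae_restrict_of_ae hae, ae_restrict_mem Metric.isOpen_ball.measurableSet]
      with y hy hyB
    calc _ ≤ 2 * jumpTail A k y := hy k x hyB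
      _ ≤ 2 * ((∑' j : ℕ, (2 : ℝ≥0∞) ^ (-(s * j))) * (2 ^ (-((k : ℝ) * s)) * S y)) :=
          mul_le_mul_right (jumpTail_le_jumpSup s A k y) _
      _ = _ := by rw [hW]; ring
  have h2 : (∫⁻ y in B, S y ∂weightMeasure d n α) ^ p ≤
      (C₁ : ℝ≥0∞) ^ (p - 1) * 2 ^ (-((k : ℝ) * (d + n + α) * (p - 1))) *
        ∫⁻ y in B, S y ^ p ∂weightMeasure d n α := by
    refine (rpow_lintegral_le hp hSm.aemeasurable).trans (mul_le_mul_left ?_ _)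
    rw [Measure.restrict_apply_univ]
    have h3 := hC₁ x (2 ^ (-(k : ℤ))) (by positivity)
      (zpow_le_one_of_nonpos₀ (by norm_num) (by simp))
    calc _ ≤ (C₁ * ENNReal.ofReal (((2 : ℝ) ^ (-(k : ℤ))) ^ (d + n + α))) ^ (p - 1) :=
          ENNReal.rpow_le_rpow h3 (by linarith)
      _ = _ := by
          rw [ENNReal.mul_rpow_of_nonneg _ _ (by linarith), ← Real.rpow_intCast,
            ← Real.rpow_mul (by norm_num), ofReal_two_rpow, two_rpow_rpow]
          congr 2; push_cast; ring
  rw [one_div, ENNReal.le_rpow_inv_iff hp0]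
  calc _ ≤ ((2 : ℝ≥0∞) ^ ((k : ℝ) * (d + n + α)) *
        (W * 2 ^ (-((k : ℝ) * s)) * ∫⁻ y in B, S y ∂weightMeasure d n α)) ^ p :=
        ENNReal.rpow_le_rpow (mul_le_mul_right h1 _) hp0.le
    _ = W ^ p * (2 ^ ((k : ℝ) * (d + n + α) * p) * 2 ^ (-((k : ℝ) * s) * p)) *
        (∫⁻ y in B, S y ∂weightMeasure d n α) ^ p := by
        rw [ENNReal.mul_rpow_of_nonneg _ _ hp0.le, ENNReal.mul_rpow_of_nonneg _ _ hp0.le,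
          ENNReal.mul_rpow_of_nonneg _ _ hp0.le, two_rpow_rpow, two_rpow_rpow]
        ring
    _ ≤ W ^ p * (2 ^ ((k : ℝ) * (d + n + α) * p) * 2 ^ (-((k : ℝ) * s) * p)) *
        ((C₁ : ℝ≥0∞) ^ (p - 1) * 2 ^ (-((k : ℝ) * (d + n + α) * (p - 1))) *
          ∫⁻ y in B, S y ^ p ∂weightMeasure d n α) := mul_le_mul_right h2 _
    _ = K * ((2 ^ ((k : ℝ) * (d + n + α) * p) * 2 ^ (-((k : ℝ) * s) * p) *
        2 ^ (-((k : ℝ) * (d + n + α) * (p - 1)))) *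
          ∫⁻ y in B, S y ^ p ∂weightMeasure d n α) := by rw [hK]; ring
    _ = _ := by
        simp only [hU]
        rw [← two_rpow_add, ← two_rpow_add]
        congr 3; ring

/-- The averages over the unit cubes touching the subspace are controlled by the `L^p` norm. -/
theorem exists_lintegral_average_lift_rpow_le (hn : 1 ≤ n) {α p : ℝ} (hα : -(n : ℝ) < α)
    (hp : 1 ≤ p) :
    ∃ C : ℝ≥0, ∀ f : EuclideanSpace ℝ (Fin d ⊕ Fin n) → ℂ,
      LocallyIntegrable f (weightMeasure d n α) →
      ∫⁻ x : EuclideanSpace ℝ (Fin d), ‖⨍ z in (lift n (DyadicCube.at_ ((0 : ℕ) : ℤ) x)).toSet, f z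
        ∂weightMeasure d n α‖ₑ ^ p ≤ C * ∫⁻ y, ‖f y‖ₑ ^ p ∂weightMeasure d n α := by
  have hp0 : 0 < p := by linarith
  set D : ℕ := Fintype.card (Fin d ⊕ Fin n) with hD
  have hD1 : (1 : ℝ) ≤ D := by
    rw [hD, Fintype.card_sum, Fintype.card_fin, Fintype.card_fin]
    exact_mod_cast le_add_left hn
  obtain ⟨C, hC⟩ := exists_inv_weightMeasure_toSet_le (d := d) hn α hD1
  set V : ℝ≥0∞ := volume (Metric.ball (0 : EuclideanSpace ℝ (Fin d)) (D + 1)) with hV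
  have hVt : V ≠ ∞ := measure_ball_lt_top.ne
  refine ⟨C * V.toNNReal, fun f hf => ?_⟩
  rw [ENNReal.coe_mul, ENNReal.coe_toNNReal hVt]
  have hfm := hf.aestronglyMeasurable
  set g : EuclideanSpace ℝ (Fin d ⊕ Fin n) → ℝ≥0∞ := fun y => ‖hfm.mk f y‖ₑ ^ p with hg
  have hgm : Measurable g := hfm.stronglyMeasurable_mk.measurable.enorm.pow_const p
  have hfg : ∀ᵐ y ∂weightMeasure d n α, ‖f y‖ₑ ^ p = g y :=
    hfm.ae_eq_mk.mono fun y hy => by simp only [hg]; rw [← hy]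
  rw [lintegral_congr_ae hfg]
  calc _ ≤ ∫⁻ x : EuclideanSpace ℝ (Fin d), C * ∫⁻ y in Metric.ball (embed n x) (D + 1), g y
        ∂weightMeasure d n α := by
        refine lintegral_mono fun x => ?_
        set P := lift n (DyadicCube.at_ ((0 : ℕ) : ℤ) x) with hP
        have hPx : P = DyadicCube.at_ ((0 : ℕ) : ℤ) (embed n x) := (at_embed _ x).symm
        have he : P.edge = 1 := by rw [hPx, DyadicCube.edge_at]; simp
        have hsub : P.toSet ⊆ Metric.closedBall (embed n x) D := fun z hz => by
          have hx : embed n x ∈ P.toSet := by rw [hPx]; exact DyadicCube.mem_at _ _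
          have h1 := DyadicCube.dist_le_of_mem (subset_closure hz) (subset_closure hx)
          rw [he, mul_one] at h1
          exact h1
        have hinv := hC P 0 x (by rw [hPx]; simp [DyadicCube.at_]) (by simpa using hsub)
        rw [Nat.cast_zero, zero_mul, ENNReal.rpow_zero, mul_one] at hinv
        have h0 := weightMeasure_toSet_ne_zero hn α P
        have ht := weightMeasure_toSet_ne_top hn hα P
        set μP := weightMeasure d n α P.toSet with hμP
        calc _ ≤ (μP⁻¹ * ∫⁻ y in P.toSet, ‖f y‖ₑ ∂weightMeasure d n α) ^ p :=
              ENNReal.rpow_le_rpow (enorm_setAverage_le h0 ht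
                (integrableOn_toSet_weightMeasure hf P)) hp0.le
          _ ≤ (μP⁻¹) ^ p * (μP ^ (p - 1) * ∫⁻ y in P.toSet, ‖f y‖ₑ ^ p ∂weightMeasure d n α) := by
              rw [ENNReal.mul_rpow_of_nonneg _ _ hp0.le]
              have h1 := rpow_lintegral_le (μ := (weightMeasure d n α).restrict P.toSet) hp
                hfm.restrict.enorm
              rw [Measure.restrict_apply_univ] at h1
              exact mul_le_mul_right h1 _
          _ = μP⁻¹ * ∫⁻ y in P.toSet, ‖f y‖ₑ ^ p ∂weightMeasure d n α := by
              rw [← mul_assoc, ENNReal.inv_rpow, ← ENNReal.rpow_neg, ← ENNReal.rpow_add _ _ h0 ht,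
                show -p + (p - 1) = -1 by ring, ENNReal.rpow_neg_one]
          _ ≤ _ := by
              rw [lintegral_congr_ae (ae_restrict_of_ae hfg)]
              exact mul_le_mul' hinv (lintegral_mono_set
                (hsub.trans (Metric.closedBall_subset_ball (by linarith))))
    _ ≤ C * (V * ∫⁻ y, g y ∂weightMeasure d n α) := by
        rw [lintegral_const_mul' _ _ (by simp)]
        exact mul_le_mul_right (lintegral_setLIntegral_ball_embed_le α _ hgm) _
    _ = _ := by rw [mul_assoc]

/-- The trace operator exists and maps the Triebel--Lizorkin space boundedly into the Besov
space. -/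
theorem exists_besovNorm_trace_le (hn : 1 ≤ n) {α s p : ℝ} {q : ℝ≥0∞} (hα : -(n : ℝ) < α)
    (hα' : α < s * p - n) (hs : 0 < s) (hp : 1 ≤ p) (hq : 0 < q) :
    ∃ C : ℝ≥0, ∀ f ∈ triebelSpace s p q (weightMeasure d n α),
      (∀ᵐ x : EuclideanSpace ℝ (Fin d), Tendsto (ballMean (weightMeasure d n α) f x) (𝓝[>] 0)
        (𝓝 (trace (weightMeasure d n α) f x))) ∧
      trace (weightMeasure d n α) f ∈ besovSpace (s - (α + n) / p) p (ENNReal.ofReal p) volume ∧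
      besovNorm (s - (α + n) / p) p (ENNReal.ofReal p) volume (trace (weightMeasure d n α) f) ≤
        C * triebelNorm s p q (weightMeasure d n α) f := by
  have hp0 : 0 < p := by linarith
  have hp1 : 1 ≤ ENNReal.ofReal p := by simpa using ENNReal.ofReal_le_ofReal hp
  set σ : ℝ := s - (α + n) / p with hσdef
  have hσ : 0 < σ := by
    rw [hσdef, sub_pos, div_lt_iff₀ hp0]; linarith
  have := isLocallyFiniteMeasure_weightMeasure (d := d) hn hα
  obtain ⟨m, hm⟩ := pow_unbounded_of_one_lt (3 * (Fintype.card (Fin d) : ℝ) + 1) one_lt_two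
  obtain ⟨C₁, hC₁⟩ := exists_tsum_maxJump_lift_le (d := d) hn α (s := s) hp0
  obtain ⟨C₂, hC₂⟩ := exists_lintegral_average_lift_rpow_le (d := d) hn hα hp
  obtain ⟨C₃, hC₃⟩ := exists_isOscBound (ι := Fin d) hp hσ m
  obtain ⟨C₄, hC₄⟩ := exists_besovEnergy_le (ι := Fin d) (σ := σ) hp hm.le
  set W : ℝ≥0∞ := (∑' j : ℕ, (2 : ℝ≥0∞) ^ (-(σ * j))) ^ p with hW
  have hWt : W ≠ ∞ := ENNReal.rpow_ne_top_of_nonneg hp0.le (tsum_two_rpow_lt_top hσ).ne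
  set K : ℝ≥0∞ := 2 ^ p * (C₂ + W * C₁) with hK
  have hKt : K ≠ ∞ := ENNReal.mul_ne_top (two_rpow_ne_top _)
    (ENNReal.add_ne_top.2 ⟨by simp, ENNReal.mul_ne_top hWt (by simp)⟩)
  refine ⟨K.toNNReal ^ (1 / p) + (C₄ * (C₃ * (K.toNNReal + C₁))) ^ (1 / p), fun f ⟨_, hfm, hfn⟩ =>
    ?_⟩
  set μ := weightMeasure d n α with hμ
  set T := triebelNorm s p q μ f with hT
  have hTt : T ^ p ≠ ∞ := ENNReal.rpow_ne_top_of_nonneg hp0.le hfn.ne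
  have hfp : ∫⁻ y, ‖f y‖ₑ ^ p ∂μ ≤ T ^ p := by
    rw [← eLpNorm_ofReal_rpow hp0]
    exact ENNReal.rpow_le_rpow le_self_add hp0.le
  have hf : LocallyIntegrable f μ :=
    MemLp.locallyIntegrable ⟨hfm, lt_of_le_of_lt le_self_add hfn⟩ hp1
  set A : DyadicCube (Fin d ⊕ Fin n) → ℂ := fun P => ⨍ z in P.toSet, f z ∂μ with hA
  set a : DyadicCube (Fin d) → ℂ := fun Q => A (lift n Q) with ha
  have hS : ∫⁻ y, jumpSup s A y ^ p ∂μ ≤ T ^ p :=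
    (lintegral_jumpSup_rpow_le hp0 hq μ f).trans (ENNReal.rpow_le_rpow le_add_self hp0.le)
  set J : ℝ≥0∞ := ∑' k : ℕ, ∫⁻ x, ((2 : ℝ≥0∞) ^ ((k : ℝ) * σ) *
    maxJump a (DyadicCube.at_ k x)) ^ p with hJ
  have hJT : J ≤ C₁ * T ^ p := (hC₁ A).trans (mul_le_mul_right hS _)
  have htail : ∫⁻ x, jumpTail a 0 x ^ p ≤ W * (C₁ * T ^ p) := by
    refine (lintegral_jumpTail_rpow_le (σ := σ) hp0 a 0).trans (mul_le_mul_right ?_ _)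
    refine le_trans (le_of_eq (tsum_congr fun j => ?_)) hJT
    simp only [zero_add, mul_comm σ]
  have hconv : ∀ᵐ x, Tendsto (fun k : ℕ => a (DyadicCube.at_ k x)) atTop (𝓝 (trace μ f x)) ∧
      Tendsto (ballMean μ f x) (𝓝[>] 0) (𝓝 (trace μ f x)) := by
    filter_upwards [ae_lt_top ((measurable_jumpTail a 0).pow_const p)
      (ne_top_of_le_ne_top (ENNReal.mul_ne_top hWt (ENNReal.mul_ne_top (by simp) hTt)) htail),
      ae_tendsto_setLIntegral_sub_average_lift hn hα hα' hs hp hf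
        (ne_top_of_le_ne_top hTt hS)] with x hx1 hx2
    have hx3 : jumpTail a 0 x ≠ ∞ := fun h => by
      rw [h, ENNReal.top_rpow_of_pos hp0] at hx1; exact lt_irrefl _ hx1
    have hx4 : ∑' k : ℕ, maxJump a (DyadicCube.at_ k x) ≠ ∞ := by
      simpa [jumpTail] using hx3
    obtain ⟨b, hb⟩ := cauchySeq_tendsto_of_complete
      (cauchySeq_of_edist_le_of_tsum_ne_top (f := fun k : ℕ => a (DyadicCube.at_ k x)) _
        (fun k => edist_at_succ_le a k x) hx4)
    have h1 := tendsto_ballMean hn hα hf x hb hx2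
    have h2 : trace μ f x = b := h1.limUnder_eq
    rw [h2]
    exact ⟨hb, h1⟩
  have htm : AEStronglyMeasurable (trace μ f) volume :=
    aestronglyMeasurable_of_tendsto_ae atTop (fun k : ℕ =>
      (DyadicCube.measurable_comp_at (k : ℤ) a).aestronglyMeasurable) (hconv.mono fun x hx => hx.1)
  -- the trace differs from the averages over unit cubes by at most the sum of all jumps
  have hLp : ∫⁻ x, ‖trace μ f x‖ₑ ^ p ≤ K * T ^ p := by
    calc _ ≤ ∫⁻ x, 2 ^ p * (‖a (DyadicCube.at_ ((0 : ℕ) : ℤ) x)‖ₑ ^ p + jumpTail a 0 x ^ p) := by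
          refine lintegral_mono_ae ?_
          filter_upwards [hconv] with x hx
          refine le_trans (ENNReal.rpow_le_rpow ?_ hp0.le) (add_rpow_le hp0 _ _)
          calc ‖trace μ f x‖ₑ = ‖a (DyadicCube.at_ ((0 : ℕ) : ℤ) x) -
                (a (DyadicCube.at_ ((0 : ℕ) : ℤ) x) - trace μ f x)‖ₑ := by congr 1; ring
            _ ≤ _ := enorm_sub_le
            _ ≤ _ := add_le_add le_rfl (edist_le_jumpTail hx.1 0)
      _ = 2 ^ p * ((∫⁻ x, ‖a (DyadicCube.at_ ((0 : ℕ) : ℤ) x)‖ₑ ^ p) +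
          ∫⁻ x, jumpTail a 0 x ^ p) := by
          rw [lintegral_const_mul' _ _ (two_rpow_ne_top _),
            lintegral_add_right _ ((measurable_jumpTail a 0).pow_const p)]
      _ ≤ 2 ^ p * (C₂ * T ^ p + W * (C₁ * T ^ p)) := by
          refine mul_le_mul_right (add_le_add ((hC₂ f hf).trans (mul_le_mul_right hfp _)) htail) _
      _ = _ := by rw [hK]; ring
  have heLp : eLpNorm (trace μ f) (ENNReal.ofReal p) volume ≤
      (K.toNNReal ^ (1 / p) : ℝ≥0) * T := by
    refine le_of_rpow_le hp0 ?_
    rwa [eLpNorm_ofReal_rpow hp0, ENNReal.coe_toNNReal hKt]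
  have htl : LocallyIntegrable (trace μ f) :=
    MemLp.locallyIntegrable ⟨htm, heLp.trans_lt (ENNReal.mul_lt_top (by simp) hfn)⟩ hp1
  obtain ⟨M, _, hM, hMsum⟩ := hC₃ a (trace μ f) htm (hconv.mono fun x hx => hx.1)
  have hE : besovEnergy σ p (ENNReal.ofReal p) volume (trace μ f) ≤
      ((C₄ * (C₃ * (K.toNNReal + C₁))) ^ (1 / p) : ℝ≥0) * T := by
    refine le_of_rpow_le hp0 ((hC₄ _ M htl hM).trans ?_)
    calc _ ≤ C₄ * (C₃ * (K * T ^ p + C₁ * T ^ p)) :=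
          mul_le_mul_right (hMsum.trans (mul_le_mul_right (add_le_add hLp hJT) _)) _
      _ = _ := by
          push_cast
          rw [ENNReal.coe_toNNReal hKt]; ring
  have hN : besovNorm σ p (ENNReal.ofReal p) volume (trace μ f) ≤
      (K.toNNReal ^ (1 / p) + (C₄ * (C₃ * (K.toNNReal + C₁))) ^ (1 / p) : ℝ≥0) * T := by
    rw [ENNReal.coe_add, add_mul]
    exact add_le_add heLp hE
  exact ⟨hconv.mono fun x hx => hx.2,
    ⟨htl, htm, hN.trans_lt (ENNReal.mul_lt_top (by simp) hfn)⟩, hN⟩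

end

end WhitneyTrace

theorem mainTheorem7 (d n : ℕ) (hd : 1 ≤ d) (hn : 1 ≤ n)
    (s p α : ℝ) (q : ENNReal) (hs0 : 0 < s) (hs1 : s < 1) (hp : 1 ≤ p) (hq : 0 < q)
    (hα0 : -(n : ℝ) < α) (hα1 : α < s * p - n)
    (ψ : WhitneyTrace.DyadicCube (Fin d ⊕ Fin n) → EuclideanSpace ℝ (Fin d ⊕ Fin n) → ℝ)
    (hψ : WhitneyTrace.IsWhitneyBumpFamily ψ) :
    WhitneyTrace.IsWhitneyTraceExtensionPair ψ (WhitneyTrace.weightMeasure d n α)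
      (WhitneyTrace.besovSpace (s - (α + n) / p) p (ENNReal.ofReal p)
        (MeasureTheory.volume : MeasureTheory.Measure (EuclideanSpace ℝ (Fin d))))
      (WhitneyTrace.besovNorm (s - (α + n) / p) p (ENNReal.ofReal p) MeasureTheory.volume)
      (WhitneyTrace.triebelSpace s p q (WhitneyTrace.weightMeasure d n α))
      (WhitneyTrace.triebelNorm s p q (WhitneyTrace.weightMeasure d n α)) := by
  obtain ⟨C₁, hC₁⟩ := WhitneyTrace.exists_triebelNorm_whitneyExt_le hψ hn hα0 hα1 hs1 hp hq
  obtain ⟨C₂, hC₂⟩ := WhitneyTrace.exists_besovNorm_trace_le (d := d) hn hα0 hα1 hs0 hp hq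
  have := WhitneyTrace.isLocallyFiniteMeasure_weightMeasure (d := d) hn hα0
  refine ⟨fun f hf => (hC₁ f hf).1, ⟨C₁, fun f hf => (hC₁ f hf).2⟩, fun f hf => (hC₂ f hf).1,
    fun f hf => (hC₂ f hf).2.1.1, fun f hf => (hC₂ f hf).2.1, ⟨C₂, fun f hf => (hC₂ f hf).2.2⟩,
    fun f hf => ?_⟩
  obtain ⟨_, hm, hN⟩ := (hC₁ f hf).1
  have hu : MeasureTheory.LocallyIntegrable (WhitneyTrace.whitneyExt ψ f)
      (WhitneyTrace.weightMeasure d n α) :=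
    MeasureTheory.MemLp.locallyIntegrable ⟨hm, lt_of_le_of_lt le_self_add hN⟩
      (by simpa using ENNReal.ofReal_le_ofReal hp)
  filter_upwards [WhitneyTrace.ae_tendsto_ballMean_whitneyExt hψ hn hα0 hf.1 hu] with x hx
  exact hx.limUnder_eq
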